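/- **Proposition 3.5 (twist invariance of $A\diamond H_0$).** *Conventions.* Let $k$ be a field; algebras, $\otimes$, etc. are over $k$. A quasi-Hopf algebra is a unital associative algebra $H$ with algebra maps $\Delta:H\to H\otimes H$, $\varepsilon:H\to k$, an invertible $\Phi\in H^{\otimes 3}$, an algebra anti-automorphism $S$ of $H$ and elements $\alpha,\beta\in H$ such that, for all $h\in H$, $(id\otimes\Delta)(\Delta(h))=\Phi(\Delta\otimes id)(\Delta(h))\Phi^{-1}$, $(id\otimes\varepsilon)\Delta(h)=h\otimes 1$, $(\varepsilon\otimes id)\Delta(h)=1\otimes h$, $(1\otimes\Phi)(id\otimes\Delta\otimes id)(\Phi)(\Phi\otimes 1)=(id\otimes id\otimes\Delta)(\Phi)(\Delta\otimes id\otimes id)(\Phi)$, $\varepsilon$ applied to any one leg of $\Phi$ gives $1\otimes 1$, $S(h_1)\alpha h_2=\varepsilon(h)\alpha$, $h_1\beta S(h_2)=\varepsilon(h)\beta$, $X^1\beta S(X^2)\alpha X^3=1$ and $S(x^1)\alpha x^2\beta S(x^3)=1$. Here $\Delta(h)=h_1\otimes h_2$, $\Phi=X^1\otimes X^2\otimes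 X^3=Y^1\otimes Y^2\otimes Y^3$ and $\Phi^{-1}=x^1\otimes x^2\otimes x^3$. A gauge transformation is an invertible $F=F^1\otimes F^2\in H\otimes H$ with $(\varepsilon\otimes id)(F)=(id\otimes\varepsilon)(F)=1$; write $F^{-1}=G^1\otimes G^2$. The twist $H_F$ is the algebra $H$ with the same $\varepsilon$ and $S$ and with $\Delta_F(h)=F\Delta(h)F^{-1}$, $\Phi_F=(1\otimes F)(id\otimes\Delta)(F)\,\Phi\,(\Delta\otimes id)(F^{-1})(F^{-1}\otimes 1)$, $\alpha_F=S(G^1)\alpha G^2$, $\beta_F=F^1\beta S(F^2)$. A left $H$-module algebra is an $H$-module $A$ with a bilinear multiplication and a two-sided unit $1_A$ such that $(aa')a''=(X^1\cdot a)[(X^2\cdot a')(X^3\cdot a'')]$, $h\cdot(aa')=(h_1\cdot a)(h_2\cdot a')$ and $h\cdot 1_A=\varepsilon(h)1_A$. For such $A$, $A_{F^{-1}}$ is the same $H$-module with the same unit and the multiplication $a\bullet a'=(G^1\cdot a)(G^2\cdot a')$. An isomorphism of left $H$-module algebras is a linear bijection preserving action, multiplication and unit. $H_0$ is the vector space $H$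 with action $h\triangleright h'=h_1h'S(h_2)$, unit $\beta$ and multiplication $h*h'=X^1hS(x^1X^2)\alpha x^2X^3_1h'S(x^3X^3_2)$. It carries the coaction $$h\mapsto h_{(-1)}\otimes h_{(0)}=X^1Y^1_1h_1g^1S(q^2Y^2_2)Y^3\otimes X^2Y^1_2h_2g^2S(X^3q^1Y^2_1),$$ where $q^1\otimes q^2=X^1\otimes S^{-1}(\alpha X^3)X^2$, $g^1\otimes g^2=\Delta(S(x^1)\alpha x^2)\,\delta\,(S\otimes S)(\Delta^{cop}(x^3))$, $\delta=B^1\beta S(B^4)\otimes B^2\beta S(B^3)$ and $B^1\otimes B^2\otimes B^3\otimes B^4=(\Delta\otimes id\otimes id)(\Phi)(\Phi^{-1}\otimes 1)$. For a left $H$-module algebra $A$, $A\diamond H_0$ is the twisted tensor product $A\otimes_R H_0$ in the monoidal category of left $H$-modules (associativity constraint $a_{U,V,W}((u\otimes v)\otimes w)=\Phi\cdot(u\otimes(v\otimes w))$) afforded by $R:H_0\otimes A\to A\otimes H_0$, $R(h\otimes a)=h_{(-1)}\cdot a\otimes h_{(0)}$. That is, it is the vector space $A\otimes H$ with action $h\cdot(a\otimes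 h')=h_1\cdot a\otimes h_2\triangleright h'$, unit $1_A\otimes\beta$ and multiplication (with $\mu_A,\mu_{H_0}$ the multiplications of $A$ and $H_0$) $$(\mu_A\otimes\mu_{H_0})\circ a^{-1}_{A,A,H_0\otimes H_0}\circ(id\otimes a_{A,H_0,H_0})\circ(id\otimes R\otimes id)\circ(id\otimes a^{-1}_{H_0,A,H_0})\circ a_{A,H_0,A\otimes H_0}.$$ *Statement.* Let $H$ be a quasi-Hopf algebra, $F\in H\otimes H$ a gauge transformation and $A$ a left $H$-module algebra. Then $H_F$ is a quasi-Hopf algebra, $A\diamond H_0$ is a left $H$-module algebra, $A_{F^{-1}}$, $(A\diamond H_0)_{F^{-1}}$ and $A_{F^{-1}}\diamond(H_F)_0$ are left $H_F$-module algebras, and $$(A\diamond H_0)_{F^{-1}}\;\simeq\;A_{F^{-1}}\diamond(H_F)_0$$ as left $H_F$-module algebras. -/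

import Mathlib

open scoped TensorProduct

noncomputable section

namespace QuasiHopf

/-- The tensor product of a representation `ρ` of the algebra `B` on `U` and a representation `σ`
of the algebra `C` on `V`: `B ⊗ C` acts on `U ⊗ V` by `(b ⊗ c) · (u ⊗ v) = (b · u) ⊗ (c · v)`. -/
def tensAct {k B C U V : Type*} [Field k] [Ring B] [Algebra k B] [Ring C] [Algebra k C]
    [AddCommGroup U] [Module k U] [AddCommGroup V] [Module k V]
    (ρ : B →ₐ[k] Module.End k U) (σ : C →ₐ[k] Module.End k V) :
    B ⊗[k] C →ₐ[k] Module.End k (U ⊗[k] V) :=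
  Module.endTensorEndAlgHom.comp (Algebra.TensorProduct.map ρ σ)

theorem tensAct_tmul {k B C U V : Type*} [Field k] [Ring B] [Algebra k B] [Ring C] [Algebra k C]
    [AddCommGroup U] [Module k U] [AddCommGroup V] [Module k V]
    (ρ : B →ₐ[k] Module.End k U) (σ : C →ₐ[k] Module.End k V) (b : B) (c : C) (u : U) (v : V) :
    tensAct ρ σ (b ⊗ₜ c) (u ⊗ₜ v) = ρ b u ⊗ₜ σ c v :=
  rfl

/-- The data of a quasi-bialgebra on a unital associative `k`-algebra `H`. The threefold tensor
power of `H` is bracketed as `H ⊗ (H ⊗ H)`. The laws are in `IsQuasiBialgebra`. -/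
structure QuasiBialgebraData (k H : Type*) [Field k] [Ring H] [Algebra k H] where
  /-- the comultiplication `Δ` -/
  comul : H →ₐ[k] H ⊗[k] H
  /-- the counit `ε` -/
  counit : H →ₐ[k] k
  /-- the reassociator `Φ`, an invertible element -/
  Phi : (H ⊗[k] (H ⊗[k] H))ˣ

section LegMaps

variable {k H : Type*} [Field k] [Ring H] [Algebra k H]

/-- `b ↦ 1 ⊗ b`. -/
def oneTensor (B : Type*) [Ring B] [Algebra k B] : B →ₐ[k] H ⊗[k] B :=
  Algebra.TensorProduct.includeRight

/-- `a ⊗ b ↦ a ⊗ b ⊗ 1`. -/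
def tensorOne₂ : H ⊗[k] H →ₐ[k] H ⊗[k] (H ⊗[k] H) :=
  Algebra.TensorProduct.map (AlgHom.id k H) Algebra.TensorProduct.includeLeft

/-- `a ⊗ b ⊗ c ↦ a ⊗ b ⊗ c ⊗ 1`. -/
def tensorOne₃ : H ⊗[k] (H ⊗[k] H) →ₐ[k] H ⊗[k] (H ⊗[k] (H ⊗[k] H)) :=
  Algebra.TensorProduct.map (AlgHom.id k H) tensorOne₂

/-- `f ⊗ id`, for `f : H → H ⊗ H`, with values rebracketed to the right:
`a ⊗ b ↦ f(a)₁ ⊗ (f(a)₂ ⊗ b)`. -/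
def leftLeg (B : Type*) [Ring B] [Algebra k B] (f : H →ₐ[k] H ⊗[k] H) :
    H ⊗[k] B →ₐ[k] H ⊗[k] (H ⊗[k] B) :=
  (Algebra.TensorProduct.assoc k k k H H B).toAlgHom.comp
    (Algebra.TensorProduct.map f (AlgHom.id k B))

/-- `id ⊗ f`: `a ⊗ b ↦ a ⊗ f(b)`. -/
def rightLeg {B C : Type*} [Ring B] [Algebra k B] [Ring C] [Algebra k C] (f : B →ₐ[k] C) :
    H ⊗[k] B →ₐ[k] H ⊗[k] C :=
  Algebra.TensorProduct.map (AlgHom.id k H) f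

end LegMaps

namespace QuasiBialgebraData

variable {k H : Type*} [Field k] [Ring H] [Algebra k H]

/-- The axioms of a quasi-bialgebra. -/
structure IsQuasiBialgebra (Q : QuasiBialgebraData k H) : Prop where
  /-- `(id ⊗ Δ)(Δ(h)) = Φ (Δ ⊗ id)(Δ(h)) Φ⁻¹` -/
  quasi_coassoc : ∀ h : H, rightLeg Q.comul (Q.comul h) =
    (Q.Phi : H ⊗[k] (H ⊗[k] H)) * leftLeg H Q.comul (Q.comul h) *
      (Q.Phi⁻¹ : (H ⊗[k] (H ⊗[k] H))ˣ)
  /-- `(id ⊗ ε)(Δ(h)) = h ⊗ 1` -/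
  id_counit : ∀ h : H, Algebra.TensorProduct.map (AlgHom.id k H) Q.counit (Q.comul h) =
    h ⊗ₜ[k] (1 : k)
  /-- `(ε ⊗ id)(Δ(h)) = 1 ⊗ h` -/
  counit_id : ∀ h : H, Algebra.TensorProduct.map Q.counit (AlgHom.id k H) (Q.comul h) =
    (1 : k) ⊗ₜ[k] h
  /-- `(1 ⊗ Φ)(id ⊗ Δ ⊗ id)(Φ)(Φ ⊗ 1) = (id ⊗ id ⊗ Δ)(Φ)(Δ ⊗ id ⊗ id)(Φ)` -/
  pentagon : oneTensor (H ⊗[k] (H ⊗[k] H)) (Q.Phi : H ⊗[k] (H ⊗[k] H)) *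
      rightLeg (leftLeg H Q.comul) (Q.Phi : H ⊗[k] (H ⊗[k] H)) *
      tensorOne₃ (Q.Phi : H ⊗[k] (H ⊗[k] H)) =
    rightLeg (rightLeg Q.comul) (Q.Phi : H ⊗[k] (H ⊗[k] H)) *
      leftLeg (H ⊗[k] H) Q.comul (Q.Phi : H ⊗[k] (H ⊗[k] H))
  /-- `(ε ⊗ id ⊗ id)(Φ) = 1` -/
  counit_Phi₁ : Algebra.TensorProduct.map Q.counit (AlgHom.id k (H ⊗[k] H))
    (Q.Phi : H ⊗[k] (H ⊗[k] H)) = 1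
  /-- `(id ⊗ ε ⊗ id)(Φ) = 1` -/
  counit_Phi₂ : Algebra.TensorProduct.map (AlgHom.id k H)
    (Algebra.TensorProduct.map Q.counit (AlgHom.id k H)) (Q.Phi : H ⊗[k] (H ⊗[k] H)) = 1
  /-- `(id ⊗ id ⊗ ε)(Φ) = 1` -/
  counit_Phi₃ : Algebra.TensorProduct.map (AlgHom.id k H)
    (Algebra.TensorProduct.map (AlgHom.id k H) Q.counit) (Q.Phi : H ⊗[k] (H ⊗[k] H)) = 1

/-- An invertible element `F` of `H ⊗ H` is a gauge transformation if
`(ε ⊗ id)(F) = 1` and `(id ⊗ ε)(F) = 1`. -/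
structure IsGaugeTransformation (Q : QuasiBialgebraData k H) (F : (H ⊗[k] H)ˣ) : Prop where
  counit_id : Algebra.TensorProduct.map Q.counit (AlgHom.id k H) (F : H ⊗[k] H) = 1
  id_counit : Algebra.TensorProduct.map (AlgHom.id k H) Q.counit (F : H ⊗[k] H) = 1

/-- The quasi-bialgebra data of the twist `H_F`: the counit is unchanged,
`Δ_F(h) = F Δ(h) F⁻¹` and `Φ_F = (1 ⊗ F)(id ⊗ Δ)(F) Φ (Δ ⊗ id)(F⁻¹)(F⁻¹ ⊗ 1)`. -/
def twist (Q : QuasiBialgebraData k H) (F : (H ⊗[k] H)ˣ) : QuasiBialgebraData k H where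
  comul := AlgHom.ofLinearMap
    (LinearMap.mulLeft k (F : H ⊗[k] H) ∘ₗ
      LinearMap.mulRight k ((F⁻¹ : (H ⊗[k] H)ˣ) : H ⊗[k] H) ∘ₗ Q.comul.toLinearMap)
    (by simp) (by intro x y; simp [mul_assoc])
  counit := Q.counit
  Phi := Units.map (oneTensor (k := k) (H := H) (H ⊗[k] H)).toMonoidHom F *
    Units.map (rightLeg (H := H) Q.comul).toMonoidHom F * Q.Phi *
    Units.map (leftLeg H Q.comul).toMonoidHom F⁻¹ *
    Units.map (tensorOne₂ (k := k) (H := H)).toMonoidHom F⁻¹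

theorem twist_comul (Q : QuasiBialgebraData k H) (F : (H ⊗[k] H)ˣ) (h : H) :
    (Q.twist F).comul h = F * Q.comul h * ((F⁻¹ : (H ⊗[k] H)ˣ) : H ⊗[k] H) := by
  simp [twist, mul_assoc]

section Monoidal

variable {U V W : Type*} [AddCommGroup U] [Module k U] [AddCommGroup V] [Module k V]
  [AddCommGroup W] [Module k W]

/-- The `H`-action on a tensor product of two `H`-modules, `h · (u ⊗ v) = h₁ · u ⊗ h₂ · v`. -/
def diagAct (Q : QuasiBialgebraData k H) (ρ : H →ₐ[k] Module.End k U)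
    (σ : H →ₐ[k] Module.End k V) : H →ₐ[k] Module.End k (U ⊗[k] V) :=
  (tensAct ρ σ).comp Q.comul

/-- The associativity constraint `a : (U ⊗ V) ⊗ W → U ⊗ (V ⊗ W)` of the category of left
`H`-modules, `(u ⊗ v) ⊗ w ↦ Φ · (u ⊗ (v ⊗ w))`. -/
def assocMap (Q : QuasiBialgebraData k H) (ρ : H →ₐ[k] Module.End k U)
    (σ : H →ₐ[k] Module.End k V) (τ : H →ₐ[k] Module.End k W) :
    (U ⊗[k] V) ⊗[k] W →ₗ[k] U ⊗[k] (V ⊗[k] W) :=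
  tensAct ρ (tensAct σ τ) (Q.Phi : H ⊗[k] (H ⊗[k] H)) ∘ₗ
    (TensorProduct.assoc k U V W).toLinearMap

/-- The inverse `U ⊗ (V ⊗ W) → (U ⊗ V) ⊗ W` of the associativity constraint. -/
def assocInv (Q : QuasiBialgebraData k H) (ρ : H →ₐ[k] Module.End k U)
    (σ : H →ₐ[k] Module.End k V) (τ : H →ₐ[k] Module.End k W) :
    U ⊗[k] (V ⊗[k] W) →ₗ[k] (U ⊗[k] V) ⊗[k] W :=
  (TensorProduct.assoc k U V W).symm.toLinearMap ∘ₗ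
    tensAct ρ (tensAct σ τ) ((Q.Phi⁻¹ : (H ⊗[k] (H ⊗[k] H))ˣ) : H ⊗[k] (H ⊗[k] H))

theorem assocMap_assocInv (Q : QuasiBialgebraData k H) (ρ : H →ₐ[k] Module.End k U)
    (σ : H →ₐ[k] Module.End k V) (τ : H →ₐ[k] Module.End k W) (x : U ⊗[k] (V ⊗[k] W)) :
    Q.assocMap ρ σ τ (Q.assocInv ρ σ τ x) = x := by
  simp [assocMap, assocInv, ← Module.End.mul_apply, ← map_mul]

end Monoidal

end QuasiBialgebraData

/-- The data of a quasi-Hopf algebra: in addition to the data of a quasi-bialgebra, an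
anti-automorphism `S` of the algebra `H` and elements `α`, `β`. -/
structure QuasiHopfData (k H : Type*) [Field k] [Ring H] [Algebra k H] extends
    QuasiBialgebraData k H where
  /-- the antipode `S` -/
  antipode : H ≃ₐ[k] Hᵐᵒᵖ
  /-- the element `α` -/
  alpha : H
  /-- the element `β` -/
  beta : H

/-- The data of a left `H`-module algebra on a vector space `A`: a left `H`-action,
a multiplication and a unit. The laws are in `IsModuleAlgebra`. -/
structure ModuleAlgebraData (k H A : Type*) [Field k] [Ring H] [Algebra k H]
    [AddCommGroup A] [Module k A] where
  /-- the action of `H` -/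
  act : H →ₐ[k] Module.End k A
  /-- the multiplication -/
  mul : A ⊗[k] A →ₗ[k] A
  /-- the unit -/
  one : A

namespace QuasiHopfData

variable {k H : Type*} [Field k] [Ring H] [Algebra k H]

/-- The antipode as a linear map `S : H → H`. -/
def S (Q : QuasiHopfData k H) : H →ₗ[k] H :=
  (MulOpposite.opLinearEquiv k).symm.toLinearMap ∘ₗ Q.antipode.toLinearMap

/-- The inverse `S⁻¹ : H → H` of the antipode. -/
def Sinv (Q : QuasiHopfData k H) : H →ₗ[k] H :=
  Q.antipode.symm.toLinearMap ∘ₗ (MulOpposite.opLinearEquiv k).toLinearMap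

theorem S_Sinv (Q : QuasiHopfData k H) (h : H) : Q.S (Q.Sinv h) = h := by
  simp [S, Sinv]

theorem Sinv_S (Q : QuasiHopfData k H) (h : H) : Q.Sinv (Q.S h) = h := by
  simp [S, Sinv]

theorem S_mul (Q : QuasiHopfData k H) (a b : H) : Q.S (a * b) = Q.S b * Q.S a := by
  simp [S]

/-- `a ⊗ b ↦ S(a) c b`. -/
def SMul (Q : QuasiHopfData k H) (c : H) : H ⊗[k] H →ₗ[k] H :=
  LinearMap.mul' k H ∘ₗ TensorProduct.map (LinearMap.mulRight k c ∘ₗ Q.S) LinearMap.id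

theorem SMul_tmul (Q : QuasiHopfData k H) (c a b : H) : Q.SMul c (a ⊗ₜ b) = Q.S a * c * b := by
  simp [SMul]

/-- `a ⊗ b ↦ a c S(b)`. -/
def MulS (Q : QuasiHopfData k H) (c : H) : H ⊗[k] H →ₗ[k] H :=
  LinearMap.mul' k H ∘ₗ TensorProduct.map (LinearMap.mulRight k c) Q.S

theorem MulS_tmul (Q : QuasiHopfData k H) (c a b : H) : Q.MulS c (a ⊗ₜ b) = a * c * Q.S b := by
  simp [MulS]

/-- The axioms of a quasi-Hopf algebra. -/
structure IsQuasiHopf (Q : QuasiHopfData k H) : Prop where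
  isQuasiBialgebra : Q.toQuasiBialgebraData.IsQuasiBialgebra
  /-- `S(h₁) α h₂ = ε(h) α` -/
  antipode_left : ∀ h : H, Q.SMul Q.alpha (Q.comul h) = Q.counit h • Q.alpha
  /-- `h₁ β S(h₂) = ε(h) β` -/
  antipode_right : ∀ h : H, Q.MulS Q.beta (Q.comul h) = Q.counit h • Q.beta
  /-- `X¹ β S(X²) α X³ = 1`, where `Φ = X¹ ⊗ X² ⊗ X³` -/
  antipode_Phi : LinearMap.mul' k H (TensorProduct.map (LinearMap.mulRight k Q.beta)
    (Q.SMul Q.alpha) (Q.Phi : H ⊗[k] (H ⊗[k] H))) = 1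
  /-- `S(x¹) α x² β S(x³) = 1`, where `Φ⁻¹ = x¹ ⊗ x² ⊗ x³` -/
  antipode_Phi_inv : LinearMap.mul' k H (TensorProduct.map (LinearMap.mulRight k Q.alpha ∘ₗ Q.S)
    (Q.MulS Q.beta) ((Q.Phi⁻¹ : (H ⊗[k] (H ⊗[k] H))ˣ) : H ⊗[k] (H ⊗[k] H))) = 1

/-- The twist `H_F` of a quasi-Hopf algebra: the antipode is unchanged,
`α_F = S(G¹) α G²` and `β_F = F¹ β S(F²)`, where `F = F¹ ⊗ F²` and `F⁻¹ = G¹ ⊗ G²`. -/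
def twist (Q : QuasiHopfData k H) (F : (H ⊗[k] H)ˣ) : QuasiHopfData k H where
  toQuasiBialgebraData := Q.toQuasiBialgebraData.twist F
  antipode := Q.antipode
  alpha := Q.SMul Q.alpha ((F⁻¹ : (H ⊗[k] H)ˣ) : H ⊗[k] H)
  beta := Q.MulS Q.beta (F : H ⊗[k] H)

/-- The action of `H ⊗ H` on `H` by `(a ⊗ b) · h = a h S(b)`. -/
def sandwich (Q : QuasiHopfData k H) : H ⊗[k] H →ₐ[k] Module.End k H :=
  Algebra.TensorProduct.lift (Algebra.lmul k H)
    ((Algebra.lsmul k k H : Hᵐᵒᵖ →ₐ[k] Module.End k H).comp Q.antipode.toAlgHom)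
    (by
      intro a b
      refine LinearMap.ext fun h => ?_
      simp [Module.End.mul_apply, MulOpposite.smul_eq_mul_unop, mul_assoc])

theorem sandwich_tmul (Q : QuasiHopfData k H) (a b h : H) :
    Q.sandwich (a ⊗ₜ b) h = a * h * Q.S b := by
  rw [mul_assoc, sandwich]
  erw [Algebra.TensorProduct.lift_tmul]
  simp [S, Module.End.mul_apply, MulOpposite.smul_eq_mul_unop]

/-- `a ⊗ b ↦ S(b) ⊗ S(a)`. -/
def flipS (Q : QuasiHopfData k H) : H ⊗[k] H →ₗ[k] H ⊗[k] H :=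
  TensorProduct.map Q.S Q.S ∘ₗ (TensorProduct.comm k H H).toLinearMap

/-- `b₁ ⊗ b₂ ⊗ b₃ ⊗ b₄ ↦ b₁ β S(b₄) ⊗ b₂ β S(b₃)`. -/
def deltaMap (Q : QuasiHopfData k H) : H ⊗[k] (H ⊗[k] (H ⊗[k] H)) →ₗ[k] H ⊗[k] H :=
  TensorProduct.map (Q.MulS Q.beta) (Q.MulS Q.beta) ∘ₗ
    (TensorProduct.assoc k H H (H ⊗[k] H)).symm.toLinearMap ∘ₗ
    TensorProduct.map LinearMap.id
      ((TensorProduct.comm k (H ⊗[k] H) H).toLinearMap ∘ₗ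
        (TensorProduct.assoc k H H H).symm.toLinearMap)

theorem deltaMap_tmul (Q : QuasiHopfData k H) (a b c d : H) :
    Q.deltaMap (a ⊗ₜ (b ⊗ₜ (c ⊗ₜ d))) =
      (a * Q.beta * Q.S d) ⊗ₜ (b * Q.beta * Q.S c) := by
  simp [deltaMap, MulS_tmul]

/-- `δ = B¹ β S(B⁴) ⊗ B² β S(B³)`, where
`B¹ ⊗ B² ⊗ B³ ⊗ B⁴ = (Δ ⊗ id ⊗ id)(Φ)(Φ⁻¹ ⊗ 1)`. -/
def delta (Q : QuasiHopfData k H) : H ⊗[k] H :=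
  Q.deltaMap (leftLeg (H ⊗[k] H) Q.comul (Q.Phi : H ⊗[k] (H ⊗[k] H)) *
    tensorOne₃ ((Q.Phi⁻¹ : (H ⊗[k] (H ⊗[k] H))ˣ) : H ⊗[k] (H ⊗[k] H)))

/-- `(a ⊗ b) ⊗ c ↦ Δ(S(a) α b) δ (S ⊗ S)(Δᶜᵒᵖ(c))`. -/
def gMap (Q : QuasiHopfData k H) : (H ⊗[k] H) ⊗[k] H →ₗ[k] H ⊗[k] H :=
  LinearMap.mul' k (H ⊗[k] H) ∘ₗ
    TensorProduct.map
      (LinearMap.mulRight k Q.delta ∘ₗ Q.comul.toLinearMap ∘ₗ Q.SMul Q.alpha)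
      (Q.flipS ∘ₗ Q.comul.toLinearMap)

theorem gMap_tmul (Q : QuasiHopfData k H) (a b c : H) :
    Q.gMap ((a ⊗ₜ b) ⊗ₜ c) =
      Q.comul (Q.S a * Q.alpha * b) * Q.delta * Q.flipS (Q.comul c) := by
  simp [gMap, SMul_tmul]

/-- The inverse `f⁻¹ = g¹ ⊗ g² = Δ(S(x¹) α x²) δ (S ⊗ S)(Δᶜᵒᵖ(x³))` of the Drinfeld twist. -/
def g (Q : QuasiHopfData k H) : H ⊗[k] H :=
  Q.gMap ((TensorProduct.assoc k H H H).symm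
    ((Q.Phi⁻¹ : (H ⊗[k] (H ⊗[k] H))ˣ) : H ⊗[k] (H ⊗[k] H)))

/-- `a ⊗ b ⊗ c ↦ a ⊗ S⁻¹(α c) b`. -/
def qMap (Q : QuasiHopfData k H) : H ⊗[k] (H ⊗[k] H) →ₗ[k] H ⊗[k] H :=
  TensorProduct.map LinearMap.id
    (LinearMap.mul' k H ∘ₗ
      TensorProduct.map (Q.Sinv ∘ₗ LinearMap.mulLeft k Q.alpha) LinearMap.id ∘ₗ
      (TensorProduct.comm k H H).toLinearMap)

theorem qMap_tmul (Q : QuasiHopfData k H) (a b c : H) :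
    Q.qMap (a ⊗ₜ (b ⊗ₜ c)) = a ⊗ₜ (Q.Sinv (Q.alpha * c) * b) := by
  simp [qMap]

/-- `q = q¹ ⊗ q² = X¹ ⊗ S⁻¹(α X³) X²`. -/
def q (Q : QuasiHopfData k H) : H ⊗[k] H :=
  Q.qMap (Q.Phi : H ⊗[k] (H ⊗[k] H))

/-- For fixed `t` in `H ⊗ H`, the map
`a ⊗ b ⊗ c ↦ Δ(a) t (S(q² b₂) c ⊗ S(q¹ b₁))`. -/
def coactInner (Q : QuasiHopfData k H) (t : H ⊗[k] H) : H ⊗[k] (H ⊗[k] H) →ₗ[k] H ⊗[k] H :=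
  LinearMap.mul' k (H ⊗[k] H) ∘ₗ
    TensorProduct.map Q.comul.toLinearMap
      (LinearMap.mulLeft k t ∘ₗ LinearMap.mul' k (H ⊗[k] H) ∘ₗ
        TensorProduct.map
          (Q.flipS ∘ₗ LinearMap.mulLeft k Q.q ∘ₗ Q.comul.toLinearMap)
          (Algebra.TensorProduct.includeLeft : H →ₐ[k] H ⊗[k] H).toLinearMap)

theorem coactInner_tmul (Q : QuasiHopfData k H) (t : H ⊗[k] H) (a b c : H) :
    Q.coactInner t (a ⊗ₜ (b ⊗ₜ c)) =
      Q.comul a * (t * (Q.flipS (Q.q * Q.comul b) * (c ⊗ₜ 1))) := by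
  simp [coactInner]

/-- For fixed `t` in `H ⊗ H`, the map `(a ⊗ b) ⊗ c ↦ (a ⊗ b) t (1 ⊗ S(c))`. -/
def coactOuter (Q : QuasiHopfData k H) (t : H ⊗[k] H) : (H ⊗[k] H) ⊗[k] H →ₗ[k] H ⊗[k] H :=
  LinearMap.mul' k (H ⊗[k] H) ∘ₗ
    TensorProduct.map LinearMap.id
      (LinearMap.mulLeft k t ∘ₗ
        (Algebra.TensorProduct.includeRight : H →ₐ[k] H ⊗[k] H).toLinearMap ∘ₗ Q.S)

theorem coactOuter_tmul (Q : QuasiHopfData k H) (t : H ⊗[k] H) (a b c : H) :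
    Q.coactOuter t ((a ⊗ₜ b) ⊗ₜ c) = (a ⊗ₜ b) * (t * (1 ⊗ₜ Q.S c)) := by
  simp [coactOuter]

theorem coactInner_add (Q : QuasiHopfData k H) (t t' : H ⊗[k] H) :
    Q.coactInner (t + t') = Q.coactInner t + Q.coactInner t' := by
  have h : LinearMap.mulLeft k (t + t') = LinearMap.mulLeft k t + LinearMap.mulLeft k t' :=
    LinearMap.ext fun x => add_mul t t' x
  simp only [coactInner, h, LinearMap.add_comp, TensorProduct.map_add_right, LinearMap.comp_add]

theorem coactInner_smul (Q : QuasiHopfData k H) (c : k) (t : H ⊗[k] H) :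
    Q.coactInner (c • t) = c • Q.coactInner t := by
  have h : LinearMap.mulLeft k (c • t) = c • LinearMap.mulLeft k t :=
    LinearMap.ext fun x => smul_mul_assoc c t x
  simp only [coactInner, h, LinearMap.smul_comp, TensorProduct.map_smul_right, LinearMap.comp_smul]

theorem coactOuter_add (Q : QuasiHopfData k H) (t t' : H ⊗[k] H) :
    Q.coactOuter (t + t') = Q.coactOuter t + Q.coactOuter t' := by
  have h : LinearMap.mulLeft k (t + t') = LinearMap.mulLeft k t + LinearMap.mulLeft k t' :=
    LinearMap.ext fun x => add_mul t t' x
  simp only [coactOuter, h, LinearMap.add_comp, TensorProduct.map_add_right, LinearMap.comp_add]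

theorem coactOuter_smul (Q : QuasiHopfData k H) (c : k) (t : H ⊗[k] H) :
    Q.coactOuter (c • t) = c • Q.coactOuter t := by
  have h : LinearMap.mulLeft k (c • t) = c • LinearMap.mulLeft k t :=
    LinearMap.ext fun x => smul_mul_assoc c t x
  simp only [coactOuter, h, LinearMap.smul_comp, TensorProduct.map_smul_right, LinearMap.comp_smul]

/-- The coaction of `H` on `H₀`,
`h ↦ X¹ Y¹₁ h₁ g¹ S(q² Y²₂) Y³ ⊗ X² Y¹₂ h₂ g² S(X³ q¹ Y²₁)`,
where `Φ = X¹ ⊗ X² ⊗ X³ = Y¹ ⊗ Y² ⊗ Y³`. -/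
def coact₀ (Q : QuasiHopfData k H) : H →ₗ[k] H ⊗[k] H where
  toFun h := Q.coactOuter
    (Q.coactInner (Q.comul h * Q.g) (Q.Phi : H ⊗[k] (H ⊗[k] H)))
    ((TensorProduct.assoc k H H H).symm (Q.Phi : H ⊗[k] (H ⊗[k] H)))
  map_add' h h' := by
    rw [map_add, add_mul, coactInner_add, LinearMap.add_apply, coactOuter_add, LinearMap.add_apply]
  map_smul' c h := by
    rw [map_smul, smul_mul_assoc, coactInner_smul, LinearMap.smul_apply, coactOuter_smul,
      LinearMap.smul_apply, RingHom.id_apply]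

/-- `(1 ⊗ Φ⁻¹)(id ⊗ id ⊗ Δ)(Φ) = X¹ ⊗ x¹X² ⊗ x²X³₁ ⊗ x³X³₂`. -/
def mulElt (Q : QuasiHopfData k H) : H ⊗[k] (H ⊗[k] (H ⊗[k] H)) :=
  oneTensor (H ⊗[k] (H ⊗[k] H))
      ((Q.Phi⁻¹ : (H ⊗[k] (H ⊗[k] H))ˣ) : H ⊗[k] (H ⊗[k] H)) *
    rightLeg (rightLeg Q.comul) (Q.Phi : H ⊗[k] (H ⊗[k] H))

/-- The left `H`-module algebra `H₀` on the vector space `H`: the action is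
`h ▷ h' = h₁ h' S(h₂)`, the unit is `β`, and the multiplication is
`h * h' = X¹ h S(x¹X²) α x²X³₁ h' S(x³X³₂)`. -/
def H₀ (Q : QuasiHopfData k H) : ModuleAlgebraData k H H where
  act := Q.sandwich.comp Q.comul
  mul := LinearMap.mul' k H ∘ₗ
    TensorProduct.map (LinearMap.mulRight k Q.alpha) LinearMap.id ∘ₗ
    tensAct Q.sandwich Q.sandwich ((TensorProduct.assoc k H H (H ⊗[k] H)).symm Q.mulElt)
  one := Q.beta

end QuasiHopfData

namespace ModuleAlgebraData

variable {k H A B : Type*} [Field k] [Ring H] [Algebra k H] [AddCommGroup A] [Module k A]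
  [AddCommGroup B] [Module k B]

/-- The axioms of a left `H`-module algebra, that is, of an algebra in the monoidal category of
left `H`-modules, over a quasi-bialgebra `H`. -/
structure IsModuleAlgebra (M : ModuleAlgebraData k H A) (Q : QuasiBialgebraData k H) : Prop where
  /-- `(a a') a'' = (X¹ · a) [(X² · a') (X³ · a'')]` -/
  quasi_assoc : ∀ a a' a'' : A, M.mul (M.mul (a ⊗ₜ a') ⊗ₜ a'') =
    M.mul (TensorProduct.map LinearMap.id M.mul
      (tensAct M.act (tensAct M.act M.act) (Q.Phi : H ⊗[k] (H ⊗[k] H)) (a ⊗ₜ (a' ⊗ₜ a''))))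
  one_mul : ∀ a : A, M.mul (M.one ⊗ₜ a) = a
  mul_one : ∀ a : A, M.mul (a ⊗ₜ M.one) = a
  /-- `h · (a a') = (h₁ · a) (h₂ · a')` -/
  act_mul : ∀ (h : H) (a a' : A), M.act h (M.mul (a ⊗ₜ a')) =
    M.mul (tensAct M.act M.act (Q.comul h) (a ⊗ₜ a'))
  /-- `h · 1 = ε(h) 1` -/
  act_one : ∀ h : H, M.act h M.one = Q.counit h • M.one

/-- `A_{F⁻¹}`: the same action and unit, and the multiplication `a • a' = (G¹ · a) (G² · a')`,
where `F⁻¹ = G¹ ⊗ G²`. -/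
def twist (M : ModuleAlgebraData k H A) (F : (H ⊗[k] H)ˣ) : ModuleAlgebraData k H A where
  act := M.act
  mul := M.mul ∘ₗ tensAct M.act M.act ((F⁻¹ : (H ⊗[k] H)ˣ) : H ⊗[k] H)
  one := M.one

/-- The twisted tensor product `A ⊗_R B` in the category of left `H`-modules afforded by
`R : B ⊗ A → A ⊗ B`: the action is the diagonal one, the unit is `1 ⊗ 1`, and the multiplication is
`(μ_A ⊗ μ_B) ∘ a⁻¹_{A, A, B ⊗ B} ∘ (id ⊗ a_{A, B, B}) ∘ (id ⊗ (R ⊗ id)) ∘ (id ⊗ a⁻¹_{B, A, B}) ∘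
a_{A, B, A ⊗ B}`. -/
def twistedTensor (Q : QuasiBialgebraData k H) (M : ModuleAlgebraData k H A)
    (N : ModuleAlgebraData k H B) (R : B ⊗[k] A →ₗ[k] A ⊗[k] B) :
    ModuleAlgebraData k H (A ⊗[k] B) where
  act := Q.diagAct M.act N.act
  mul := TensorProduct.map M.mul N.mul ∘ₗ
    Q.assocInv M.act M.act (Q.diagAct N.act N.act) ∘ₗ
    TensorProduct.map LinearMap.id (Q.assocMap M.act N.act N.act) ∘ₗ
    TensorProduct.map LinearMap.id (TensorProduct.map R LinearMap.id) ∘ₗ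
    TensorProduct.map LinearMap.id (Q.assocInv N.act M.act N.act) ∘ₗ
    Q.assocMap M.act N.act (Q.diagAct M.act N.act)
  one := M.one ⊗ₜ N.one

/-- The map `R : H₀ ⊗ A → A ⊗ H₀`, `R(h ⊗ a) = h₍₋₁₎ · a ⊗ h₍₀₎`, where `h ↦ h₍₋₁₎ ⊗ h₍₀₎` is the
coaction on `H₀`. -/
def diamondTwisting (Q : QuasiHopfData k H) (M : ModuleAlgebraData k H A) :
    H ⊗[k] A →ₗ[k] A ⊗[k] H :=
  TensorProduct.map (TensorProduct.lift M.act.toLinearMap) LinearMap.id ∘ₗ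
    (TensorProduct.rightComm k H H A).toLinearMap ∘ₗ
    TensorProduct.map Q.coact₀ LinearMap.id

/-- `A ◇ H₀`, the twisted tensor product of `A` and `H₀` afforded by `R`. -/
def diamond (M : ModuleAlgebraData k H A) (Q : QuasiHopfData k H) :
    ModuleAlgebraData k H (A ⊗[k] H) :=
  twistedTensor Q.toQuasiBialgebraData M Q.H₀ (diamondTwisting Q M)

/-- Two left `H`-module algebras are isomorphic if there is a linear bijection that preserves
the multiplications, the units and the actions. -/
def Isomorphic (M : ModuleAlgebraData k H A) (N : ModuleAlgebraData k H B) : Prop :=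
  ∃ e : A ≃ₗ[k] B, (∀ a a' : A, e (M.mul (a ⊗ₜ a')) = N.mul (e a ⊗ₜ e a')) ∧
    e M.one = N.one ∧ ∀ (h : H) (a : A), e (M.act h a) = N.act h (e a)

end ModuleAlgebraData

end QuasiHopf

end

/-! All the algebras in question are compared inside one large module algebra. For any algebra map v
: H → B, the formulas that define H₀ make B a left H-module algebra B^v (`adjointAlgebra`), and v
becomes a homomorphism H₀ → B^v. Take B = End(A ⊗ H), where A ⊗ H is the space of the smash product
A # H, and let v be the diagonal action of H. Then a ↦ (x¹·a) # x² β S(x³) gives a homomorphism A →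
B^v (`isHom_smashHom`). Every B^v obeys the commutation rule v(h) * b = (h₍₋₁₎·b) * v(h₍₀₎)
(`adjointAlgebra_mul_comm`), which is exactly what a twisted tensor product requires. So the two
maps combine into a homomorphism A ◇ H₀ → B^v (`isHom_twistedTensor`). Evaluated at 1 ⊗ 1 it is the
invertible action of Φ⁻¹; hence it is injective and A ◇ H₀ inherits the axioms from B^v.

For the twist, b ↦ F¹ b S(F²) is a homomorphism from (B^v)_{F⁻¹} to the algebra that H_F and v put
on B (`isHom_sandwichAt`). Both (A ◇ H₀)_{F⁻¹} and A_{F⁻¹} ◇ (H_F)₀ therefore embed in the latter,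
with the same image, and `twistDiamond` is the resulting bijection.

Products in B^v are controlled by ι(b) = X¹ b S(X²) α X³. The function u ↦ ι(u·b) determines b, and
ι(b * b') = ι(X¹·b) ι(X²·b') X³, so associativity of B^v becomes the pentagon (`iota_mulLeft₃`).
Conversely an intertwiner λ : H → B is sent to λ(x¹) x² β S(x³) (`conj₃_circ_beta`,
`circ_iotaAt_beta`).

The commutation rule is the hard point. Under ι it reduces to an identity in H ⊗ H for the algebra
map Δ. Along Δ there are two antipodes: Δ∘S with Δ(α), Δ(β), and (S ⊗ S)Δᶜᵒᵖ with Drinfeld's γ, δ.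
The element g passes from one to the other (`iotaAt_comul`), and what remains is a pentagon
computation in five tensor factors (`fiveLeg`). -/

noncomputable section

set_option maxSynthPendingDepth 4

namespace QuasiHopf

/-! ### Tensor legs, products of functionals and forms of the pentagon. -/

section

section Star

variable {k : Type*} [Field k]

/-- To prove an additive statement about a tensor it is enough to prove it for pure tensors. -/
@[elab_as_elim]
theorem induction₂ {U V : Type*} [AddCommGroup U] [Module k U] [AddCommGroup V] [Module k V]
    {p : U ⊗[k] V → Prop} (t : U ⊗[k] V) (tmul : ∀ a b, p (a ⊗ₜ b))
    (add : ∀ x y, p x → p y → p (x + y)) : p t := by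
  induction t with
  | zero => simpa using tmul 0 0
  | tmul a b => exact tmul a b
  | add x y hx hy => exact add x y hx hy

@[elab_as_elim]
theorem induction₃ {U V W : Type*} [AddCommGroup U] [Module k U] [AddCommGroup V] [Module k V]
    [AddCommGroup W] [Module k W] {p : U ⊗[k] (V ⊗[k] W) → Prop} (t : U ⊗[k] (V ⊗[k] W))
    (tmul : ∀ a b c, p (a ⊗ₜ (b ⊗ₜ c))) (add : ∀ x y, p x → p y → p (x + y)) : p t := by
  refine induction₂ t (fun a s => ?_) add
  refine induction₂ (p := fun s => p (a ⊗ₜ s)) s (tmul a) fun x y hx hy => ?_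
  rw [TensorProduct.tmul_add]
  exact add _ _ hx hy

@[elab_as_elim]
theorem induction₄ {U V W Z : Type*} [AddCommGroup U] [Module k U] [AddCommGroup V] [Module k V]
    [AddCommGroup W] [Module k W] [AddCommGroup Z] [Module k Z]
    {p : U ⊗[k] (V ⊗[k] (W ⊗[k] Z)) → Prop} (t : U ⊗[k] (V ⊗[k] (W ⊗[k] Z)))
    (tmul : ∀ a b c d, p (a ⊗ₜ (b ⊗ₜ (c ⊗ₜ d)))) (add : ∀ x y, p x → p y → p (x + y)) : p t := by
  refine induction₂ t (fun a s => ?_) add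
  refine induction₃ (p := fun s => p (a ⊗ₜ s)) s (tmul a) fun x y hx hy => ?_
  rw [TensorProduct.tmul_add]
  exact add _ _ hx hy

variable {B U V W : Type*} [Ring B] [Algebra k B] [AddCommGroup U] [Module k U]
  [AddCommGroup V] [Module k V] [AddCommGroup W] [Module k W]

/-- The linear map `u ⊗ w ↦ f(u) g(w)`. -/
def starMul (f : U →ₗ[k] B) (g : W →ₗ[k] B) : U ⊗[k] W →ₗ[k] B :=
  LinearMap.mul' k B ∘ₗ TensorProduct.map f g

infixr:67 " ⋆ " => starMul

@[simp] theorem starMul_tmul (f : U →ₗ[k] B) (g : W →ₗ[k] B) (u : U) (w : W) :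
    (f ⋆ g) (u ⊗ₜ w) = f u * g w := by
  simp [starMul]

/-- Evaluates products of functionals on images of `leftLeg`, which are rebracketed from an
unexpanded Δ(a) ⊗ b. -/
theorem starMul_assoc (f : U →ₗ[k] B) (g : V →ₗ[k] B) (h : W →ₗ[k] B) (d : U ⊗[k] V) (w : W) :
    (f ⋆ (g ⋆ h)) (TensorProduct.assoc k U V W (d ⊗ₜ w)) = (f ⋆ g) d * h w := by
  refine induction₂ d (fun a b => by simp [mul_assoc]) fun x y hx hy => ?_
  simp only [TensorProduct.add_tmul, map_add, hx, hy, add_mul]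

end Star

section Legs

variable {k H : Type*} [Field k] [Ring H] [Algebra k H]
  {B C X : Type*} [Ring B] [Algebra k B] [Ring C] [Algebra k C] [Ring X] [Algebra k X]

@[simp] theorem oneTensor_apply (b : B) : oneTensor (k := k) (H := H) B b = 1 ⊗ₜ b := rfl

@[simp] theorem tensorOne₂_tmul (a b : H) :
    tensorOne₂ (k := k) (a ⊗ₜ b) = a ⊗ₜ (b ⊗ₜ 1) := rfl

@[simp] theorem tensorOne₃_tmul (a b c : H) :
    tensorOne₃ (k := k) (a ⊗ₜ (b ⊗ₜ c)) = a ⊗ₜ (b ⊗ₜ (c ⊗ₜ 1)) := rfl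

@[simp] theorem rightLeg_tmul (f : B →ₐ[k] C) (a : H) (b : B) :
    rightLeg f (a ⊗ₜ b) = a ⊗ₜ f b := rfl

@[simp] theorem leftLeg_tmul (f : H →ₐ[k] H ⊗[k] H) (a : H) (b : B) :
    leftLeg B f (a ⊗ₜ b) = TensorProduct.assoc k H H B (f a ⊗ₜ b) := rfl

theorem assoc_mul (d d' : H ⊗[k] H) (b b' : B) :
    TensorProduct.assoc k H H B ((d * d') ⊗ₜ (b * b')) =
      TensorProduct.assoc k H H B (d ⊗ₜ b) * TensorProduct.assoc k H H B (d' ⊗ₜ b') := by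
  rw [← Algebra.TensorProduct.tmul_mul_tmul]
  exact map_mul (Algebra.TensorProduct.assoc k k k H H B) _ _

theorem assoc_mul_tmul (d : H ⊗[k] H) (b b' : B) (x y : H) :
    TensorProduct.assoc k H H B (d ⊗ₜ b) * (x ⊗ₜ (y ⊗ₜ b')) =
      TensorProduct.assoc k H H B ((d * x ⊗ₜ y) ⊗ₜ (b * b')) := by
  rw [assoc_mul]; rfl

/-- `(a ⊗ (b ⊗ c)) ⊗ d ↦ a ⊗ (b ⊗ (c ⊗ d))`. -/
def assoc₃ (B : Type*) [Ring B] [Algebra k B] :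
    (H ⊗[k] (H ⊗[k] H)) ⊗[k] B →ₐ[k] H ⊗[k] (H ⊗[k] (H ⊗[k] B)) :=
  (rightLeg (Algebra.TensorProduct.assoc k k k H H B).toAlgHom).comp
    (Algebra.TensorProduct.assoc k k k H (H ⊗[k] H) B).toAlgHom

@[simp] theorem assoc₃_tmul (a b c : H) (d : B) :
    assoc₃ B ((a ⊗ₜ[k] (b ⊗ₜ[k] c)) ⊗ₜ[k] d) = a ⊗ₜ (b ⊗ₜ (c ⊗ₜ d)) := rfl

/-- `a ⊗ b ⊗ c ↦ a ⊗ b ⊗ c ⊗ 1`, with `1` in `B`. -/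
def tensorOneB (B : Type*) [Ring B] [Algebra k B] :
    H ⊗[k] (H ⊗[k] H) →ₐ[k] H ⊗[k] (H ⊗[k] (H ⊗[k] B)) :=
  rightLeg (rightLeg Algebra.TensorProduct.includeLeft)

@[simp] theorem tensorOneB_tmul (a b c : H) :
    tensorOneB (k := k) B (a ⊗ₜ (b ⊗ₜ c)) = a ⊗ₜ (b ⊗ₜ (c ⊗ₜ 1)) := rfl

theorem tensorOneB_eq_assoc₃ (t : H ⊗[k] (H ⊗[k] H)) :
    tensorOneB B t = assoc₃ B (t ⊗ₜ 1) := by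
  refine induction₃ t (fun a b c => by simp) fun x y hx hy => ?_
  rw [map_add, hx, hy, TensorProduct.add_tmul, map_add]

/-- With b as a spectator, iterated comultiplications become images under `assoc₃` of elements of
the threefold tensor power, where quasi-coassociativity is stated. -/
theorem leftLeg_leftLeg (f g : H →ₐ[k] H ⊗[k] H) (h : H) (b : B) :
    leftLeg (H ⊗[k] B) f (leftLeg B g (h ⊗ₜ b)) = assoc₃ B (leftLeg H f (g h) ⊗ₜ b) := by
  rw [leftLeg_tmul]
  refine induction₂ (g h) (fun x y => ?_) fun x y hx hy => ?_
  · simp only [TensorProduct.assoc_tmul, leftLeg_tmul]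
    refine induction₂ (f x) (fun z w => by simp) fun x y hx hy => ?_
    simp only [TensorProduct.add_tmul, map_add, hx, hy]
  · simp only [TensorProduct.add_tmul, map_add, hx, hy]

theorem rightLeg_leftLeg_leftLeg (f g : H →ₐ[k] H ⊗[k] H) (h : H) (b : B) :
    rightLeg (leftLeg B f) (leftLeg B g (h ⊗ₜ b)) = assoc₃ B (rightLeg f (g h) ⊗ₜ b) := by
  rw [leftLeg_tmul]
  refine induction₂ (g h) (fun x y => ?_) fun x y hx hy => ?_
  · simp only [TensorProduct.assoc_tmul, leftLeg_tmul, rightLeg_tmul]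
    refine induction₂ (f y) (fun z w => by simp) fun x y hx hy => ?_
    simp only [TensorProduct.add_tmul, TensorProduct.tmul_add, map_add, hx, hy]
  · simp only [TensorProduct.add_tmul, map_add, hx, hy]

theorem rightLeg_comp {D : Type*} [Ring D] [Algebra k D] (f : B →ₐ[k] C) (g : C →ₐ[k] D)
    (t : H ⊗[k] B) : rightLeg g (rightLeg f t) = rightLeg (g.comp f) t := by
  refine induction₂ t (fun a b => by simp) fun x y hx hy => ?_
  simp only [map_add, hx, hy]

/-- Commutation of `f ⊗ id` with `id ⊗ g` on disjoint legs. -/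
theorem leftLeg_rightLeg (f : H →ₐ[k] H ⊗[k] H) (g : B →ₐ[k] C) (t : H ⊗[k] B) :
    leftLeg C f (rightLeg g t) = rightLeg (rightLeg g) (leftLeg B f t) := by
  refine induction₂ t (fun a b => ?_) fun x y hx hy => ?_
  · simp only [rightLeg_tmul, leftLeg_tmul]
    refine induction₂ (f a) (fun z w => by simp) fun x y hx hy => ?_
    simp only [TensorProduct.add_tmul, map_add, hx, hy]
  · simp only [map_add, hx, hy]

theorem rightLeg_oneTensor (f : B →ₐ[k] C) (b : B) :
    rightLeg (H := H) f (oneTensor B b) = oneTensor C (f b) := rfl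

theorem leftLeg_oneTensor (f : H →ₐ[k] H ⊗[k] H) (b : B) :
    leftLeg B f (oneTensor B b) = oneTensor (H ⊗[k] B) (oneTensor B b) := by
  simp [Algebra.TensorProduct.one_def]

/-- An identity `D(x) u = u D'(x)` can be applied to the right leg of a tensor. -/
theorem rightLeg_mul_oneTensor {D D' : X →ₐ[k] C} {u : C} (h : ∀ x, D x * u = u * D' x)
    (t : H ⊗[k] X) : rightLeg D t * oneTensor C u = oneTensor C u * rightLeg D' t := by
  refine induction₂ t (fun a b => by simp [h]) fun x y hx hy => ?_
  simp only [map_add, add_mul, mul_add, hx, hy]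

/-- `h ↦ ε(h) 1`. -/
def QuasiBialgebraData.unitCounit (Q : QuasiBialgebraData k H) (C : Type*) [Ring C] [Algebra k C] :
    H →ₐ[k] C := (Algebra.ofId k C).comp Q.counit

theorem QuasiBialgebraData.unitCounit_apply (Q : QuasiBialgebraData k H) (h : H) :
    Q.unitCounit C h = algebraMap k C (Q.counit h) := rfl

/-- If `f` does not distinguish `D(x) c` from `D'(x) c` then neither does `p ⋆ f`. -/
theorem starMul_rightLeg_congr {Y : Type*} [Ring Y] [Algebra k Y] {D D' : X →ₐ[k] C}
    {f : C →ₗ[k] Y} (h : ∀ x c, f (D x * c) = f (D' x * c)) (p : H →ₗ[k] Y) (s : H ⊗[k] X)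
    (T : H ⊗[k] C) : (p ⋆ f) (rightLeg D s * T) = (p ⋆ f) (rightLeg D' s * T) := by
  refine induction₂ s (fun a b => ?_) fun x y hx hy => ?_
  · refine induction₂ T (fun c d => by simp [h]) fun x y hx hy => ?_
    simp only [mul_add, map_add, hx, hy]
  · simp only [map_add, add_mul, hx, hy]

/-- The intended case is D = Δ and D' = ε(·)1: an antipode axiom is applied to two adjacent legs of
a longer tensor. The free right factor `T` leaves room for the rest of a product of reassociators.
-/
theorem starMul_leftLeg_congr {Y : Type*} [Ring Y] [Algebra k Y] {D D' : H →ₐ[k] H ⊗[k] H}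
    {p q : H →ₗ[k] Y} (h : ∀ x c, (p ⋆ q) (D x * c) = (p ⋆ q) (D' x * c)) (r : X →ₗ[k] Y)
    (s : H ⊗[k] X) (T : H ⊗[k] (H ⊗[k] X)) :
    (p ⋆ (q ⋆ r)) (leftLeg X D s * T) = (p ⋆ (q ⋆ r)) (leftLeg X D' s * T) := by
  refine induction₂ s (fun a b => ?_) fun x y hx hy => ?_
  · refine induction₃ T (fun c d e => ?_) fun x y hx hy => ?_
    · simp only [leftLeg_tmul, assoc_mul_tmul, starMul_assoc, h]
    simp only [mul_add, map_add, hx, hy]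
  · simp only [map_add, add_mul, hx, hy]

end Legs

namespace QuasiBialgebraData

variable {k H : Type*} [Field k] [Ring H] [Algebra k H] (Q : QuasiBialgebraData k H)
  {B C : Type*} [Ring B] [Algebra k B] [Ring C] [Algebra k C]

/-- The reassociator as an element of the threefold tensor power. -/
abbrev P : H ⊗[k] (H ⊗[k] H) := Q.Phi

/-- The inverse of the reassociator. -/
abbrev P' : H ⊗[k] (H ⊗[k] H) := (Q.Phi⁻¹ : (H ⊗[k] (H ⊗[k] H))ˣ)

theorem map_P_mul (f : H ⊗[k] (H ⊗[k] H) →ₐ[k] B) : f Q.P * f Q.P' = 1 := by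
  rw [← map_mul, Units.mul_inv, map_one]

theorem map_P'_mul (f : H ⊗[k] (H ⊗[k] H) →ₐ[k] B) : f Q.P' * f Q.P = 1 := by
  rw [← map_mul, Units.inv_mul, map_one]

theorem map_P_mul_assoc (f : H ⊗[k] (H ⊗[k] H) →ₐ[k] B) (b : B) : f Q.P * (f Q.P' * b) = b := by
  rw [← mul_assoc, map_P_mul, one_mul]

theorem map_P'_mul_assoc (f : H ⊗[k] (H ⊗[k] H) →ₐ[k] B) (b : B) : f Q.P' * (f Q.P * b) = b := by
  rw [← mul_assoc, map_P'_mul, one_mul]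

theorem map_P'_eq_one {f : H ⊗[k] (H ⊗[k] H) →ₐ[k] B} (h : f Q.P = 1) : f Q.P' = 1 := by
  simpa [h] using Q.map_P_mul f

namespace IsQuasiBialgebra

variable {Q}

theorem coassoc_mul (hQ : Q.IsQuasiBialgebra) (h : H) :
    rightLeg Q.comul (Q.comul h) * Q.P = Q.P * leftLeg H Q.comul (Q.comul h) := by
  rw [hQ.quasi_coassoc, Units.inv_mul_cancel_right]

theorem coassoc_mul' (hQ : Q.IsQuasiBialgebra) (h : H) :
    leftLeg H Q.comul (Q.comul h) * Q.P' = Q.P' * rightLeg Q.comul (Q.comul h) := by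
  rw [hQ.quasi_coassoc, mul_assoc, Units.inv_mul_cancel_left]

/-- Quasi-coassociativity on the first leg, with everything to its right as a spectator. -/
theorem coassoc_first (hQ : Q.IsQuasiBialgebra) (t : H ⊗[k] B) :
    rightLeg (leftLeg B Q.comul) (leftLeg B Q.comul t) * tensorOneB B Q.P =
      tensorOneB B Q.P * leftLeg (H ⊗[k] B) Q.comul (leftLeg B Q.comul t) := by
  refine induction₂ t (fun a b => ?_) fun x y hx hy => ?_
  · rw [rightLeg_leftLeg_leftLeg, leftLeg_leftLeg, tensorOneB_eq_assoc₃, ← map_mul, ← map_mul]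
    simp [hQ.coassoc_mul]
  · simp only [map_add, add_mul, mul_add, hx, hy]

theorem coassoc_first' (hQ : Q.IsQuasiBialgebra) (t : H ⊗[k] B) :
    leftLeg (H ⊗[k] B) Q.comul (leftLeg B Q.comul t) * tensorOneB B Q.P' =
      tensorOneB B Q.P' * rightLeg (leftLeg B Q.comul) (leftLeg B Q.comul t) := by
  have h := congrArg (fun z => tensorOneB B Q.P' * z * tensorOneB B Q.P') (hQ.coassoc_first t)
  simp only [mul_assoc, map_P_mul, mul_one, map_P'_mul_assoc] at h
  exact h.symm

/-- `(Δ ⊗ id ⊗ id)(Φ)(Φ⁻¹ ⊗ 1) = (id ⊗ id ⊗ Δ)(Φ⁻¹)(1 ⊗ Φ)(id ⊗ Δ ⊗ id)(Φ)` -/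
theorem pentagon₁ (hQ : Q.IsQuasiBialgebra) :
    leftLeg (H ⊗[k] H) Q.comul Q.P * tensorOne₃ Q.P' =
      rightLeg (rightLeg Q.comul) Q.P' *
        (oneTensor (H ⊗[k] (H ⊗[k] H)) Q.P * rightLeg (leftLeg H Q.comul) Q.P) := by
  have h := congrArg (fun z => rightLeg (rightLeg Q.comul) Q.P' * z * tensorOne₃ Q.P') hQ.pentagon
  simp only [mul_assoc, map_P_mul, mul_one, map_P'_mul_assoc] at h
  exact h.symm

/-- `(1 ⊗ Φ)(id ⊗ Δ ⊗ id)(Φ) = (id ⊗ id ⊗ Δ)(Φ)(Δ ⊗ id ⊗ id)(Φ)(Φ⁻¹ ⊗ 1)` -/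
theorem pentagon₂ (hQ : Q.IsQuasiBialgebra) :
    oneTensor (H ⊗[k] (H ⊗[k] H)) Q.P * rightLeg (leftLeg H Q.comul) Q.P =
      rightLeg (rightLeg Q.comul) Q.P *
        (leftLeg (H ⊗[k] H) Q.comul Q.P * tensorOne₃ Q.P') := by
  rw [pentagon₁ hQ, map_P_mul_assoc]

/-- `(Φ ⊗ 1)(Δ ⊗ id ⊗ id)(Φ⁻¹) = (id ⊗ Δ ⊗ id)(Φ⁻¹)(1 ⊗ Φ⁻¹)(id ⊗ id ⊗ Δ)(Φ)` -/
theorem pentagon₃ (hQ : Q.IsQuasiBialgebra) :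
    tensorOne₃ Q.P * leftLeg (H ⊗[k] H) Q.comul Q.P' =
      rightLeg (leftLeg H Q.comul) Q.P' *
        (oneTensor (H ⊗[k] (H ⊗[k] H)) Q.P' * rightLeg (rightLeg Q.comul) Q.P) := by
  have h := congrArg (fun z => rightLeg (leftLeg H Q.comul) Q.P' *
    (oneTensor (H ⊗[k] (H ⊗[k] H)) Q.P' * z) * leftLeg (H ⊗[k] H) Q.comul Q.P') hQ.pentagon
  simp only [mul_assoc, map_P_mul, mul_one, map_P'_mul_assoc] at h
  exact h

/-- `(1 ⊗ Φ⁻¹)(id ⊗ id ⊗ Δ)(Φ)(Δ ⊗ id ⊗ id)(Φ) = (id ⊗ Δ ⊗ id)(Φ)(Φ ⊗ 1)` -/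
theorem pentagon₄ (hQ : Q.IsQuasiBialgebra) :
    oneTensor (H ⊗[k] (H ⊗[k] H)) Q.P' *
        (rightLeg (rightLeg Q.comul) Q.P * leftLeg (H ⊗[k] H) Q.comul Q.P) =
      rightLeg (leftLeg H Q.comul) Q.P * tensorOne₃ Q.P := by
  have h := congrArg (fun z => oneTensor (H ⊗[k] (H ⊗[k] H)) Q.P' * z) hQ.pentagon
  simp only [mul_assoc, map_P'_mul_assoc] at h
  exact h.symm

/-- The counit axioms are needed with ε(·)1 in a general algebra `C`, because an antipode axiom puts
ε(·)1 in the place of a comultiplication with the same target. -/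
theorem rightLeg_unitCounit_comul (hQ : Q.IsQuasiBialgebra) (h : H) :
    rightLeg (Q.unitCounit C) (Q.comul h) = h ⊗ₜ 1 := by
  have key : ∀ t : H ⊗[k] H, rightLeg (Q.unitCounit C) t =
      rightLeg (Algebra.ofId k C) (Algebra.TensorProduct.map (AlgHom.id k H) Q.counit t) := by
    intro t
    refine induction₂ t (fun a b => rfl) fun x y hx hy => ?_
    simp only [map_add, hx, hy]
  rw [key, hQ.id_counit, rightLeg_tmul, map_one]

theorem map_unitCounit_comul (hQ : Q.IsQuasiBialgebra) (h : H) :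
    Algebra.TensorProduct.map (Q.unitCounit C) (AlgHom.id k H) (Q.comul h) = 1 ⊗ₜ h := by
  have key : ∀ t : H ⊗[k] H, Algebra.TensorProduct.map (Q.unitCounit C) (AlgHom.id k H) t =
      Algebra.TensorProduct.map (Algebra.ofId k C) (AlgHom.id k H)
        (Algebra.TensorProduct.map Q.counit (AlgHom.id k H) t) := by
    intro t
    refine induction₂ t (fun a b => rfl) fun x y hx hy => ?_
    simp only [map_add, hx, hy]
  rw [key, hQ.counit_id, Algebra.TensorProduct.map_tmul, map_one, AlgHom.id_apply]

theorem leftLeg_unitCounit_comul (hQ : Q.IsQuasiBialgebra) (h : H) :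
    leftLeg H (Q.unitCounit (H ⊗[k] H)) (Q.comul h) = 1 ⊗ₜ (1 ⊗ₜ h) := by
  change Algebra.TensorProduct.assoc k k k H H H (Algebra.TensorProduct.map
    (Q.unitCounit (H ⊗[k] H)) (AlgHom.id k H) (Q.comul h)) = _
  rw [hQ.map_unitCounit_comul]
  rfl

theorem rightLeg_rightLeg_unitCounit_P (hQ : Q.IsQuasiBialgebra) :
    rightLeg (rightLeg (Q.unitCounit C)) Q.P = 1 := by
  have key : ∀ t : H ⊗[k] (H ⊗[k] H), rightLeg (rightLeg (Q.unitCounit C)) t =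
      rightLeg (rightLeg (Algebra.ofId k C)) (Algebra.TensorProduct.map (AlgHom.id k H)
        (Algebra.TensorProduct.map (AlgHom.id k H) Q.counit) t) := by
    intro t
    refine induction₃ t (fun a b c => rfl) fun x y hx hy => ?_
    simp only [map_add, hx, hy]
  rw [key, hQ.counit_Phi₃, map_one]

theorem rightLeg_leftLeg_unitCounit_P (hQ : Q.IsQuasiBialgebra) :
    rightLeg (leftLeg H (Q.unitCounit (H ⊗[k] H))) Q.P = 1 := by
  have key : ∀ t : H ⊗[k] (H ⊗[k] H), rightLeg (leftLeg H (Q.unitCounit (H ⊗[k] H))) t =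
      rightLeg ((Algebra.TensorProduct.assoc k k k H H H).toAlgHom.comp
        (Algebra.TensorProduct.map (Algebra.ofId k (H ⊗[k] H)) (AlgHom.id k H)))
        (Algebra.TensorProduct.map (AlgHom.id k H)
        (Algebra.TensorProduct.map Q.counit (AlgHom.id k H)) t) := by
    intro t
    refine induction₃ t (fun a b c => rfl) fun x y hx hy => ?_
    simp only [map_add, hx, hy]
  rw [key, hQ.counit_Phi₂, map_one]

theorem map_unitCounit_P (hQ : Q.IsQuasiBialgebra) :
    Algebra.TensorProduct.map (Q.unitCounit C) (AlgHom.id k (H ⊗[k] H)) Q.P = 1 := by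
  have key : ∀ t : H ⊗[k] (H ⊗[k] H),
      Algebra.TensorProduct.map (Q.unitCounit C) (AlgHom.id k (H ⊗[k] H)) t =
      Algebra.TensorProduct.map (Algebra.ofId k C) (AlgHom.id k (H ⊗[k] H))
        (Algebra.TensorProduct.map Q.counit (AlgHom.id k (H ⊗[k] H)) t) := by
    intro t
    refine induction₂ t (fun a b => rfl) fun x y hx hy => ?_
    simp only [map_add, hx, hy]
  rw [key, hQ.counit_Phi₁, map_one]

theorem rightLeg_map_unitCounit_P (hQ : Q.IsQuasiBialgebra) :
    rightLeg (Algebra.TensorProduct.map (Q.unitCounit C) (AlgHom.id k H)) Q.P = 1 := by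
  have key : ∀ t : H ⊗[k] (H ⊗[k] H),
      rightLeg (Algebra.TensorProduct.map (Q.unitCounit C) (AlgHom.id k H)) t =
      rightLeg (Algebra.TensorProduct.map (Algebra.ofId k C) (AlgHom.id k H))
        (Algebra.TensorProduct.map (AlgHom.id k H)
        (Algebra.TensorProduct.map Q.counit (AlgHom.id k H)) t) := by
    intro t
    refine induction₃ t (fun a b c => rfl) fun x y hx hy => ?_
    simp only [map_add, hx, hy]
  rw [key, hQ.counit_Phi₂, map_one]

end IsQuasiBialgebra

end QuasiBialgebraData

end

/-! ### Antipodes with values in an algebra, and the map ι. -/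

section

section Star

variable {k : Type*} [Field k] {B U V W : Type*} [Ring B] [Algebra k B] [AddCommGroup U]
  [Module k U] [AddCommGroup V] [Module k V] [AddCommGroup W] [Module k W]

/-- `u ↦ f(u) b`. -/
def mulAt (f : U →ₗ[k] B) (b : B) : U →ₗ[k] B := LinearMap.mulRight k b ∘ₗ f

@[simp] theorem mulAt_apply (f : U →ₗ[k] B) (b : B) (u : U) : mulAt f b u = f u * b := rfl

theorem mulAt_add (f : U →ₗ[k] B) (b b' : B) : mulAt f (b + b') = mulAt f b + mulAt f b' :=
  LinearMap.ext fun u => mul_add (f u) b b'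

theorem mulAt_smul (f : U →ₗ[k] B) (c : k) (b : B) : mulAt f (c • b) = c • mulAt f b :=
  LinearMap.ext fun u => mul_smul_comm c (f u) b

theorem starMul_mulAt (f : U →ₗ[k] B) (g : W →ₗ[k] B) (b : B) (d : U ⊗[k] W) :
    (f ⋆ mulAt g b) d = (f ⋆ g) d * b := by
  refine induction₂ d (fun x y => by simp [mul_assoc]) fun x y hx hy => ?_
  rw [map_add, map_add, hx, hy, add_mul]

theorem add_starMul (f f' : U →ₗ[k] B) (g : W →ₗ[k] B) : (f + f') ⋆ g = f ⋆ g + f' ⋆ g := by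
  simp [starMul, TensorProduct.map_add_left, LinearMap.comp_add]

theorem starMul_add (f : U →ₗ[k] B) (g g' : W →ₗ[k] B) : f ⋆ (g + g') = f ⋆ g + f ⋆ g' := by
  simp [starMul, TensorProduct.map_add_right, LinearMap.comp_add]

theorem smul_starMul (c : k) (f : U →ₗ[k] B) (g : W →ₗ[k] B) : (c • f) ⋆ g = c • (f ⋆ g) := by
  simp [starMul, TensorProduct.map_smul_left, LinearMap.comp_smul]

theorem starMul_smul (c : k) (f : U →ₗ[k] B) (g : W →ₗ[k] B) : f ⋆ (c • g) = c • (f ⋆ g) := by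
  simp [starMul, TensorProduct.map_smul_right, LinearMap.comp_smul]

end Star

section Legs

variable {k H : Type*} [Field k] [Ring H] [Algebra k H]
  {B C X Y : Type*} [Ring B] [Algebra k B] [Ring C] [Algebra k C] [Ring X] [Algebra k X]
  [Ring Y] [Algebra k Y]

theorem tmul_mul_assoc (d : H ⊗[k] H) (b b' : B) (x y : H) :
    (x ⊗ₜ (y ⊗ₜ b')) * TensorProduct.assoc k H H B (d ⊗ₜ b) =
      TensorProduct.assoc k H H B ((x ⊗ₜ y * d) ⊗ₜ (b' * b)) := by
  rw [assoc_mul]; rfl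

/-- The mirror form with the free factor on the left: β absorbs a Δ at the right end of a product,
as α absorbs one at the left end. -/
theorem starMul_mul_rightLeg_congr {D D' : X →ₐ[k] C}
    {f : C →ₗ[k] Y} (h : ∀ x c, f (c * D x) = f (c * D' x)) (p : H →ₗ[k] Y) (s : H ⊗[k] X)
    (T : H ⊗[k] C) : (p ⋆ f) (T * rightLeg D s) = (p ⋆ f) (T * rightLeg D' s) := by
  refine induction₂ s (fun a b => ?_) fun x y hx hy => ?_
  · refine induction₂ T (fun c d => by simp [h]) fun x y hx hy => ?_
    simp only [add_mul, map_add, hx, hy]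
  · simp only [map_add, mul_add, hx, hy]

theorem starMul_mul_leftLeg_congr {D D' : H →ₐ[k] H ⊗[k] H}
    {p q : H →ₗ[k] Y} (h : ∀ x c, (p ⋆ q) (c * D x) = (p ⋆ q) (c * D' x)) (r : X →ₗ[k] Y)
    (s : H ⊗[k] X) (T : H ⊗[k] (H ⊗[k] X)) :
    (p ⋆ (q ⋆ r)) (T * leftLeg X D s) = (p ⋆ (q ⋆ r)) (T * leftLeg X D' s) := by
  refine induction₂ s (fun a b => ?_) fun x y hx hy => ?_
  · refine induction₃ T (fun c d e => ?_) fun x y hx hy => ?_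
    · simp only [leftLeg_tmul, tmul_mul_assoc, starMul_assoc, h]
    simp only [add_mul, map_add, hx, hy]
  · simp only [map_add, mul_add, hx, hy]

end Legs

namespace QuasiBialgebraData

variable {k H : Type*} [Field k] [Ring H] [Algebra k H] (Q : QuasiBialgebraData k H)
  {B : Type*} [Ring B] [Algebra k B]

theorem IsQuasiBialgebra.starMul_unitCounit_starMul_P {Q : QuasiBialgebraData k H}
    (hQ : Q.IsQuasiBialgebra) (f g : H →ₗ[k] B) :
    (f ⋆ ((Q.unitCounit B).toLinearMap ⋆ g)) Q.P = f 1 * g 1 := by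
  have key : ∀ t : H ⊗[k] (H ⊗[k] H), (f ⋆ ((Q.unitCounit B).toLinearMap ⋆ g)) t =
      (f ⋆ (LinearMap.id ⋆ g))
        (rightLeg (Algebra.TensorProduct.map (Q.unitCounit B) (AlgHom.id k H)) t) := by
    intro t
    refine induction₃ t (fun a b c => by simp) fun x y hx hy => ?_
    simp only [map_add, hx, hy]
  rw [key, hQ.rightLeg_map_unitCounit_P]
  simp [Algebra.TensorProduct.one_def]

theorem IsQuasiBialgebra.unitCounit_starMul_P' {Q : QuasiBialgebraData k H}
    (hQ : Q.IsQuasiBialgebra) (f : H ⊗[k] H →ₗ[k] B) :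
    ((Q.unitCounit B).toLinearMap ⋆ f) Q.P' = f 1 := by
  have key : ∀ t : H ⊗[k] (H ⊗[k] H), ((Q.unitCounit B).toLinearMap ⋆ f) t =
      ((LinearMap.id : B →ₗ[k] B) ⋆ f)
        (Algebra.TensorProduct.map (Q.unitCounit B) (AlgHom.id k (H ⊗[k] H)) t) := by
    intro t
    refine induction₂ t (fun a b => by simp) fun x y hx hy => ?_
    simp only [map_add, hx, hy]
  rw [key, Q.map_P'_eq_one hQ.map_unitCounit_P]
  simp [Algebra.TensorProduct.one_def]

/-- `(v, σ, α, β)` behaves like an antipode of `H` with values in the algebra `B`. -/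
structure IsAntipodal (v : H →ₐ[k] B) (σ : H →ₗ[k] B) (α β : B) : Prop where
  antipode_mul : ∀ x y, σ (x * y) = σ y * σ x
  antipode_one : σ 1 = 1
  left : ∀ h, (mulAt σ α ⋆ v.toLinearMap) (Q.comul h) = Q.counit h • α
  right : ∀ h, (mulAt v.toLinearMap β ⋆ σ) (Q.comul h) = Q.counit h • β

/-- `b ↦ t₁ b σ(t₂) α t₃`. -/
def conj₃ (v : H →ₐ[k] B) (σ : H →ₗ[k] B) (α : B) (t : H ⊗[k] (H ⊗[k] H)) : B →ₗ[k] B where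
  toFun b := (mulAt v.toLinearMap b ⋆ (mulAt σ α ⋆ v.toLinearMap)) t
  map_add' b b' := by rw [mulAt_add, add_starMul, LinearMap.add_apply]
  map_smul' c b := by rw [mulAt_smul, smul_starMul, LinearMap.smul_apply, RingHom.id_apply]

theorem conj₃_apply (v : H →ₐ[k] B) (σ : H →ₗ[k] B) (α : B) (t : H ⊗[k] (H ⊗[k] H)) (b : B) :
    conj₃ v σ α t b = (mulAt v.toLinearMap b ⋆ (mulAt σ α ⋆ v.toLinearMap)) t := rfl

theorem conj₃_tmul (v : H →ₐ[k] B) (σ : H →ₗ[k] B) (α : B) (x y z : H) (b : B) :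
    conj₃ v σ α (x ⊗ₜ (y ⊗ₜ z)) b = v x * b * (σ y * α * v z) := rfl

/-- The adjoint action `u ↦ u₁ b σ(u₂)` on `b`. -/
def adjAt (v : H →ₐ[k] B) (σ : H →ₗ[k] B) (b : B) : H →ₗ[k] B :=
  (mulAt v.toLinearMap b ⋆ σ) ∘ₗ Q.comul.toLinearMap

theorem adjAt_apply (v : H →ₐ[k] B) (σ : H →ₗ[k] B) (b : B) (u : H) :
    Q.adjAt v σ b u = (mulAt v.toLinearMap b ⋆ σ) (Q.comul u) := rfl

/-- `u ↦ X¹ (u · b) σ(X²) α X³`. -/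
def iotaAt (v : H →ₐ[k] B) (σ : H →ₗ[k] B) (α b : B) : H →ₗ[k] B :=
  conj₃ v σ α Q.P ∘ₗ Q.adjAt v σ b

theorem iotaAt_apply (v : H →ₐ[k] B) (σ : H →ₗ[k] B) (α b : B) (u : H) :
    Q.iotaAt v σ α b u = conj₃ v σ α Q.P (Q.adjAt v σ b u) := rfl

/-- `λ(x¹) x² b σ(x³)`. -/
def circ (v : H →ₐ[k] B) (σ l : H →ₗ[k] B) (b : B) : B :=
  (l ⋆ (mulAt v.toLinearMap b ⋆ σ)) Q.P'

/-- `l` intertwines the left action of `H` through `v'` with the diagonal one: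
`v'(u) l(w) = l(u₁ w) v(u₂)`. -/
def Intertwines (v v' : H →ₐ[k] B) (l : H →ₗ[k] B) : Prop :=
  ∀ u w, v' u * l w = (l ⋆ v.toLinearMap) (Q.comul u * (w ⊗ₜ 1))

namespace IsAntipodal

variable {Q} {v : H →ₐ[k] B} {σ : H →ₗ[k] B} {α β : B}

/-- Since σ is antimultiplicative and v multiplicative, the two legs of `d` come out on either side
of σ(u₁) α v(u₂). The factor `d` is kept arbitrary to fit the congruence lemmas. -/
theorem left_mul (hA : Q.IsAntipodal v σ α β) (u : H) (d : H ⊗[k] H) :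
    (mulAt σ α ⋆ v.toLinearMap) (Q.comul u * d) =
      (mulAt σ α ⋆ v.toLinearMap) (Q.unitCounit (H ⊗[k] H) u * d) := by
  refine induction₂ d (fun a c => ?_) fun x y hx hy => ?_
  · have key : ∀ e : H ⊗[k] H, (mulAt σ α ⋆ v.toLinearMap) (e * (a ⊗ₜ c)) =
        σ a * ((mulAt σ α ⋆ v.toLinearMap) e * v c) := by
      intro e
      refine induction₂ e (fun x y => by simp [hA.antipode_mul, mul_assoc]) fun x y hx hy => ?_
      simp only [add_mul, mul_add, map_add, hx, hy]
    rw [key, key, hA.left, unitCounit_apply]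
    simp [Algebra.TensorProduct.one_def, hA.antipode_one, Algebra.algebraMap_eq_smul_one]
  · simp only [mul_add, map_add, hx, hy]

theorem left_mul_mulAt (hA : Q.IsAntipodal v σ α β) (b : B) (u : H) (d : H ⊗[k] H) :
    (mulAt σ α ⋆ mulAt v.toLinearMap b) (Q.comul u * d) =
      (mulAt σ α ⋆ mulAt v.toLinearMap b) (Q.unitCounit (H ⊗[k] H) u * d) := by
  rw [starMul_mulAt, hA.left_mul, starMul_mulAt]

theorem mul_right (hA : Q.IsAntipodal v σ α β) (u : H) (d : H ⊗[k] H) :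
    (mulAt v.toLinearMap β ⋆ σ) (d * Q.comul u) =
      (mulAt v.toLinearMap β ⋆ σ) (d * Q.unitCounit (H ⊗[k] H) u) := by
  refine induction₂ d (fun a c => ?_) fun x y hx hy => ?_
  · have key : ∀ e : H ⊗[k] H, (mulAt v.toLinearMap β ⋆ σ) ((a ⊗ₜ c) * e) =
        v a * ((mulAt v.toLinearMap β ⋆ σ) e * σ c) := by
      intro e
      refine induction₂ e (fun x y => by simp [hA.antipode_mul, mul_assoc]) fun x y hx hy => ?_
      simp only [add_mul, mul_add, map_add, hx, hy]
    rw [key, key, hA.right, unitCounit_apply]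
    simp [Algebra.TensorProduct.one_def, hA.antipode_one, Algebra.algebraMap_eq_smul_one]
  · simp only [add_mul, map_add, hx, hy]

theorem sandwich_mul (hA : Q.IsAntipodal v σ α β) (d e : H ⊗[k] H) (b : B) :
    (mulAt v.toLinearMap b ⋆ σ) (d * e) =
      (mulAt v.toLinearMap ((mulAt v.toLinearMap b ⋆ σ) e) ⋆ σ) d := by
  refine induction₂ d (fun x y => ?_) fun x y hx hy => ?_
  · refine induction₂ e (fun a c => by simp [hA.antipode_mul, mul_assoc]) fun x y hx hy => ?_
    simp only [mul_add, map_add, hx, hy, mulAt_add, add_starMul, LinearMap.add_apply]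
  · simp only [add_mul, map_add, hx, hy]

theorem adjAt_mul (hA : Q.IsAntipodal v σ α β) (b : B) (u w : H) :
    Q.adjAt v σ b (u * w) = Q.adjAt v σ (Q.adjAt v σ b w) u := by
  rw [adjAt_apply, map_mul, hA.sandwich_mul]; rfl

theorem adjAt_beta (hA : Q.IsAntipodal v σ α β) (u : H) :
    Q.adjAt v σ β u = Q.counit u • β := hA.right u

theorem iotaAt_mul (hA : Q.IsAntipodal v σ α β) (b : B) (u w : H) :
    Q.iotaAt v σ α b (u * w) = Q.iotaAt v σ α (Q.adjAt v σ b w) u := by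
  rw [iotaAt_apply, hA.adjAt_mul]; rfl

/-- The adjoint action multiplies β by ε, and ι(β) = 1 is an antipode axiom; this is what makes β
the unit of B. -/
theorem iotaAt_beta (hA : Q.IsAntipodal v σ α β) (hP : conj₃ v σ α Q.P β = 1) :
    Q.iotaAt v σ α β = (Q.unitCounit B).toLinearMap := by
  refine LinearMap.ext fun u => ?_
  rw [iotaAt_apply, hA.adjAt_beta, map_smul, hP, AlgHom.toLinearMap_apply, unitCounit_apply,
    Algebra.algebraMap_eq_smul_one]

/-- `u ι(b) = ι(u₁ · b) u₂`. -/
theorem mul_conj₃ (hA : Q.IsAntipodal v σ α β) (hQ : Q.IsQuasiBialgebra) (u : H) (b : B) :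
    v u * conj₃ v σ α Q.P b = (Q.iotaAt v σ α b ⋆ v.toLinearMap) (Q.comul u) := by
  have key : ∀ (t : H ⊗[k] (H ⊗[k] H)) (d : H ⊗[k] H),
      ((conj₃ v σ α t ∘ₗ Q.adjAt v σ b) ⋆ v.toLinearMap) d =
        conj₃ v σ α (t * leftLeg H Q.comul d) b := by
    intro t d
    refine induction₂ d (fun x y => ?_) fun x y hx hy => ?_
    · simp only [starMul_tmul, LinearMap.comp_apply, adjAt_apply, leftLeg_tmul]
      refine induction₃ t (fun a c e => ?_) fun x y hx hy => ?_
      · conv_rhs => rw [tmul_mul_assoc, conj₃_apply, starMul_assoc]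
        refine induction₂ (Q.comul x) (fun x y => ?_) fun x y hx hy => ?_
        · simp [conj₃_tmul, hA.antipode_mul, mul_assoc]
        · simp only [map_add, mul_add, add_mul, hx, hy]
      · simp only [conj₃_apply, map_add, add_mul] at hx hy ⊢
        rw [hx, hy]
    · rw [map_add, hx, hy]
      simp only [conj₃_apply, map_add, mul_add]
  have h1 : ∀ t : H ⊗[k] (H ⊗[k] H), conj₃ v σ α ((u ⊗ₜ 1) * t) b = v u * conj₃ v σ α t b := by
    intro t
    refine induction₃ t (fun a c e => ?_) fun x y hx hy => ?_
    · simp [conj₃_tmul, Algebra.TensorProduct.one_def, mul_assoc]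
    · simp only [conj₃_apply, mul_add, map_add] at hx hy ⊢
      rw [hx, hy]
  -- Φ (Δ ⊗ id)Δ(u) becomes (id ⊗ Δ)Δ(u) Φ, and then α collapses the last two legs to ε.
  rw [iotaAt, key, ← hQ.coassoc_mul, conj₃_apply _ _ _ (_ * _), starMul_rightLeg_congr hA.left_mul,
    hQ.rightLeg_unitCounit_comul, ← conj₃_apply, h1]

theorem intertwines_iotaAt (hA : Q.IsAntipodal v σ α β) (hQ : Q.IsQuasiBialgebra) (b : B) :
    Q.Intertwines v v (Q.iotaAt v σ α b) := by
  intro u w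
  rw [iotaAt_apply, hA.mul_conj₃ hQ]
  refine induction₂ (Q.comul u) (fun x y => ?_) fun x y hx hy => ?_
  · simp [hA.iotaAt_mul]
  · simp only [map_add, add_mul, hx, hy]

/-- Since λ is an intertwiner, inserting λ(x¹) x² b σ(x³) produces (Δ ⊗ id ⊗ id)(Φ)(Φ⁻¹ ⊗ 1). The
pentagon turns this into (id ⊗ id ⊗ Δ)(Φ⁻¹)(1 ⊗ Φ)(id ⊗ Δ ⊗ id)(Φ). The first factor is absorbed by
α, and the rest spells out ι of the adjoint action on b. The map `v'` may differ from `v`; this is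
used for the trivial action and for Δ. -/
theorem conj₃_circ (hA : Q.IsAntipodal v σ α β) (hQ : Q.IsQuasiBialgebra) {v' : H →ₐ[k] B}
    {l : H →ₗ[k] B} (hl : Q.Intertwines v v' l) (b : B) :
    (mulAt v'.toLinearMap (Q.circ v σ l b) ⋆ (mulAt σ α ⋆ v.toLinearMap)) Q.P =
      (l ⋆ (Q.iotaAt v σ α b ⋆ v.toLinearMap)) Q.P := by
  have h1 : ∀ s t : H ⊗[k] (H ⊗[k] H), (mulAt v'.toLinearMap
      ((l ⋆ (mulAt v.toLinearMap b ⋆ σ)) t) ⋆ (mulAt σ α ⋆ v.toLinearMap)) s =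
      (l ⋆ (mulAt v.toLinearMap b ⋆ (mulAt σ α ⋆ v.toLinearMap)))
        (leftLeg (H ⊗[k] H) Q.comul s * tensorOne₃ t) := by
    intro s t
    refine induction₃ s (fun s₁ s₂ s₃ => ?_) fun x y hx hy => ?_
    · refine induction₃ t (fun t₁ t₂ t₃ => ?_) fun x y hx hy => ?_
      · have e : Q.comul s₁ * (t₁ ⊗ₜ t₂) = Q.comul s₁ * (t₁ ⊗ₜ 1) * (1 ⊗ₜ t₂) := by
          rw [mul_assoc, Algebra.TensorProduct.tmul_mul_tmul, mul_one, one_mul]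
        simp only [leftLeg_tmul, tensorOne₃_tmul, assoc_mul_tmul, starMul_tmul, mulAt_apply,
          starMul_assoc, AlgHom.toLinearMap_apply, e]
        rw [← mul_assoc (v' s₁), hl]
        refine induction₂ (Q.comul s₁ * (t₁ ⊗ₜ 1)) (fun x y => ?_) fun x y hx hy => ?_
        · simp [hA.antipode_mul, mul_assoc]
        · simp only [map_add, add_mul, hx, hy]
      · simp only [map_add, mulAt_add, add_starMul, LinearMap.add_apply, hx, hy, mul_add]
    · simp only [map_add, add_mul, hx, hy]
  have h2 : ∀ s t : H ⊗[k] (H ⊗[k] H),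
      (l ⋆ (mulAt v.toLinearMap b ⋆ (mulAt σ α ⋆ v.toLinearMap)))
        (oneTensor (H ⊗[k] (H ⊗[k] H)) t * rightLeg (leftLeg H Q.comul) s) =
      (l ⋆ ((conj₃ v σ α t ∘ₗ Q.adjAt v σ b) ⋆ v.toLinearMap)) s := by
    intro s t
    refine induction₃ s (fun s₁ s₂ s₃ => ?_) fun x y hx hy => ?_
    · simp only [rightLeg_tmul, leftLeg_tmul, starMul_tmul, LinearMap.comp_apply, adjAt_apply,
        oneTensor_apply, Algebra.TensorProduct.tmul_mul_tmul, one_mul]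
      congr 1
      refine induction₃ t (fun a c e => ?_) fun x y hx hy => ?_
      · rw [tmul_mul_assoc, starMul_assoc]
        refine induction₂ (Q.comul s₂) (fun x y => ?_) fun x y hx hy => ?_
        · simp [conj₃_tmul, hA.antipode_mul, mul_assoc]
        · simp only [map_add, mul_add, add_mul, hx, hy]
      · simp only [conj₃_apply, map_add, add_mul] at hx hy ⊢
        rw [hx, hy]
    · simp only [map_add, mul_add, hx, hy]
  rw [circ, h1, hQ.pentagon₁,
    starMul_rightLeg_congr (starMul_rightLeg_congr hA.left_mul (mulAt v.toLinearMap b)),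
    Q.map_P'_eq_one hQ.rightLeg_rightLeg_unitCounit_P, one_mul, h2]
  rfl

/-- For b = β the inner ι reduces to ε, and the counit of Φ leaves λ(1). When v' = v, this and
`circ_iotaAt_beta` make b ↦ ι(- · b) a bijection onto intertwiners. -/
theorem conj₃_circ_beta (hA : Q.IsAntipodal v σ α β) (hQ : Q.IsQuasiBialgebra)
    (hP : conj₃ v σ α Q.P β = 1) {v' : H →ₐ[k] B}
    {l : H →ₗ[k] B} (hl : Q.Intertwines v v' l) :
    (mulAt v'.toLinearMap (Q.circ v σ l β) ⋆ (mulAt σ α ⋆ v.toLinearMap)) Q.P = l 1 := by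
  rw [hA.conj₃_circ hQ hl, hA.iotaAt_beta hP, hQ.starMul_unitCounit_starMul_P]
  simp

/-- `ι(x¹ · b) x² b' σ(x³) = X¹ b σ(x¹X²) α x²X³₁ b' σ(x³X³₂)` -/
theorem circ_iotaAt (hA : Q.IsAntipodal v σ α β) (hQ : Q.IsQuasiBialgebra) (b b' : B) :
    Q.circ v σ (Q.iotaAt v σ α b) b' =
      (mulAt v.toLinearMap b ⋆ (mulAt σ α ⋆ (mulAt v.toLinearMap b' ⋆ σ)))
        (oneTensor (H ⊗[k] (H ⊗[k] H)) Q.P' * rightLeg (rightLeg Q.comul) Q.P) := by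
  have h1 : ∀ s t : H ⊗[k] (H ⊗[k] H),
      ((conj₃ v σ α t ∘ₗ Q.adjAt v σ b) ⋆ (mulAt v.toLinearMap b' ⋆ σ)) s =
      (mulAt v.toLinearMap b ⋆ (mulAt σ α ⋆ (mulAt v.toLinearMap b' ⋆ σ)))
        (tensorOne₃ t * leftLeg (H ⊗[k] H) Q.comul s) := by
    intro s t
    refine induction₃ s (fun s₁ s₂ s₃ => ?_) fun x y hx hy => ?_
    · simp only [starMul_tmul, LinearMap.comp_apply, adjAt_apply, leftLeg_tmul]
      refine induction₃ t (fun a c e => ?_) fun x y hx hy => ?_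
      · rw [tensorOne₃_tmul, tmul_mul_assoc, starMul_assoc]
        refine induction₂ (Q.comul s₁) (fun x y => ?_) fun x y hx hy => ?_
        · simp [conj₃_tmul, hA.antipode_mul, mul_assoc]
        · simp only [map_add, mul_add, add_mul, hx, hy]
      · simp only [conj₃_apply, map_add, add_mul] at hx hy ⊢
        rw [hx, hy]
    · simp only [map_add, mul_add, hx, hy]
  -- The pentagon rewrites (Φ ⊗ 1)(Δ ⊗ id ⊗ id)(Φ⁻¹); the leading factor (id ⊗ Δ ⊗ id)(Φ⁻¹) is
  -- absorbed by α between the middle legs.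
  rw [circ, iotaAt, h1, hQ.pentagon₃, starMul_rightLeg_congr
    (starMul_leftLeg_congr (hA.left_mul_mulAt b') σ), Q.map_P'_eq_one hQ.rightLeg_leftLeg_unitCounit_P,
    one_mul]

/-- `ι(x¹ · b) x² β σ(x³) = b` -/
theorem circ_iotaAt_beta (hA : Q.IsAntipodal v σ α β) (hQ : Q.IsQuasiBialgebra)
    (hP' : (mulAt σ α ⋆ (mulAt v.toLinearMap β ⋆ σ)) Q.P' = 1) (b : B) :
    Q.circ v σ (Q.iotaAt v σ α b) β = b := by
  rw [hA.circ_iotaAt hQ, starMul_mul_rightLeg_congr (starMul_mul_rightLeg_congr hA.mul_right _),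
    hQ.rightLeg_rightLeg_unitCounit_P, mul_one, oneTensor_apply, starMul_tmul, hP']
  simp

end IsAntipodal

end QuasiBialgebraData

end

/-! ### The module algebra afforded by an algebra map. -/

section

namespace ModuleAlgebraData

variable {k H A : Type*} [Field k] [Ring H] [Algebra k H] [AddCommGroup A] [Module k A]

/-- `a ⊗ a' ⊗ a'' ↦ (a a') a''`. -/
def mulLeft₃ (M : ModuleAlgebraData k H A) : A ⊗[k] (A ⊗[k] A) →ₗ[k] A :=
  M.mul ∘ₗ TensorProduct.map M.mul LinearMap.id ∘ₗ (TensorProduct.assoc k A A A).symm.toLinearMap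

@[simp] theorem mulLeft₃_tmul (M : ModuleAlgebraData k H A) (a b c : A) :
    M.mulLeft₃ (a ⊗ₜ (b ⊗ₜ c)) = M.mul (M.mul (a ⊗ₜ b) ⊗ₜ c) := by simp [mulLeft₃]

/-- `a ⊗ a' ⊗ a'' ↦ a (a' a'')`. -/
def mulRight₃ (M : ModuleAlgebraData k H A) : A ⊗[k] (A ⊗[k] A) →ₗ[k] A :=
  M.mul ∘ₗ TensorProduct.map LinearMap.id M.mul

@[simp] theorem mulRight₃_tmul (M : ModuleAlgebraData k H A) (a b c : A) :
    M.mulRight₃ (a ⊗ₜ (b ⊗ₜ c)) = M.mul (a ⊗ₜ M.mul (b ⊗ₜ c)) := by simp [mulRight₃]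

/-- The action of `H ⊗ (H ⊗ H)` on the threefold tensor power. -/
abbrev act₃ (M : ModuleAlgebraData k H A) :
    H ⊗[k] (H ⊗[k] H) →ₐ[k] Module.End k (A ⊗[k] (A ⊗[k] A)) :=
  tensAct M.act (tensAct M.act M.act)

theorem mul_tensAct_left (M : ModuleAlgebraData k H A) {Q : QuasiBialgebraData k H}
    (hM : ∀ (h : H) (a a' : A), M.act h (M.mul (a ⊗ₜ a')) =
      M.mul (tensAct M.act M.act (Q.comul h) (a ⊗ₜ a'))) (d : H ⊗[k] H) (a b c : A) :
    M.mul (tensAct M.act M.act d (M.mul (a ⊗ₜ b) ⊗ₜ c)) =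
      M.mulLeft₃ (M.act₃ (leftLeg H Q.comul d) (a ⊗ₜ (b ⊗ₜ c))) := by
  refine induction₂ d (fun x y => ?_) fun x y hx hy => ?_
  · rw [tensAct_tmul, hM, leftLeg_tmul]
    refine induction₂ (Q.comul x) (fun x y => by simp [tensAct_tmul]) fun x y hx hy => ?_
    simp only [TensorProduct.add_tmul, map_add, LinearMap.add_apply, hx, hy]
  · simp only [map_add, LinearMap.add_apply, hx, hy]

theorem mul_tensAct_right (M : ModuleAlgebraData k H A) {Q : QuasiBialgebraData k H}
    (hM : ∀ (h : H) (a a' : A), M.act h (M.mul (a ⊗ₜ a')) =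
      M.mul (tensAct M.act M.act (Q.comul h) (a ⊗ₜ a'))) (d : H ⊗[k] H) (a b c : A) :
    M.mul (tensAct M.act M.act d (a ⊗ₜ M.mul (b ⊗ₜ c))) =
      M.mulRight₃ (M.act₃ (rightLeg Q.comul d) (a ⊗ₜ (b ⊗ₜ c))) := by
  refine induction₂ d (fun x y => ?_) fun x y hx hy => ?_
  · rw [tensAct_tmul, hM, rightLeg_tmul, tensAct_tmul]
    refine induction₂ (Q.comul y) (fun x y => by simp [tensAct_tmul]) fun x y hx hy => ?_
    simp only [TensorProduct.tmul_add, map_add, LinearMap.add_apply, hx, hy]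
  · simp only [map_add, LinearMap.add_apply, hx, hy]

/-- Only compatibility of the action with the product is assumed, since the lemma enters the proof
that `adjointAlgebra` is associative. -/
theorem act_mulLeft₃ (M : ModuleAlgebraData k H A) {Q : QuasiBialgebraData k H}
    (hM : ∀ (h : H) (a a' : A), M.act h (M.mul (a ⊗ₜ a')) =
      M.mul (tensAct M.act M.act (Q.comul h) (a ⊗ₜ a'))) (h : H) (z : A ⊗[k] (A ⊗[k] A)) :
    M.act h (M.mulLeft₃ z) = M.mulLeft₃ (M.act₃ (leftLeg H Q.comul (Q.comul h)) z) := by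
  refine induction₃ z (fun a b c => ?_) fun x y hx hy => ?_
  · rw [mulLeft₃_tmul, hM, M.mul_tensAct_left hM]
  · simp only [map_add, hx, hy]

theorem act_mulRight₃ (M : ModuleAlgebraData k H A) {Q : QuasiBialgebraData k H}
    (hM : ∀ (h : H) (a a' : A), M.act h (M.mul (a ⊗ₜ a')) =
      M.mul (tensAct M.act M.act (Q.comul h) (a ⊗ₜ a'))) (h : H) (z : A ⊗[k] (A ⊗[k] A)) :
    M.act h (M.mulRight₃ z) = M.mulRight₃ (M.act₃ (rightLeg Q.comul (Q.comul h)) z) := by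
  refine induction₃ z (fun a b c => ?_) fun x y hx hy => ?_
  · rw [mulRight₃_tmul, hM, M.mul_tensAct_right hM]
  · simp only [map_add, hx, hy]

end ModuleAlgebraData

namespace QuasiHopfData

variable {k H : Type*} [Field k] [Ring H] [Algebra k H] (Q : QuasiHopfData k H)
  {B : Type*} [Ring B] [Algebra k B]

theorem S_one : Q.S 1 = 1 := by simp [S]

/-- The antipode followed by an algebra map `v`. -/
abbrev vS (v : H →ₐ[k] B) : H →ₗ[k] B := v.toLinearMap ∘ₗ Q.S

theorem vS_starMul (v : H →ₐ[k] B) (c : H) (d : H ⊗[k] H) :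
    (mulAt (Q.vS v) (v c) ⋆ v.toLinearMap) d = v (Q.SMul c d) := by
  refine induction₂ d (fun x y => by simp [SMul_tmul]) fun x y hx hy => ?_
  simp only [map_add, hx, hy]

theorem starMul_vS (v : H →ₐ[k] B) (c : H) (d : H ⊗[k] H) :
    (mulAt v.toLinearMap (v c) ⋆ Q.vS v) d = v (Q.MulS c d) := by
  refine induction₂ d (fun x y => by simp [MulS_tmul]) fun x y hx hy => ?_
  simp only [map_add, hx, hy]

variable {Q}

/-- An algebra map carries the antipode structure into its target, so the formulas of H₀ make sense
on every such B. -/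
theorem IsQuasiHopf.isAntipodal (hQ : Q.IsQuasiHopf) (v : H →ₐ[k] B) :
    Q.IsAntipodal v (Q.vS v) (v Q.alpha) (v Q.beta) where
  antipode_mul x y := by simp [S_mul]
  antipode_one := by simp [S_one]
  left h := by rw [vS_starMul, hQ.antipode_left, map_smul]
  right h := by rw [starMul_vS, hQ.antipode_right, map_smul]

theorem IsQuasiHopf.conj₃_beta (hQ : Q.IsQuasiHopf) (v : H →ₐ[k] B) :
    QuasiBialgebraData.conj₃ v (Q.vS v) (v Q.alpha) Q.P (v Q.beta) = 1 := by
  have key : ∀ t : H ⊗[k] (H ⊗[k] H), (mulAt v.toLinearMap (v Q.beta) ⋆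
      (mulAt (Q.vS v) (v Q.alpha) ⋆ v.toLinearMap)) t = v (LinearMap.mul' k H
        (TensorProduct.map (LinearMap.mulRight k Q.beta) (Q.SMul Q.alpha) t)) := by
    intro t
    refine induction₃ t (fun a b c => by simp [SMul_tmul]) fun x y hx hy => ?_
    simp only [map_add, hx, hy]
  rw [QuasiBialgebraData.conj₃_apply, key, hQ.antipode_Phi, map_one]

theorem IsQuasiHopf.starMul_P' (hQ : Q.IsQuasiHopf) (v : H →ₐ[k] B) :
    (mulAt (Q.vS v) (v Q.alpha) ⋆ (mulAt v.toLinearMap (v Q.beta) ⋆ Q.vS v)) Q.P' = 1 := by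
  have key : ∀ t : H ⊗[k] (H ⊗[k] H), (mulAt (Q.vS v) (v Q.alpha) ⋆
      (mulAt v.toLinearMap (v Q.beta) ⋆ Q.vS v)) t = v (LinearMap.mul' k H
        (TensorProduct.map (LinearMap.mulRight k Q.alpha ∘ₗ Q.S) (Q.MulS Q.beta) t)) := by
    intro t
    refine induction₃ t (fun a b c => by simp [MulS_tmul]) fun x y hx hy => ?_
    simp only [map_add, hx, hy]
  rw [key, hQ.antipode_Phi_inv, map_one]

variable (Q)

/-- The adjoint action as a bilinear map. -/
def adjLin (v : H →ₐ[k] B) : H →ₗ[k] B →ₗ[k] B :=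
  LinearMap.flip
    { toFun := fun b => Q.adjAt v (Q.vS v) b
      map_add' := fun b b' => by
        refine LinearMap.ext fun u => ?_
        simp only [QuasiBialgebraData.adjAt_apply, mulAt_add, add_starMul, LinearMap.add_apply]
      map_smul' := fun c b => by
        refine LinearMap.ext fun u => ?_
        simp only [QuasiBialgebraData.adjAt_apply, mulAt_smul, smul_starMul, LinearMap.smul_apply,
          RingHom.id_apply] }

theorem adjLin_apply (v : H →ₐ[k] B) (u : H) (b : B) :
    Q.adjLin v u b = (mulAt v.toLinearMap b ⋆ Q.vS v) (Q.comul u) := rfl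

theorem sandwich_vS_mul (v : H →ₐ[k] B) (d e : H ⊗[k] H) (b : B) :
    (mulAt v.toLinearMap b ⋆ Q.vS v) (d * e) =
      (mulAt v.toLinearMap ((mulAt v.toLinearMap b ⋆ Q.vS v) e) ⋆ Q.vS v) d := by
  refine induction₂ d (fun x y => ?_) fun x y hx hy => ?_
  · refine induction₂ e (fun a c => by simp [S_mul, mul_assoc]) fun x y hx hy => ?_
    simp only [mul_add, map_add, hx, hy, mulAt_add, add_starMul, LinearMap.add_apply]
  · simp only [add_mul, map_add, hx, hy]

/-- The bilinear map `(b, b') ↦ t₁ b S(t₂) α t₃ b' S(t₄)`. -/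
def conj₄ (v : H →ₐ[k] B) (a : H) (t : H ⊗[k] (H ⊗[k] (H ⊗[k] H))) : B →ₗ[k] B →ₗ[k] B :=
  LinearMap.mk₂ k (fun b b' => (mulAt v.toLinearMap b ⋆ (mulAt (Q.vS v) (v a) ⋆
      (mulAt v.toLinearMap b' ⋆ Q.vS v))) t)
    (fun b₁ b₂ b' => by rw [mulAt_add, add_starMul, LinearMap.add_apply])
    (fun c b b' => by rw [mulAt_smul, smul_starMul, LinearMap.smul_apply])
    (fun b b₁ b₂ => by
      rw [mulAt_add, add_starMul, starMul_add, starMul_add, LinearMap.add_apply])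
    (fun c b b' => by
      rw [mulAt_smul, smul_starMul, starMul_smul, starMul_smul, LinearMap.smul_apply])

theorem conj₄_apply (v : H →ₐ[k] B) (a : H) (t : H ⊗[k] (H ⊗[k] (H ⊗[k] H))) (b b' : B) :
    Q.conj₄ v a t b b' = (mulAt v.toLinearMap b ⋆ (mulAt (Q.vS v) (v a) ⋆
      (mulAt v.toLinearMap b' ⋆ Q.vS v))) t := rfl

/-- For an algebra map `v : H → B`, the data of a left `H`-module algebra on `B` generalizing
`H₀`: the action is `h₁ b S(h₂)`, the unit is `β` and the multiplication is
`X¹ b S(x¹X²) α x²X³₁ b' S(x³X³₂)`. -/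
def adjointAlgebra (v : H →ₐ[k] B) : ModuleAlgebraData k H B where
  act := AlgHom.ofLinearMap (Q.adjLin v)
    (by
      refine LinearMap.ext fun b => ?_
      simp [adjLin_apply, Algebra.TensorProduct.one_def, S_one])
    (by
      intro x y
      refine LinearMap.ext fun b => ?_
      rw [adjLin_apply, map_mul, sandwich_vS_mul]
      rfl)
  mul := TensorProduct.lift (Q.conj₄ v Q.alpha Q.mulElt)
  one := v Q.beta

theorem adjointAlgebra_act (v : H →ₐ[k] B) (u : H) (b : B) :
    (Q.adjointAlgebra v).act u b = Q.adjAt v (Q.vS v) b u := rfl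

theorem adjointAlgebra_mul (v : H →ₐ[k] B) (b b' : B) :
    (Q.adjointAlgebra v).mul (b ⊗ₜ b') = Q.conj₄ v Q.alpha Q.mulElt b b' := rfl

/-- `ι(b) = X¹ b S(X²) α X³`. -/
abbrev iota (v : H →ₐ[k] B) : B →ₗ[k] B :=
  QuasiBialgebraData.conj₃ v (Q.vS v) (v Q.alpha) Q.P

/-- `u ↦ ι(u · b)`. -/
abbrev iotaMap (v : H →ₐ[k] B) (b : B) : H →ₗ[k] B := Q.iotaAt v (Q.vS v) (v Q.alpha) b

theorem iotaMap_apply (v : H →ₐ[k] B) (b : B) (u : H) :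
    Q.iotaMap v b u = Q.iota v ((Q.adjointAlgebra v).act u b) := rfl

variable {Q}

theorem IsQuasiHopf.circ_iotaMap (hQ : Q.IsQuasiHopf) (v : H →ₐ[k] B) (b b' : B) :
    Q.circ v (Q.vS v) (Q.iotaMap v b) b' = (Q.adjointAlgebra v).mul (b ⊗ₜ b') :=
  (hQ.isAntipodal v).circ_iotaAt hQ.isQuasiBialgebra b b'

theorem IsQuasiHopf.circ_iotaMap_beta (hQ : Q.IsQuasiHopf) (v : H →ₐ[k] B) (b : B) :
    Q.circ v (Q.vS v) (Q.iotaMap v b) (v Q.beta) = b :=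
  (hQ.isAntipodal v).circ_iotaAt_beta hQ.isQuasiBialgebra (hQ.starMul_P' v) b

/-- `circ` with β recovers b from u ↦ ι(u·b). Identities in B can therefore be checked after ι,
where products become products of functionals evaluated at Φ. -/
theorem IsQuasiHopf.iota_ext (hQ : Q.IsQuasiHopf) (v : H →ₐ[k] B) {b b' : B}
    (h : ∀ u, Q.iotaMap v b u = Q.iotaMap v b' u) : b = b' := by
  rw [← hQ.circ_iotaMap_beta v b, ← hQ.circ_iotaMap_beta v b', LinearMap.ext h]

/-- `ι(b * b') = ι(X¹ · b) ι(X² · b') X³`. -/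
theorem IsQuasiHopf.iota_mul (hQ : Q.IsQuasiHopf) (v : H →ₐ[k] B) (b b' : B) :
    Q.iota v ((Q.adjointAlgebra v).mul (b ⊗ₜ b')) =
      (Q.iotaMap v b ⋆ (Q.iotaMap v b' ⋆ v.toLinearMap)) Q.P := by
  rw [← hQ.circ_iotaMap, QuasiBialgebraData.conj₃_apply]
  exact (hQ.isAntipodal v).conj₃_circ hQ.isQuasiBialgebra
    ((hQ.isAntipodal v).intertwines_iotaAt hQ.isQuasiBialgebra b) b'

/-- (Δ ⊗ Δ)Δ(h) crosses (id ⊗ id ⊗ Δ)(Φ) by the image of quasi-coassociativity under id ⊗ id ⊗ Δ,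
and then crosses 1 ⊗ Φ⁻¹ by quasi-coassociativity in the second leg. -/
theorem _root_.QuasiHopf.QuasiBialgebraData.IsQuasiBialgebra.mulElt_mul
    (hQ : Q.IsQuasiBialgebra) (h : H) :
    Q.mulElt * leftLeg (H ⊗[k] H) Q.comul (rightLeg Q.comul (Q.comul h)) =
      rightLeg ((leftLeg H Q.comul).comp Q.comul) (Q.comul h) * Q.mulElt := by
  rw [mulElt, leftLeg_rightLeg, mul_assoc, ← map_mul, ← hQ.coassoc_mul, map_mul,
    rightLeg_comp, ← mul_assoc, ← mul_assoc]
  congr 1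
  refine (rightLeg_mul_oneTensor (fun x => ?_) _).symm
  exact hQ.coassoc_mul' x

theorem lift_conj₄_tensAct (v : H →ₐ[k] B) (b b' : B) (t : H ⊗[k] (H ⊗[k] (H ⊗[k] H)))
    (d : H ⊗[k] H) : TensorProduct.lift (Q.conj₄ v Q.alpha t)
        (tensAct (Q.adjointAlgebra v).act (Q.adjointAlgebra v).act d (b ⊗ₜ b')) =
      Q.conj₄ v Q.alpha (t * leftLeg (H ⊗[k] H) Q.comul (rightLeg Q.comul d)) b b' := by
  refine induction₂ d (fun x y => ?_) fun x y hx hy => ?_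
  · rw [tensAct_tmul, TensorProduct.lift.tmul, adjointAlgebra_act, adjointAlgebra_act]
    refine induction₄ t (fun t₁ t₂ t₃ t₄ => ?_) fun x y hx hy => ?_
    · rw [rightLeg_tmul, leftLeg_tmul, tmul_mul_assoc]
      conv_rhs => rw [conj₄_apply, starMul_assoc]
      simp only [QuasiBialgebraData.adjAt_apply]
      refine induction₂ (Q.comul x) (fun x₁ x₂ => ?_) fun x y hx hy => ?_
      · refine induction₂ (Q.comul y) (fun y₁ y₂ => ?_) fun x y hx hy => ?_
        · simp [conj₄_apply, S_mul, mul_assoc]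
        · simp only [map_add, mul_add, hx, hy]
      · simp only [map_add, LinearMap.add_apply, mul_add, add_mul, hx, hy]
    · simp only [conj₄_apply] at hx hy ⊢
      simp only [map_add, add_mul, hx, hy]
  · simp only [conj₄_apply] at hx hy ⊢
    simp only [map_add, LinearMap.add_apply, mul_add, hx, hy]

theorem IsQuasiHopf.adjointAlgebra_act_mul (hQ : Q.IsQuasiHopf) (v : H →ₐ[k] B) (h : H)
    (b b' : B) : (Q.adjointAlgebra v).act h ((Q.adjointAlgebra v).mul (b ⊗ₜ b')) =
      (Q.adjointAlgebra v).mul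
        (tensAct (Q.adjointAlgebra v).act (Q.adjointAlgebra v).act (Q.comul h) (b ⊗ₜ b')) := by
  have hq := hQ.isQuasiBialgebra
  have h1 : ∀ (t : H ⊗[k] (H ⊗[k] (H ⊗[k] H))) (d : H ⊗[k] H),
      (mulAt v.toLinearMap (Q.conj₄ v Q.alpha t b b') ⋆ Q.vS v) d =
      Q.conj₄ v Q.alpha (rightLeg ((leftLeg H (Q.unitCounit (H ⊗[k] H))).comp Q.comul) d * t)
        b b' := by
    intro t d
    refine induction₂ d (fun x y => ?_) fun x y hx hy => ?_
    · refine induction₄ t (fun t₁ t₂ t₃ t₄ => ?_) fun x y hx hy => ?_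
      · simp [conj₄_apply, hq.leftLeg_unitCounit_comul, S_mul, mul_assoc]
      · simp only [conj₄_apply] at hx hy ⊢
        simp only [map_add, mul_add, mulAt_add, add_starMul, LinearMap.add_apply, hx, hy]
    · simp only [conj₄_apply] at hx hy ⊢
      simp only [map_add, add_mul, hx, hy]
  rw [adjointAlgebra_mul, adjointAlgebra_act, QuasiBialgebraData.adjAt_apply, h1]
  refine Eq.trans ?_ (lift_conj₄_tensAct v b b' Q.mulElt (Q.comul h)).symm
  rw [hq.mulElt_mul, conj₄_apply, conj₄_apply]
  -- The two sides differ only by Δ against ε in the middle legs, which have α between them.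
  refine (starMul_rightLeg_congr (fun x c => ?_) _ _ _).symm
  exact starMul_leftLeg_congr ((hQ.isAntipodal v).left_mul_mulAt b') _ _ _

theorem IsQuasiHopf.iotaMap_mul (hQ : Q.IsQuasiHopf) (v : H →ₐ[k] B) (b b' : B) (u : H) :
    Q.iotaMap v ((Q.adjointAlgebra v).mul (b ⊗ₜ b')) u =
      (Q.iotaMap v b ⋆ (Q.iotaMap v b' ⋆ v.toLinearMap)) (Q.P * tensorOne₂ (Q.comul u)) := by
  rw [iotaMap_apply, hQ.adjointAlgebra_act_mul]
  refine induction₂ (Q.comul u) (fun x y => ?_) fun x y hx hy => ?_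
  · rw [tensAct_tmul, hQ.iota_mul, tensorOne₂_tmul]
    refine induction₃ Q.P (fun p q r => ?_) fun x y hx hy => ?_
    · simp only [starMul_tmul, Algebra.TensorProduct.tmul_mul_tmul,
        (hQ.isAntipodal v).iotaAt_mul, mul_one]
      rfl
    · simp only [map_add, add_mul, hx, hy]
  · simp only [map_add, LinearMap.add_apply, mul_add, hx, hy]

/-- Two uses of `iota_mul` express both sides through the product of ι(- · b), ι(- · b'), ι(- · b'')
and v. The left bracketing is its value at (id ⊗ id ⊗ Δ)(Φ)(Δ ⊗ id ⊗ id)(Φ), the right one at (1 ⊗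
Φ)(id ⊗ Δ ⊗ id)(Φ)(Φ ⊗ 1). These are the two sides of the pentagon. -/
theorem IsQuasiHopf.iota_mulLeft₃ (hQ : Q.IsQuasiHopf) (v : H →ₐ[k] B)
    (z : B ⊗[k] (B ⊗[k] B)) :
    Q.iota v ((Q.adjointAlgebra v).mulLeft₃ z) = Q.iota v ((Q.adjointAlgebra v).mulRight₃
      ((Q.adjointAlgebra v).act₃ Q.P z)) := by
  have hq := hQ.isQuasiBialgebra
  refine induction₃ z (fun b b' b'' => ?_) fun x y hx hy => ?_
  swap
  · simp only [map_add, hx, hy]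
  have h1 : ∀ s t : H ⊗[k] (H ⊗[k] H), ∀ f : H →ₗ[k] B,
      (∀ u, f u = (Q.iotaMap v b ⋆ (Q.iotaMap v b' ⋆ v.toLinearMap)) (t * tensorOne₂ (Q.comul u))) →
      (f ⋆ (Q.iotaMap v b'' ⋆ v.toLinearMap)) s =
      (Q.iotaMap v b ⋆ (Q.iotaMap v b' ⋆ (Q.iotaMap v b'' ⋆ v.toLinearMap)))
        (rightLeg (rightLeg Q.comul) t * leftLeg (H ⊗[k] H) Q.comul s) := by
    intro s t f hf
    refine induction₃ s (fun s₁ s₂ s₃ => ?_) fun x y hx hy => ?_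
    · rw [starMul_tmul, hf, leftLeg_tmul]
      clear hf
      refine induction₃ t (fun t₁ t₂ t₃ => ?_) fun x y hx hy => ?_
      · have e : Q.comul t₃ * (s₂ ⊗ₜ s₃) = Q.comul t₃ * (s₂ ⊗ₜ 1) * (1 ⊗ₜ s₃) := by
          rw [mul_assoc, Algebra.TensorProduct.tmul_mul_tmul, mul_one, one_mul]
        have e' : v t₃ * (Q.iotaMap v b'' s₂ * v s₃) =
            (Q.iotaMap v b'' ⋆ v.toLinearMap) (Q.comul t₃ * (s₂ ⊗ₜ s₃)) := by
          rw [e, ← mul_assoc, (hQ.isAntipodal v).intertwines_iotaAt hq b'' t₃ s₂]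
          refine induction₂ (Q.comul t₃ * (s₂ ⊗ₜ 1)) (fun x y => ?_) fun x y hx hy => ?_
          · simp [mul_assoc]
          · simp only [map_add, add_mul, hx, hy]
        rw [rightLeg_tmul, rightLeg_tmul, tmul_mul_assoc, starMul_assoc, ← e']
        refine induction₂ (Q.comul s₁) (fun x y => ?_) fun x y hx hy => ?_
        · simp [mul_assoc]
        · simp only [map_add, mul_add, add_mul, hx, hy]
      · simp only [map_add, add_mul, hx, hy]
    · simp only [map_add, mul_add, hx, hy]
  have h2 : ∀ s t : H ⊗[k] (H ⊗[k] H), ∀ (b b' b'' : B) (f : H →ₗ[k] B),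
      (∀ u, f u = (Q.iotaMap v b' ⋆ (Q.iotaMap v b'' ⋆ v.toLinearMap))
        (t * tensorOne₂ (Q.comul u))) →
      (Q.iotaMap v b ⋆ (f ⋆ v.toLinearMap)) s =
      (Q.iotaMap v b ⋆ (Q.iotaMap v b' ⋆ (Q.iotaMap v b'' ⋆ v.toLinearMap)))
        (oneTensor (H ⊗[k] (H ⊗[k] H)) t * rightLeg (leftLeg H Q.comul) s) := by
    intro s t b b' b'' f hf
    refine induction₃ s (fun s₁ s₂ s₃ => ?_) fun x y hx hy => ?_
    · rw [starMul_tmul, starMul_tmul, hf, rightLeg_tmul, leftLeg_tmul]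
      clear hf
      refine induction₃ t (fun t₁ t₂ t₃ => ?_) fun x y hx hy => ?_
      · rw [oneTensor_apply, Algebra.TensorProduct.tmul_mul_tmul, one_mul, tmul_mul_assoc,
          starMul_tmul, starMul_assoc]
        congr 1
        refine induction₂ (Q.comul s₂) (fun x y => ?_) fun x y hx hy => ?_
        · simp [mul_assoc]
        · simp only [map_add, mul_add, add_mul, hx, hy]
      · simp only [map_add, mul_add, add_mul, hx, hy]
    · simp only [map_add, mul_add, hx, hy]
  have h3 : ∀ t : H ⊗[k] (H ⊗[k] H), Q.iota v ((Q.adjointAlgebra v).mulRight₃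
      ((Q.adjointAlgebra v).act₃ t (b ⊗ₜ (b' ⊗ₜ b'')))) =
      (Q.iotaMap v b ⋆ (Q.iotaMap v b' ⋆ (Q.iotaMap v b'' ⋆ v.toLinearMap)))
        (oneTensor (H ⊗[k] (H ⊗[k] H)) Q.P * rightLeg (leftLeg H Q.comul) Q.P *
          tensorOne₃ t) := by
    intro t
    refine induction₃ t (fun t₁ t₂ t₃ => ?_) fun x y hx hy => ?_
    · rw [tensAct_tmul, tensAct_tmul, ModuleAlgebraData.mulRight₃_tmul, hQ.iota_mul,
        h2 Q.P Q.P _ _ _ _ fun u => hQ.iotaMap_mul v _ _ u]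
      refine induction₄ (oneTensor (H ⊗[k] (H ⊗[k] H)) Q.P * rightLeg (leftLeg H Q.comul) Q.P)
        (fun x y z w => ?_) fun x y hx hy => ?_
      · simp only [tensorOne₃_tmul, Algebra.TensorProduct.tmul_mul_tmul, starMul_tmul,
          (hQ.isAntipodal v).iotaAt_mul, mul_one]
        rfl
      · simp only [map_add, add_mul, hx, hy]
    · simp only [map_add, LinearMap.add_apply, mul_add, hx, hy]
  rw [h3, ModuleAlgebraData.mulLeft₃_tmul, hQ.iota_mul,
    h1 Q.P Q.P _ fun u => hQ.iotaMap_mul v b b' u, hq.pentagon]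

theorem IsQuasiHopf.adjointAlgebra_isModuleAlgebra (hQ : Q.IsQuasiHopf) (v : H →ₐ[k] B) :
    (Q.adjointAlgebra v).IsModuleAlgebra Q.toQuasiBialgebraData where
  quasi_assoc b b' b'' := by
    refine hQ.iota_ext v fun u => ?_
    have h := ModuleAlgebraData.act_mulLeft₃ (Q.adjointAlgebra v) (hQ.adjointAlgebra_act_mul v) u
    have h' := ModuleAlgebraData.act_mulRight₃ (Q.adjointAlgebra v) (hQ.adjointAlgebra_act_mul v) u
    rw [iotaMap_apply, iotaMap_apply, ← ModuleAlgebraData.mulLeft₃_tmul, h, hQ.iota_mulLeft₃ v]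
    -- The action of u has been moved inside both bracketings; quasi-coassociativity carries it past
    -- Φ.
    refine congrArg _ (Eq.trans ?_ (h' _).symm)
    rw [← Module.End.mul_apply, ← map_mul, ← hQ.isQuasiBialgebra.coassoc_mul, map_mul,
      Module.End.mul_apply]
  one_mul b := by
    have h := (hQ.isAntipodal v).iotaAt_beta (hQ.conj₃_beta v)
    rw [← hQ.circ_iotaMap]
    change Q.circ v (Q.vS v) (Q.iotaMap v (v Q.beta)) b = b
    rw [iotaMap, h, QuasiBialgebraData.circ, hQ.isQuasiBialgebra.unitCounit_starMul_P']
    simp [Algebra.TensorProduct.one_def, S_one]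
  mul_one b := by
    rw [← hQ.circ_iotaMap]
    exact hQ.circ_iotaMap_beta v b
  act_mul := hQ.adjointAlgebra_act_mul v
  act_one h := (hQ.isAntipodal v).right h

end QuasiHopfData

end

/-! ### Homomorphisms, and maps out of a twisted tensor product. -/

section

theorem tensAct_map {k B C U V U' V' : Type*} [Field k] [Ring B] [Algebra k B] [Ring C]
    [Algebra k C] [AddCommGroup U] [Module k U] [AddCommGroup V] [Module k V]
    [AddCommGroup U'] [Module k U'] [AddCommGroup V'] [Module k V']
    {ρ : B →ₐ[k] Module.End k U} {σ : C →ₐ[k] Module.End k V}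
    {ρ' : B →ₐ[k] Module.End k U'} {σ' : C →ₐ[k] Module.End k V'} {f : U →ₗ[k] U'}
    {g : V →ₗ[k] V'} (hf : ∀ b u, f (ρ b u) = ρ' b (f u)) (hg : ∀ c v, g (σ c v) = σ' c (g v))
    (t : B ⊗[k] C) (z : U ⊗[k] V) :
    TensorProduct.map f g (tensAct ρ σ t z) = tensAct ρ' σ' t (TensorProduct.map f g z) := by
  refine induction₂ t (fun b c => ?_) fun x y hx hy => ?_
  · refine induction₂ z (fun u w => by simp [tensAct_tmul, hf, hg]) fun x y hx hy => ?_
    simp only [map_add, hx, hy]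
  · simp only [map_add, LinearMap.add_apply, hx, hy]

namespace ModuleAlgebraData

variable {k H A B C : Type*} [Field k] [Ring H] [Algebra k H] [AddCommGroup A] [Module k A]
  [AddCommGroup B] [Module k B] [AddCommGroup C] [Module k C]

/-- A linear map preserving the action, the multiplication and the unit. -/
structure IsHom (M : ModuleAlgebraData k H A) (N : ModuleAlgebraData k H B) (f : A →ₗ[k] B) :
    Prop where
  act : ∀ h a, f (M.act h a) = N.act h (f a)
  mul : ∀ a a', f (M.mul (a ⊗ₜ a')) = N.mul (f a ⊗ₜ f a')
  one : f M.one = N.one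

variable {M : ModuleAlgebraData k H A} {N : ModuleAlgebraData k H B} {P : ModuleAlgebraData k H C}
  {f : A →ₗ[k] B} {g : B →ₗ[k] C}

theorem IsHom.mul' (hf : IsHom M N f) (z : A ⊗[k] A) :
    f (M.mul z) = N.mul (TensorProduct.map f f z) := by
  refine induction₂ z (fun a b => by simp [hf.mul]) fun x y hx hy => ?_
  simp only [map_add, hx, hy]

theorem IsHom.comp (hg : IsHom N P g) (hf : IsHom M N f) : IsHom M P (g ∘ₗ f) where
  act h a := by simp [hf.act, hg.act]
  mul a a' := by simp [hf.mul, hg.mul]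
  one := by simp [hf.one, hg.one]

/-- A structure admitting an injective homomorphism to a module algebra is a module algebra. -/
theorem IsHom.isModuleAlgebra {Q : QuasiBialgebraData k H} (hf : IsHom M N f)
    (hi : Function.Injective f) (hN : N.IsModuleAlgebra Q) : M.IsModuleAlgebra Q where
  quasi_assoc a a' a'' := by
    apply hi
    have e : TensorProduct.map f f ∘ₗ TensorProduct.map LinearMap.id M.mul =
        TensorProduct.map LinearMap.id N.mul ∘ₗ
          TensorProduct.map f (TensorProduct.map f f) := by
      refine TensorProduct.ext' fun x y => ?_
      simp [hf.mul']
    have e' := LinearMap.congr_fun e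
    simp only [LinearMap.comp_apply] at e'
    rw [hf.mul, hf.mul, hN.quasi_assoc, hf.mul', e',
      tensAct_map hf.act (tensAct_map hf.act hf.act)]
    rfl
  one_mul a := hi (by rw [hf.mul, hf.one, hN.one_mul])
  mul_one a := hi (by rw [hf.mul, hf.one, hN.mul_one])
  act_mul h a a' := hi (by
    rw [hf.act, hf.mul, hN.act_mul, hf.mul', tensAct_map hf.act hf.act]; rfl)
  act_one h := hi (by rw [hf.act, hf.one, hN.act_one, map_smul, hf.one])

section TwistedTensor

variable {Q : QuasiBialgebraData k H} {X Y Z : Type*} [AddCommGroup X] [Module k X]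
  [AddCommGroup Y] [Module k Y] [AddCommGroup Z] [Module k Z]

/-- The map `x ⊗ y ↦ f(x) g(y)` into a module algebra. -/
def mulMap (P : ModuleAlgebraData k H C) (f : X →ₗ[k] C) (g : Y →ₗ[k] C) : X ⊗[k] Y →ₗ[k] C :=
  P.mul ∘ₗ TensorProduct.map f g

@[simp] theorem mulMap_tmul (P : ModuleAlgebraData k H C) (f : X →ₗ[k] C) (g : Y →ₗ[k] C)
    (x : X) (y : Y) : P.mulMap f g (x ⊗ₜ y) = P.mul (f x ⊗ₜ g y) := rfl

theorem mulMap_apply (P : ModuleAlgebraData k H C) (f : X →ₗ[k] C) (g : Y →ₗ[k] C)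
    (z : X ⊗[k] Y) : P.mulMap f g z = P.mul (TensorProduct.map f g z) := rfl

variable {ρ : H →ₐ[k] Module.End k X} {σ : H →ₐ[k] Module.End k Y} {τ : H →ₐ[k] Module.End k Z}
  {f : X →ₗ[k] C} {g : Y →ₗ[k] C} {h : Z →ₗ[k] C}

theorem IsModuleAlgebra.mulMap_act (hP : P.IsModuleAlgebra Q)
    (hf : ∀ u x, f (ρ u x) = P.act u (f x)) (hg : ∀ u y, g (σ u y) = P.act u (g y)) (u : H)
    (z : X ⊗[k] Y) : P.mulMap f g (Q.diagAct ρ σ u z) = P.act u (P.mulMap f g z) := by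
  refine induction₂ z (fun x y => ?_) fun x y hx hy => ?_
  · rw [mulMap_tmul, hP.act_mul, mulMap_apply]
    change P.mul (TensorProduct.map f g (tensAct ρ σ (Q.comul u) _)) = _
    rw [tensAct_map hf hg]
    rfl
  · simp only [map_add, hx, hy]

/-- Associativity of the target, pulled back along equivariant maps: rebracketing a product of such
maps costs one associativity constraint on the source. This matches the constraints in the
definition of `twistedTensor`. -/
theorem IsModuleAlgebra.mulMap_assocMap (hP : P.IsModuleAlgebra Q)
    (hf : ∀ u x, f (ρ u x) = P.act u (f x)) (hg : ∀ u y, g (σ u y) = P.act u (g y))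
    (hh : ∀ u z, h (τ u z) = P.act u (h z)) (z : (X ⊗[k] Y) ⊗[k] Z) :
    P.mulMap (P.mulMap f g) h z = P.mulMap f (P.mulMap g h) (Q.assocMap ρ σ τ z) := by
  have e : ∀ y, P.mulMap f (P.mulMap g h) y =
      P.mulRight₃ (TensorProduct.map f (TensorProduct.map g h) y) := by
    intro y
    refine induction₃ y (fun a b c => rfl) fun x y hx hy => ?_
    simp only [map_add, hx, hy]
  rw [QuasiBialgebraData.assocMap, LinearMap.comp_apply, e, tensAct_map hf (tensAct_map hg hh)]
  refine induction₂ z (fun w c => ?_) fun x y hx hy => ?_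
  · refine induction₂ w (fun a b => ?_) fun x y hx hy => ?_
    · exact hP.quasi_assoc (f a) (g b) (h c)
    · simp only [TensorProduct.add_tmul, map_add, hx, hy]
  · simp only [map_add, hx, hy]

theorem IsModuleAlgebra.mulMap_assocInv (hP : P.IsModuleAlgebra Q)
    (hf : ∀ u x, f (ρ u x) = P.act u (f x)) (hg : ∀ u y, g (σ u y) = P.act u (g y))
    (hh : ∀ u z, h (τ u z) = P.act u (h z)) (z : X ⊗[k] (Y ⊗[k] Z)) :
    P.mulMap f (P.mulMap g h) z = P.mulMap (P.mulMap f g) h (Q.assocInv ρ σ τ z) := by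
  rw [hP.mulMap_assocMap hf hg hh, Q.assocMap_assocInv]

theorem mulMap_map {X' Y' : Type*} [AddCommGroup X'] [Module k X'] [AddCommGroup Y'] [Module k Y']
    (P : ModuleAlgebraData k H C) (f : X →ₗ[k] C) (g : Y →ₗ[k] C) (p : X' →ₗ[k] X)
    (q : Y' →ₗ[k] Y) (z : X' ⊗[k] Y') :
    P.mulMap f g (TensorProduct.map p q z) = P.mulMap (f ∘ₗ p) (g ∘ₗ q) z := by
  refine induction₂ z (fun x y => rfl) fun x y hx hy => ?_
  simp only [map_add, hx, hy]

/-- Homomorphisms `i` and `j` to a module algebra that commute up to `R` induce a homomorphism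
on the twisted tensor product afforded by `R`. -/
theorem IsModuleAlgebra.isHom_twistedTensor (hP : P.IsModuleAlgebra Q) {i : A →ₗ[k] C}
    {j : B →ₗ[k] C} (hi : IsHom M P i) (hj : IsHom N P j) {R : B ⊗[k] A →ₗ[k] A ⊗[k] B}
    (hR : ∀ z, P.mulMap j i z = P.mulMap i j (R z)) :
    IsHom (twistedTensor Q M N R) P (P.mulMap i j) where
  act u z := hP.mulMap_act hi.act hj.act u z
  one := by
    rw [twistedTensor, mulMap_tmul, hi.one, hj.one, hP.one_mul]
  mul z z' := by
    have hij : ∀ u z, P.mulMap i j (Q.diagAct M.act N.act u z) = P.act u (P.mulMap i j z) :=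
      hP.mulMap_act hi.act hj.act
    have hjj : ∀ u z, P.mulMap j j (Q.diagAct N.act N.act u z) = P.act u (P.mulMap j j z) :=
      hP.mulMap_act hj.act hj.act
    have e₀ : P.mulMap j i = P.mulMap i j ∘ₗ R := LinearMap.ext hR
    -- The adjacent factors j, i are exchanged by R; the constraints before and after R bring them
    -- together and separate them again.
    have e₁ : P.mulMap j (P.mulMap i j) = P.mulMap i (P.mulMap j j) ∘ₗ
        Q.assocMap M.act N.act N.act ∘ₗ TensorProduct.map R LinearMap.id ∘ₗ
        Q.assocInv N.act M.act N.act := by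
      refine LinearMap.ext fun z => ?_
      rw [hP.mulMap_assocInv hj.act hi.act hj.act, e₀]
      simp only [LinearMap.comp_apply]
      rw [← hP.mulMap_assocMap hi.act hj.act hj.act, mulMap_map]
      rfl
    -- The factors i, i, j, j are regrouped into two pairs, on which i and j are multiplicative.
    have e₂ : P.mulMap i (P.mulMap i (P.mulMap j j)) = P.mulMap i j ∘ₗ
        TensorProduct.map M.mul N.mul ∘ₗ Q.assocInv M.act M.act (Q.diagAct N.act N.act) := by
      refine LinearMap.ext fun z => ?_
      rw [hP.mulMap_assocInv hi.act hi.act hjj]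
      simp only [LinearMap.comp_apply]
      rw [mulMap_map]
      congr 2
      · exact LinearMap.ext fun z => (hi.mul' z).symm
      · exact LinearMap.ext fun z => (hj.mul' z).symm
    rw [← mulMap_tmul, hP.mulMap_assocMap hi.act hj.act hij, e₁]
    change P.mulMap i j (TensorProduct.map M.mul N.mul _) = _
    have e₃ := LinearMap.congr_fun e₂
    simp only [LinearMap.comp_apply] at e₃
    simp only [LinearMap.comp_apply, ← e₃]
    rw [mulMap_map, mulMap_map, mulMap_map]
    rfl

end TwistedTensor

end ModuleAlgebraData

namespace QuasiHopfData

variable {k H : Type*} [Field k] [Ring H] [Algebra k H] {Q : QuasiHopfData k H}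
  {B : Type*} [Ring B] [Algebra k B]

/-- An algebra map `v : H → B` is a homomorphism from `H₀` to the algebra afforded by `v`. -/
theorem isHom_adjointAlgebra (v : H →ₐ[k] B) :
    ModuleAlgebraData.IsHom Q.H₀ (Q.adjointAlgebra v) v.toLinearMap where
  act u h := by
    change v (Q.sandwich (Q.comul u) h) = (mulAt v.toLinearMap (v h) ⋆ Q.vS v) (Q.comul u)
    refine induction₂ (Q.comul u) (fun x y => by simp [sandwich_tmul]) fun x y hx hy => ?_
    simp only [map_add, LinearMap.add_apply, hx, hy]
  mul h h' := by
    rw [adjointAlgebra_mul]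
    have key : ∀ t : H ⊗[k] (H ⊗[k] (H ⊗[k] H)), v (LinearMap.mul' k H (TensorProduct.map
        (LinearMap.mulRight k Q.alpha) LinearMap.id (tensAct Q.sandwich Q.sandwich
          ((TensorProduct.assoc k H H (H ⊗[k] H)).symm t) (h ⊗ₜ h')))) =
        Q.conj₄ v Q.alpha t (v h) (v h') := by
      intro t
      refine induction₄ t (fun a b c d => ?_) fun x y hx hy => ?_
      · simp [tensAct_tmul, sandwich_tmul, conj₄_apply, mul_assoc]
      · simp only [conj₄_apply] at hx hy ⊢
        simp only [map_add, LinearMap.add_apply, hx, hy]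
    exact key Q.mulElt
  one := rfl

theorem IsQuasiHopf.iota_circ_beta (hQ : Q.IsQuasiHopf) {v : H →ₐ[k] B} {l : H →ₗ[k] B}
    (hl : Q.Intertwines v v l) :
    Q.iota v (Q.circ v (Q.vS v) l (v Q.beta)) = l 1 :=
  (hQ.isAntipodal v).conj₃_circ_beta hQ.isQuasiBialgebra (hQ.conj₃_beta v) hl

/-- `h · (λ ∘ β) = λ(- h) ∘ β` -/
theorem IsQuasiHopf.adjAt_circ (hQ : Q.IsQuasiHopf) {v : H →ₐ[k] B} {l : H →ₗ[k] B}
    (hl : Q.Intertwines v v l) (u : H) :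
    Q.adjAt v (Q.vS v) (Q.circ v (Q.vS v) l (v Q.beta)) u =
      Q.circ v (Q.vS v) (l ∘ₗ LinearMap.mulRight k u) (v Q.beta) := by
  have h1 : ∀ (d : H ⊗[k] H) (t : H ⊗[k] (H ⊗[k] H)),
      (mulAt v.toLinearMap ((l ⋆ (mulAt v.toLinearMap (v Q.beta) ⋆ Q.vS v)) t) ⋆ Q.vS v) d =
      (l ⋆ (mulAt v.toLinearMap (v Q.beta) ⋆ Q.vS v)) (leftLeg H Q.comul d * t) := by
    intro d t
    refine induction₂ d (fun d₁ d₂ => ?_) fun x y hx hy => ?_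
    · refine induction₃ t (fun t₁ t₂ t₃ => ?_) fun x y hx hy => ?_
      · have e : Q.comul d₁ * (t₁ ⊗ₜ t₂) = Q.comul d₁ * (t₁ ⊗ₜ 1) * (1 ⊗ₜ t₂) := by
          rw [mul_assoc, Algebra.TensorProduct.tmul_mul_tmul, mul_one, one_mul]
        simp only [leftLeg_tmul, assoc_mul_tmul, starMul_tmul, mulAt_apply,
          starMul_assoc, AlgHom.toLinearMap_apply, e]
        rw [← mul_assoc (v d₁), hl]
        refine induction₂ (Q.comul d₁ * (t₁ ⊗ₜ 1)) (fun x y => ?_) fun x y hx hy => ?_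
        · simp [S_mul, mul_assoc]
        · simp only [map_add, add_mul, hx, hy]
      · simp only [map_add, mulAt_add, add_starMul, LinearMap.add_apply, hx, hy, mul_add]
    · simp only [map_add, add_mul, hx, hy]
  -- (Δ ⊗ id)Δ(u) Φ⁻¹ becomes Φ⁻¹ (id ⊗ Δ)Δ(u); then β collapses the last two legs and u survives on
  -- the right of the first.
  rw [QuasiBialgebraData.adjAt_apply, QuasiBialgebraData.circ, h1,
    hQ.isQuasiBialgebra.coassoc_mul',
    starMul_mul_rightLeg_congr (hQ.isAntipodal v).mul_right,
    hQ.isQuasiBialgebra.rightLeg_unitCounit_comul, QuasiBialgebraData.circ]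
  refine induction₃ Q.P' (fun a b c => ?_) fun x y hx hy => ?_
  · simp [Algebra.TensorProduct.one_def]
  · simp only [add_mul, map_add, hx, hy]

end QuasiHopfData

end

/-! ### The smash product and the embedding of A ◇ H₀. -/

section

namespace ModuleAlgebraData

variable {k H A : Type*} [Field k] [Ring H] [Algebra k H] [AddCommGroup A] [Module k A]
  (M : ModuleAlgebraData k H A)

/-- The diagonal action of `H` on `A ⊗ H`. -/
abbrev smashAct (Q : QuasiBialgebraData k H) : H →ₐ[k] Module.End k (A ⊗[k] H) :=
  Q.diagAct M.act (Algebra.lmul k H)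

/-- `a ⊗ a' ⊗ h ↦ a a' ⊗ h`. -/
def mulTensor : A ⊗[k] (A ⊗[k] H) →ₗ[k] A ⊗[k] H :=
  TensorProduct.map M.mul LinearMap.id ∘ₗ (TensorProduct.assoc k A A H).symm.toLinearMap

@[simp] theorem mulTensor_tmul (a b : A) (h : H) :
    M.mulTensor (a ⊗ₜ (b ⊗ₜ h)) = M.mul (a ⊗ₜ b) ⊗ₜ h := rfl

/-- The action of `H ⊗ (H ⊗ H)` on `A ⊗ (A ⊗ H)`. -/
abbrev actA₃ : H ⊗[k] (H ⊗[k] H) →ₐ[k] Module.End k (A ⊗[k] (A ⊗[k] H)) :=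
  tensAct M.act (tensAct M.act (Algebra.lmul k H))

/-- The action of the fourfold tensor power of `H` on `A ⊗ (A ⊗ (A ⊗ H))`. -/
abbrev actA₄ : H ⊗[k] (H ⊗[k] (H ⊗[k] H)) →ₐ[k] Module.End k (A ⊗[k] (A ⊗[k] (A ⊗[k] H))) :=
  tensAct M.act M.actA₃

/-- The left action of `A` on `A ⊗ H` by the multiplication of the smash product,
`a · (a' ⊗ h) = (x¹ · a)(x² · a') ⊗ x³ h`. -/
def smashLeft (Q : QuasiBialgebraData k H) : A →ₗ[k] Module.End k (A ⊗[k] H) :=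
  TensorProduct.curry (M.mulTensor ∘ₗ M.actA₃ Q.P')

theorem smashLeft_apply (Q : QuasiBialgebraData k H) (a : A) (w : A ⊗[k] H) :
    M.smashLeft Q a w = M.mulTensor (M.actA₃ Q.P' (a ⊗ₜ w)) := rfl

/-- `u ↦ (u · a) ·` -/
def smashLeftAt (Q : QuasiBialgebraData k H) (a : A) : H →ₗ[k] Module.End k (A ⊗[k] H) :=
  M.smashLeft Q ∘ₗ (M.act.toLinearMap.flip a)

theorem smashLeftAt_apply (Q : QuasiBialgebraData k H) (a : A) (u : H) :
    M.smashLeftAt Q a u = M.smashLeft Q (M.act u a) := rfl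

variable {M} {Q : QuasiBialgebraData k H}

theorem mulTensor_leg (hM : M.IsModuleAlgebra Q) (d : H ⊗[k] H) (a b : A) (h : H) :
    tensAct M.act (Algebra.lmul k H) d (M.mulTensor (a ⊗ₜ (b ⊗ₜ h))) =
      M.mulTensor (M.actA₃ (leftLeg H Q.comul d) (a ⊗ₜ (b ⊗ₜ h))) := by
  refine induction₂ d (fun x y => ?_) fun x y hx hy => ?_
  · rw [mulTensor_tmul, tensAct_tmul, hM.act_mul, leftLeg_tmul]
    refine induction₂ (Q.comul x) (fun x y => by simp [tensAct_tmul]) fun x y hx hy => ?_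
    simp only [TensorProduct.add_tmul, map_add, LinearMap.add_apply, hx, hy]
  · simp only [map_add, LinearMap.add_apply, hx, hy]

theorem mulTensor_leg' (hM : M.IsModuleAlgebra Q) (d : H ⊗[k] H) (z : A ⊗[k] (A ⊗[k] H)) :
    tensAct M.act (Algebra.lmul k H) d (M.mulTensor z) =
      M.mulTensor (M.actA₃ (leftLeg H Q.comul d) z) := by
  refine induction₃ z (fun a b c => mulTensor_leg hM d a b c) fun x y hx hy => ?_
  simp only [map_add, hx, hy]

theorem smashLeftAt_starMul (a : A) (d : H ⊗[k] H) (w : A ⊗[k] H) :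
    (M.smashLeftAt Q a ⋆ (M.smashAct Q).toLinearMap) d w =
      M.mulTensor (M.actA₃ (Q.P' * rightLeg Q.comul d) (a ⊗ₜ w)) := by
  rw [map_mul, Module.End.mul_apply]
  refine induction₂ d (fun x y => rfl) fun x y hx hy => ?_
  simp only [map_add, LinearMap.add_apply, hx, hy]

/-- Acting on a product in A yields (Δ ⊗ id)Δ(u), whereas nested diagonal actions need (id ⊗ Δ)Δ(u);
the Φ⁻¹ in `smashLeft` converts one into the other. -/
theorem smashAct_mul_smashLeft (hQ : Q.IsQuasiBialgebra) (hM : M.IsModuleAlgebra Q) (u : H)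
    (a : A) : M.smashAct Q u * M.smashLeft Q a =
      (M.smashLeftAt Q a ⋆ (M.smashAct Q).toLinearMap) (Q.comul u) := by
  refine LinearMap.ext fun w => ?_
  rw [smashLeftAt_starMul, ← hQ.coassoc_mul', map_mul, Module.End.mul_apply, Module.End.mul_apply,
    smashLeft_apply]
  exact mulTensor_leg' hM _ _

theorem smashLeftAt_mul (a : A) (u w : H) :
    M.smashLeftAt Q a (u * w) = M.smashLeftAt Q (M.act w a) u := by
  rw [smashLeftAt_apply, map_mul]; rfl

theorem intertwines_smashLeftAt (hQ : Q.IsQuasiBialgebra) (hM : M.IsModuleAlgebra Q) (a : A) :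
    Q.Intertwines (M.smashAct Q) (M.smashAct Q) (M.smashLeftAt Q a) := by
  intro u w
  rw [smashLeftAt_apply, smashAct_mul_smashLeft hQ hM]
  refine induction₂ (Q.comul u) (fun x y => ?_) fun x y hx hy => ?_
  · simp [smashLeftAt_mul]
  · simp only [map_add, add_mul, hx, hy]

/-- The nested left actions contribute (id ⊗ Δ ⊗ id)(Φ⁻¹)(1 ⊗ Φ⁻¹)(id ⊗ id ⊗ Δ)(Φ), which by the
pentagon is (Φ ⊗ 1)(Δ ⊗ id ⊗ id)(Φ⁻¹). Associativity of A uses up the factor Φ ⊗ 1. -/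
theorem smashLeft_mul (hQ : Q.IsQuasiBialgebra) (hM : M.IsModuleAlgebra Q) (a b : A) :
    (M.smashLeftAt Q a ⋆ (M.smashLeftAt Q b ⋆ (M.smashAct Q).toLinearMap)) Q.P =
      M.smashLeft Q (M.mul (a ⊗ₜ b)) := by
  have h1 : ∀ (s : H ⊗[k] (H ⊗[k] H)) (z : A ⊗[k] (A ⊗[k] (A ⊗[k] H))),
      M.actA₃ s (TensorProduct.map LinearMap.id M.mulTensor z) =
      TensorProduct.map LinearMap.id M.mulTensor
        (M.actA₄ (rightLeg (leftLeg H Q.comul) s) z) := by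
    intro s z
    refine induction₂ s (fun x y => ?_) fun x y hx hy => ?_
    · refine induction₂ z (fun a w => ?_) fun x y hx hy => ?_
      · simp only [TensorProduct.map_tmul, tensAct_tmul, rightLeg_tmul, LinearMap.id_apply,
          mulTensor_leg' hM]
      · simp only [map_add, hx, hy]
    · simp only [map_add, LinearMap.add_apply, hx, hy]
  have h2 : ∀ (s : H ⊗[k] (H ⊗[k] H)) (t : H ⊗[k] (H ⊗[k] H)) (w : A ⊗[k] H),
      (M.smashLeftAt Q a ⋆ (M.smashLeftAt Q b ⋆ (M.smashAct Q).toLinearMap)) t w =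
      M.mulTensor (TensorProduct.map LinearMap.id M.mulTensor (M.actA₄
        (rightLeg (leftLeg H Q.comul) Q.P' *
        (oneTensor (H ⊗[k] (H ⊗[k] H)) Q.P' * rightLeg (rightLeg Q.comul) t)) (a ⊗ₜ (b ⊗ₜ w)))) := by
    intro s t w
    rw [map_mul, Module.End.mul_apply, ← h1]
    refine induction₂ t (fun x y => ?_) fun x y hx hy => ?_
    · rw [starMul_tmul, Module.End.mul_apply, smashLeftAt_starMul, smashLeftAt_apply,
        smashLeft_apply]
      congr 2
      simp [tensAct_tmul]
    · simp only [map_add, LinearMap.add_apply, mul_add, hx, hy]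
  have h3 : ∀ (s : H ⊗[k] (H ⊗[k] H)) (w : A ⊗[k] H),
      M.mulTensor (M.actA₃ s (M.mul (a ⊗ₜ b) ⊗ₜ w)) =
      M.mulTensor (TensorProduct.map LinearMap.id M.mulTensor (M.actA₄
        (tensorOne₃ Q.P * leftLeg (H ⊗[k] H) Q.comul s) (a ⊗ₜ (b ⊗ₜ w)))) := by
    have h4 : ∀ z : A ⊗[k] (A ⊗[k] (A ⊗[k] H)),
        M.mulTensor (TensorProduct.map LinearMap.id M.mulTensor (M.actA₄ (tensorOne₃ Q.P) z)) =
        M.mulTensor (TensorProduct.map M.mul LinearMap.id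
          ((TensorProduct.assoc k A A (A ⊗[k] H)).symm z)) := by
      intro z
      refine induction₄ z (fun x y z h => ?_) fun x y hx hy => ?_
      · have e : ∀ t : H ⊗[k] (H ⊗[k] H), M.mulTensor (TensorProduct.map LinearMap.id M.mulTensor
            (M.actA₄ (tensorOne₃ t) (x ⊗ₜ (y ⊗ₜ (z ⊗ₜ h))))) =
            M.mulRight₃ (M.act₃ t (x ⊗ₜ (y ⊗ₜ z))) ⊗ₜ h := by
          intro t
          refine induction₃ t (fun a b c => by simp [tensAct_tmul]) fun x y hx hy => ?_
          simp only [map_add, LinearMap.add_apply, TensorProduct.add_tmul, hx, hy]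
        rw [e, mulRight₃, LinearMap.comp_apply, ← hM.quasi_assoc]
        rfl
      · simp only [map_add, hx, hy]
    intro s w
    rw [map_mul, Module.End.mul_apply, h4]
    refine induction₂ s (fun x y => ?_) fun x y hx hy => ?_
    · rw [tensAct_tmul, hM.act_mul, leftLeg_tmul]
      refine induction₂ (Q.comul x) (fun x y => ?_) fun x y hx hy => ?_
      · simp [tensAct_tmul]
      · simp only [TensorProduct.add_tmul, map_add, LinearMap.add_apply, hx, hy]
    · simp only [map_add, LinearMap.add_apply, hx, hy]
  refine LinearMap.ext fun w => ?_
  rw [h2 1, ← hQ.pentagon₃, smashLeft_apply, h3]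

theorem smashLeft_one (hQ : Q.IsQuasiBialgebra) (hM : M.IsModuleAlgebra Q) :
    M.smashLeft Q M.one = 1 := by
  refine LinearMap.ext fun w => ?_
  have key : ∀ t : H ⊗[k] (H ⊗[k] H), M.actA₃ t (M.one ⊗ₜ w) =
      M.actA₃ (Algebra.TensorProduct.map (Q.unitCounit H) (AlgHom.id k (H ⊗[k] H)) t)
        (M.one ⊗ₜ w) := by
    intro t
    refine induction₂ t (fun x y => ?_) fun x y hx hy => ?_
    · rw [Algebra.TensorProduct.map_tmul, tensAct_tmul, tensAct_tmul, hM.act_one,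
        QuasiBialgebraData.unitCounit_apply, AlgHom.commutes]
      rfl
    · simp only [map_add, LinearMap.add_apply, hx, hy]
  rw [smashLeft_apply, key, Q.map_P'_eq_one hQ.map_unitCounit_P, map_one]
  refine induction₂ w (fun x y => by simp [hM.one_mul]) fun x y hx hy => ?_
  simp only [TensorProduct.tmul_add, map_add, hx, hy]

theorem smashLeft_apply_one (hQ : Q.IsQuasiBialgebra) (hM : M.IsModuleAlgebra Q) (a : A) (h : H) :
    M.smashLeft Q a (M.one ⊗ₜ h) = a ⊗ₜ h := by
  have key : ∀ t : H ⊗[k] (H ⊗[k] H), M.actA₃ t (a ⊗ₜ (M.one ⊗ₜ h)) =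
      M.actA₃ (rightLeg (Algebra.TensorProduct.map (Q.unitCounit H) (AlgHom.id k H)) t)
        (a ⊗ₜ (M.one ⊗ₜ h)) := by
    intro t
    refine induction₃ t (fun x y z => ?_) fun x y hx hy => ?_
    · rw [rightLeg_tmul, Algebra.TensorProduct.map_tmul]
      simp only [tensAct_tmul, hM.act_one,
        QuasiBialgebraData.unitCounit_apply, AlgHom.commutes]
      rfl
    · simp only [map_add, LinearMap.add_apply, hx, hy]
  rw [smashLeft_apply, key, Q.map_P'_eq_one hQ.rightLeg_map_unitCounit_P, map_one]
  simp [hM.mul_one]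

/-- With `smashLeft_apply_one` this says that 1 ⊗ 1 generates A ⊗ H under H and A, so evaluation at
1 ⊗ 1 will detect injectivity. -/
theorem smashAct_apply_one (hQ : Q.IsQuasiBialgebra) (hM : M.IsModuleAlgebra Q) (h : H) :
    M.smashAct Q h (M.one ⊗ₜ 1) = M.one ⊗ₜ h := by
  have key : ∀ t : H ⊗[k] H, tensAct M.act (Algebra.lmul k H) t (M.one ⊗ₜ 1) =
      tensAct M.act (Algebra.lmul k H)
        (Algebra.TensorProduct.map (Q.unitCounit H) (AlgHom.id k H) t) (M.one ⊗ₜ 1) := by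
    intro t
    refine induction₂ t (fun x y => ?_) fun x y hx hy => ?_
    · rw [Algebra.TensorProduct.map_tmul, tensAct_tmul, tensAct_tmul, hM.act_one,
        QuasiBialgebraData.unitCounit_apply, AlgHom.commutes]
      rfl
    · simp only [map_add, LinearMap.add_apply, hx, hy]
  change tensAct M.act (Algebra.lmul k H) (Q.comul h) (M.one ⊗ₜ 1) = _
  rw [key, hQ.map_unitCounit_comul]
  simp [tensAct_tmul]

end ModuleAlgebraData

open ModuleAlgebraData

variable {k H A : Type*} [Field k] [Ring H] [Algebra k H] [AddCommGroup A] [Module k A]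
  {M : ModuleAlgebraData k H A} {Q : QuasiHopfData k H}

/-- The map `a ↦ (x¹ · a) # x² β S(x³)` from `A` to endomorphisms of the smash product. -/
def smashHom (M : ModuleAlgebraData k H A) (Q : QuasiHopfData k H) :
    A →ₗ[k] Module.End k (A ⊗[k] H) where
  toFun a := Q.circ (M.smashAct Q.toQuasiBialgebraData) (Q.vS (M.smashAct Q.toQuasiBialgebraData))
    (M.smashLeftAt Q.toQuasiBialgebraData a) (M.smashAct Q.toQuasiBialgebraData Q.beta)
  map_add' a b := by
    have e : M.smashLeftAt Q.toQuasiBialgebraData (a + b) =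
        M.smashLeftAt Q.toQuasiBialgebraData a + M.smashLeftAt Q.toQuasiBialgebraData b :=
      LinearMap.ext fun u => by simp only [smashLeftAt_apply, map_add, LinearMap.add_apply]
    rw [e, QuasiBialgebraData.circ, add_starMul]; rfl
  map_smul' c a := by
    have e : M.smashLeftAt Q.toQuasiBialgebraData (c • a) =
        c • M.smashLeftAt Q.toQuasiBialgebraData a :=
      LinearMap.ext fun u => by simp only [smashLeftAt_apply, map_smul, LinearMap.smul_apply]
    rw [e, QuasiBialgebraData.circ, smul_starMul]; rfl

theorem smashHom_apply (a : A) : smashHom M Q a =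
    Q.circ (M.smashAct Q.toQuasiBialgebraData) (Q.vS (M.smashAct Q.toQuasiBialgebraData))
      (M.smashLeftAt Q.toQuasiBialgebraData a) (M.smashAct Q.toQuasiBialgebraData Q.beta) := rfl

theorem act_smashHom (hQ : Q.IsQuasiHopf) (hM : M.IsModuleAlgebra Q.toQuasiBialgebraData) (u : H)
    (a : A) : smashHom M Q (M.act u a) =
      (Q.adjointAlgebra (M.smashAct Q.toQuasiBialgebraData)).act u (smashHom M Q a) := by
  refine Eq.trans ?_
    (hQ.adjAt_circ (intertwines_smashLeftAt hQ.isQuasiBialgebra hM a) u).symm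
  have e : M.smashLeftAt Q.toQuasiBialgebraData a ∘ₗ LinearMap.mulRight k u =
      M.smashLeftAt Q.toQuasiBialgebraData (M.act u a) := by
    refine LinearMap.ext fun w => ?_
    rw [LinearMap.comp_apply, LinearMap.mulRight_apply, smashLeftAt_mul]
  rw [e]; rfl

/-- `smashHom` is `circ`, with β, of the intertwiner given by left multiplication, so ι returns that
intertwiner. Statements about `smashHom` thereby reduce to `smashLeft`. -/
theorem iotaMap_smashHom (hQ : Q.IsQuasiHopf) (hM : M.IsModuleAlgebra Q.toQuasiBialgebraData)
    (a : A) : Q.iotaMap (M.smashAct Q.toQuasiBialgebraData) (smashHom M Q a) =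
      M.smashLeftAt Q.toQuasiBialgebraData a := by
  refine LinearMap.ext fun u => ?_
  have h := hQ.iota_circ_beta (intertwines_smashLeftAt hQ.isQuasiBialgebra hM (M.act u a))
  rw [smashLeftAt_apply, map_one, Module.End.one_apply, ← smashHom_apply] at h
  rw [smashLeftAt_apply, ← h, act_smashHom hQ hM]
  rfl

theorem isHom_smashHom (hQ : Q.IsQuasiHopf) (hM : M.IsModuleAlgebra Q.toQuasiBialgebraData) :
    IsHom M (Q.adjointAlgebra (M.smashAct Q.toQuasiBialgebraData)) (smashHom M Q) where
  act := act_smashHom hQ hM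
  mul a b := by
    refine hQ.iota_ext (M.smashAct Q.toQuasiBialgebraData) fun u => ?_
    rw [iotaMap_smashHom hQ hM, hQ.iotaMap_mul, iotaMap_smashHom hQ hM, iotaMap_smashHom hQ hM,
      smashLeftAt_apply, hM.act_mul]
    refine induction₂ (Q.comul u) (fun x y => ?_) fun x y hx hy => ?_
    · rw [tensAct_tmul, ← smashLeft_mul hQ.isQuasiBialgebra hM, tensorOne₂_tmul]
      refine induction₃ Q.P (fun p q r => ?_) fun x y hx hy => ?_
      · simp [smashLeftAt_mul]
      · simp only [map_add, add_mul, hx, hy]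
    · simp only [map_add, LinearMap.add_apply, mul_add, hx, hy]
  one := by
    have e : M.smashLeftAt Q.toQuasiBialgebraData M.one =
        (Q.unitCounit (Module.End k (A ⊗[k] H))).toLinearMap := by
      refine LinearMap.ext fun u => ?_
      rw [smashLeftAt_apply, hM.act_one, map_smul, smashLeft_one hQ.isQuasiBialgebra hM,
        AlgHom.toLinearMap_apply, QuasiBialgebraData.unitCounit_apply,
        Algebra.algebraMap_eq_smul_one]
    change Q.circ _ _ (M.smashLeftAt Q.toQuasiBialgebraData M.one) _ = _
    rw [e, QuasiBialgebraData.circ, hQ.isQuasiBialgebra.unitCounit_starMul_P',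
      Algebra.TensorProduct.one_def]
    simp only [starMul_tmul, mulAt_apply, LinearMap.comp_apply, QuasiHopfData.S_one,
      AlgHom.toLinearMap_apply, map_one, one_mul, mul_one]
    rfl

/-- The homomorphism `a ⊗ h ↦ (x¹ · a) # x² h S(x³)` from `A ◇ H₀`. -/
abbrev smashMap (M : ModuleAlgebraData k H A) (Q : QuasiHopfData k H) :
    A ⊗[k] H →ₗ[k] Module.End k (A ⊗[k] H) :=
  (Q.adjointAlgebra (M.smashAct Q.toQuasiBialgebraData)).mulMap (smashHom M Q)
    (M.smashAct Q.toQuasiBialgebraData).toLinearMap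

/-- The product of B^v is `circ` of ι, and ι of `smashHom` is left multiplication; at 1 ⊗ 1 this
leaves (x¹·a) ⊗ x² h S(x³), an invertible operator on a ⊗ h. -/
theorem smashMap_apply_one (hQ : Q.IsQuasiHopf) (hM : M.IsModuleAlgebra Q.toQuasiBialgebraData)
    (z : A ⊗[k] H) : smashMap M Q z (M.one ⊗ₜ 1) = tensAct M.act Q.sandwich Q.P' z := by
  refine induction₂ z (fun a h => ?_) fun x y hx hy => ?_
  · rw [smashMap, mulMap_tmul, ← hQ.circ_iotaMap, iotaMap_smashHom hQ hM, QuasiBialgebraData.circ]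
    refine induction₃ Q.P' (fun x y z => ?_) fun x y hx hy => ?_
    · have e : (M.smashAct Q.toQuasiBialgebraData).toLinearMap y *
          (M.smashAct Q.toQuasiBialgebraData).toLinearMap h *
          (Q.vS (M.smashAct Q.toQuasiBialgebraData)) z =
          M.smashAct Q.toQuasiBialgebraData (y * h * Q.S z) := by simp
      rw [starMul_tmul, starMul_tmul, mulAt_apply, e, Module.End.mul_apply,
        smashAct_apply_one hQ.isQuasiBialgebra hM, smashLeftAt_apply,
        smashLeft_apply_one hQ.isQuasiBialgebra hM, tensAct_tmul, QuasiHopfData.sandwich_tmul]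
    · simp only [map_add, LinearMap.add_apply, hx, hy]
  · simp only [map_add, LinearMap.add_apply, hx, hy]

theorem smashMap_injective (hQ : Q.IsQuasiHopf)
    (hM : M.IsModuleAlgebra Q.toQuasiBialgebraData) : Function.Injective (smashMap M Q) := by
  intro z z' h
  have e := congrArg (fun f => f (M.one ⊗ₜ 1)) h
  simp only [smashMap_apply_one hQ hM] at e
  have e' := congrArg (tensAct M.act Q.sandwich Q.P) e
  simpa only [← Module.End.mul_apply, Q.map_P_mul, Module.End.one_apply] using e'

end

/-! ### Two antipodes along Δ, and the Drinfeld twist. -/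

section

variable {k H : Type*} [Field k] [Ring H] [Algebra k H]

/-- `a ↦ a ⊗ 1` -/
abbrev inl : H →ₐ[k] H ⊗[k] H := Algebra.TensorProduct.includeLeft

/-- `a ↦ 1 ⊗ a` -/
abbrev inr : H →ₐ[k] H ⊗[k] H := Algebra.TensorProduct.includeRight

theorem inl_starMul_inr :
    (inl (k := k) (H := H)).toLinearMap ⋆ (inr (k := k) (H := H)).toLinearMap = LinearMap.id := by
  refine TensorProduct.ext' fun x y => ?_
  simp

namespace QuasiBialgebraData.IsAntipodal

variable {Q : QuasiBialgebraData k H} {B : Type*} [Ring B] [Algebra k B] {v : H →ₐ[k] B}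
  {σ σ' : H →ₗ[k] B} {α α' β β' : B}

/-- `σ(u) α` intertwines the trivial action with the diagonal one. -/
theorem intertwines_unitCounit (hA : Q.IsAntipodal v σ α β) :
    Q.Intertwines v (Q.unitCounit B) (mulAt σ α) := by
  intro u w
  rw [hA.left_mul, unitCounit_apply, unitCounit_apply, Algebra.algebraMap_eq_smul_one,
    Algebra.algebraMap_eq_smul_one, smul_mul_assoc, smul_mul_assoc, map_smul]
  simp

/-- The element `U = σ(x¹) α x² β' σ'(x³)` satisfies `U α' = α`. -/
theorem circ_mul (hA : Q.IsAntipodal v σ α β) (hA' : Q.IsAntipodal v σ' α' β')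
    (hQ : Q.IsQuasiBialgebra) (hP : conj₃ v σ' α' Q.P β' = 1) :
    Q.circ v σ' (mulAt σ α) β' * α' = α := by
  -- λ(u) = σ(u) α is an intertwiner for the trivial action v' = ε(·)1. The inversion lemma returns
  -- λ(1) = α, while triviality of v' reduces its left side to U α'.
  have h := hA'.conj₃_circ_beta hQ hP hA.intertwines_unitCounit
  rw [mulAt_apply, hA.antipode_one, one_mul] at h
  have key : ∀ t : H ⊗[k] (H ⊗[k] H), (mulAt (Q.unitCounit B).toLinearMap
      (Q.circ v σ' (mulAt σ α) β') ⋆ (mulAt σ' α' ⋆ v.toLinearMap)) t =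
      (mulAt LinearMap.id (Q.circ v σ' (mulAt σ α) β') ⋆ (mulAt σ' α' ⋆ v.toLinearMap))
        (Algebra.TensorProduct.map (Q.unitCounit B) (AlgHom.id k (H ⊗[k] H)) t) := by
    intro t
    refine induction₂ t (fun x y => by simp) fun x y hx hy => ?_
    simp only [map_add, hx, hy]
  refine Eq.trans ?_ h
  rw [key, hQ.map_unitCounit_P, Algebra.TensorProduct.one_def, Algebra.TensorProduct.one_def]
  simp [hA'.antipode_one]

/-- The element `U = σ(x¹) α x² β' σ'(x³)` satisfies `σ(u) U = U σ'(u)`. -/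
theorem mul_circ (hA : Q.IsAntipodal v σ α β) (hA' : Q.IsAntipodal v σ' α' β')
    (hQ : Q.IsQuasiBialgebra) (u : H) :
    σ u * Q.circ v σ' (mulAt σ α) β' = Q.circ v σ' (mulAt σ α) β' * σ' u := by
  have h := hQ.coassoc_mul' u
  have h' := congrArg (mulAt σ α ⋆ (mulAt v.toLinearMap β' ⋆ σ')) h
  -- In (Δ ⊗ id)Δ(u) Φ⁻¹ the first two legs collapse by α and u stays in the third; in Φ⁻¹ (id ⊗
  -- Δ)Δ(u) the last two collapse by β' and u stays in the first.
  rw [starMul_leftLeg_congr (hA.left_mul_mulAt β'), hQ.leftLeg_unitCounit_comul,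
    starMul_mul_rightLeg_congr hA'.mul_right, hQ.rightLeg_unitCounit_comul] at h'
  have h₁ : ∀ t : H ⊗[k] (H ⊗[k] H), (mulAt σ α ⋆ (mulAt v.toLinearMap β' ⋆ σ'))
      ((1 ⊗ₜ (1 ⊗ₜ u)) * t) = (mulAt σ α ⋆ (mulAt v.toLinearMap β' ⋆ σ')) t * σ' u := by
    intro t
    refine induction₃ t (fun x y z => by simp [hA'.antipode_mul, mul_assoc]) fun x y hx hy => ?_
    simp only [map_add, mul_add, add_mul, hx, hy]
  have h₂ : ∀ t : H ⊗[k] (H ⊗[k] H), (mulAt σ α ⋆ (mulAt v.toLinearMap β' ⋆ σ'))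
      (t * (u ⊗ₜ 1)) = σ u * (mulAt σ α ⋆ (mulAt v.toLinearMap β' ⋆ σ')) t := by
    intro t
    refine induction₃ t (fun x y z => ?_) fun x y hx hy => ?_
    · simp [Algebra.TensorProduct.one_def, hA.antipode_mul, mul_assoc]
    · simp only [map_add, mul_add, add_mul, hx, hy]
  rw [h₁, h₂] at h'
  exact h'.symm

end QuasiBialgebraData.IsAntipodal

namespace QuasiHopfData

variable (Q : QuasiHopfData k H)

theorem flipS_mul (d e : H ⊗[k] H) : Q.flipS (d * e) = Q.flipS e * Q.flipS d := by
  refine induction₂ d (fun x y => ?_) fun x y hx hy => ?_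
  · refine induction₂ e (fun a c => by simp [flipS, S_mul]) fun x y hx hy => ?_
    simp only [map_add, mul_add, add_mul, hx, hy]
  · simp only [map_add, mul_add, add_mul, hx, hy]

theorem flipS_tmul (x y : H) : Q.flipS (x ⊗ₜ y) = Q.S y ⊗ₜ Q.S x := by simp [flipS]

/-- `h ↦ (S ⊗ S)(Δᶜᵒᵖ(h))`. -/
abbrev SS : H →ₗ[k] H ⊗[k] H := Q.flipS ∘ₗ Q.comul.toLinearMap

/-- `t₁ ⊗ t₂ ⊗ t₃ ⊗ t₄ ↦ S(t₂) α t₃ ⊗ S(t₁) α t₄`. -/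
def gammaMap : H ⊗[k] (H ⊗[k] (H ⊗[k] H)) →ₗ[k] H ⊗[k] H :=
  mulAt (Q.vS inr) (inr Q.alpha) ⋆ (mulAt (Q.vS inl) (inl Q.alpha) ⋆
    (inl.toLinearMap ⋆ inr.toLinearMap))

theorem gammaMap_tmul (a b c d : H) : Q.gammaMap (a ⊗ₜ (b ⊗ₜ (c ⊗ₜ d))) =
    (Q.S b * Q.alpha * c) ⊗ₜ (Q.S a * Q.alpha * d) := by
  simp [gammaMap]

/-- Drinfeld's element `γ`. -/
def gamma : H ⊗[k] H := Q.gammaMap Q.mulElt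

/-- In this order legs 2 and 3 are nested inside legs 1 and 4, so the axiom for β applies to an
adjacent pair. -/
theorem deltaMap_eq : Q.deltaMap = mulAt inl.toLinearMap (inl Q.beta) ⋆
    (mulAt inr.toLinearMap (inr Q.beta) ⋆ (Q.vS inr ⋆ Q.vS inl)) := by
  refine LinearMap.ext fun t => ?_
  refine induction₄ t (fun a b c d => ?_) fun x y hx hy => ?_
  · simp [deltaMap_tmul, mul_assoc]
  · simp only [map_add, hx, hy]

variable {Q}

theorem IsQuasiHopf.gammaMap_congr (hQ : Q.IsQuasiHopf)
    (s : H ⊗[k] (H ⊗[k] H)) (T : H ⊗[k] (H ⊗[k] (H ⊗[k] H))) :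
    Q.gammaMap (rightLeg (leftLeg H Q.comul) s * T) =
      Q.gammaMap (rightLeg (leftLeg H (Q.unitCounit (H ⊗[k] H))) s * T) :=
  starMul_rightLeg_congr (starMul_leftLeg_congr (hQ.isAntipodal inl).left_mul inr.toLinearMap) _ _ _

theorem IsQuasiHopf.deltaMap_congr (hQ : Q.IsQuasiHopf)
    (s : H ⊗[k] (H ⊗[k] H)) (T : H ⊗[k] (H ⊗[k] (H ⊗[k] H))) :
    Q.deltaMap (T * rightLeg (leftLeg H Q.comul) s) =
      Q.deltaMap (T * rightLeg (leftLeg H (Q.unitCounit (H ⊗[k] H))) s) := by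
  rw [deltaMap_eq]
  exact starMul_mul_rightLeg_congr
    (starMul_mul_leftLeg_congr (hQ.isAntipodal inr).mul_right (Q.vS inl)) _ _ _

/-- By `mulElt_mul` the comultiplied h passes to the left of the element defining γ. There α
collapses the inner legs 2 and 3, and after that the outer legs 1 and 4. -/
theorem IsQuasiHopf.gamma_left (hQ : Q.IsQuasiHopf) (h : H) :
    (mulAt Q.SS Q.gamma ⋆ Q.comul.toLinearMap) (Q.comul h) = Q.counit h • Q.gamma := by
  have hq := hQ.isQuasiBialgebra
  have h₁ : ∀ (d : H ⊗[k] H) (t : H ⊗[k] (H ⊗[k] (H ⊗[k] H))),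
      (mulAt Q.SS (Q.gammaMap t) ⋆ Q.comul.toLinearMap) d =
        Q.gammaMap (t * leftLeg (H ⊗[k] H) Q.comul (rightLeg Q.comul d)) := by
    intro d t
    refine induction₂ d (fun x y => ?_) fun x y hx hy => ?_
    · rw [starMul_tmul, mulAt_apply, LinearMap.comp_apply, rightLeg_tmul, leftLeg_tmul,
        AlgHom.toLinearMap_apply, AlgHom.toLinearMap_apply]
      refine induction₂ (Q.comul x) (fun x₁ x₂ => ?_) fun x y hx hy => ?_
      · refine induction₂ (Q.comul y) (fun y₁ y₂ => ?_) fun x y hx hy => ?_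
        · refine induction₄ t (fun t₁ t₂ t₃ t₄ => ?_) fun x y hx hy => ?_
          · simp [gammaMap_tmul, flipS_tmul, S_mul, mul_assoc]
          · simp only [map_add, mul_add, add_mul, hx, hy]
        · simp only [map_add, mul_add, TensorProduct.tmul_add, hx, hy]
      · simp only [map_add, mul_add, add_mul, TensorProduct.add_tmul, hx, hy]
    · simp only [map_add, mul_add, hx, hy]
  have h₂ : ∀ (d : H ⊗[k] H) (t : H ⊗[k] (H ⊗[k] (H ⊗[k] H))),
      Q.gammaMap (rightLeg (leftLeg H (Q.unitCounit (H ⊗[k] H))) (rightLeg Q.comul d) * t) =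
        (mulAt (Q.vS inr) (inr (Q.SMul Q.alpha d)) ⋆ (mulAt (Q.vS inl) (inl Q.alpha) ⋆
          (inl.toLinearMap ⋆ inr.toLinearMap))) t := by
    intro d t
    refine induction₂ d (fun x y => ?_) fun x y hx hy => ?_
    · rw [rightLeg_tmul, rightLeg_tmul, hq.leftLeg_unitCounit_comul]
      refine induction₄ t (fun t₁ t₂ t₃ t₄ => ?_) fun x y hx hy => ?_
      · simp [gammaMap_tmul, SMul_tmul, S_mul, mul_assoc]
      · simp only [map_add, mul_add, hx, hy]
    · simp only [map_add, add_mul, mulAt_add, add_starMul, LinearMap.add_apply, hx, hy]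
  rw [gamma, h₁, hq.mulElt_mul, ← rightLeg_comp, hQ.gammaMap_congr, h₂, hQ.antipode_left,
    map_smul, mulAt_smul, smul_starMul]
  rfl

/-- Dual to `gamma_left`: quasi-coassociativity carries the comultiplied h to the right of the
element defining δ, where β collapses the inner legs and then the outer ones. -/
theorem IsQuasiHopf.delta_right (hQ : Q.IsQuasiHopf) (h : H) :
    (mulAt Q.comul.toLinearMap Q.delta ⋆ Q.SS) (Q.comul h) = Q.counit h • Q.delta := by
  have hq := hQ.isQuasiBialgebra
  have h₁ : ∀ (d : H ⊗[k] H) (t : H ⊗[k] (H ⊗[k] (H ⊗[k] H))),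
      (mulAt Q.comul.toLinearMap (Q.deltaMap t) ⋆ Q.SS) d =
        Q.deltaMap (leftLeg (H ⊗[k] H) Q.comul (rightLeg Q.comul d) * t) := by
    intro d t
    refine induction₂ d (fun x y => ?_) fun x y hx hy => ?_
    · rw [starMul_tmul, mulAt_apply, LinearMap.comp_apply, rightLeg_tmul, leftLeg_tmul,
        AlgHom.toLinearMap_apply, AlgHom.toLinearMap_apply]
      refine induction₂ (Q.comul x) (fun x₁ x₂ => ?_) fun x y hx hy => ?_
      · refine induction₂ (Q.comul y) (fun y₁ y₂ => ?_) fun x y hx hy => ?_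
        · refine induction₄ t (fun t₁ t₂ t₃ t₄ => ?_) fun x y hx hy => ?_
          · simp [deltaMap_tmul, flipS_tmul, S_mul, mul_assoc]
          · simp only [map_add, mul_add, add_mul, hx, hy]
        · simp only [map_add, mul_add, add_mul, TensorProduct.tmul_add, hx, hy]
      · simp only [map_add, add_mul, TensorProduct.add_tmul, hx, hy]
    · simp only [map_add, add_mul, hx, hy]
  have h₂ : ∀ (d : H ⊗[k] H) (t : H ⊗[k] (H ⊗[k] (H ⊗[k] H))),
      Q.deltaMap (t * rightLeg (leftLeg H (Q.unitCounit (H ⊗[k] H))) (leftLeg H Q.comul d)) =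
        (mulAt inl.toLinearMap (inl (Q.MulS Q.beta d)) ⋆
          (mulAt inr.toLinearMap (inr Q.beta) ⋆ (Q.vS inr ⋆ Q.vS inl))) t := by
    intro d t
    refine induction₂ d (fun x y => ?_) fun x y hx hy => ?_
    · rw [rightLeg_leftLeg_leftLeg, hq.rightLeg_unitCounit_comul, Algebra.TensorProduct.one_def,
        assoc₃_tmul]
      refine induction₄ t (fun t₁ t₂ t₃ t₄ => ?_) fun x y hx hy => ?_
      · simp [deltaMap_tmul, MulS_tmul, S_mul, mul_assoc]
      · simp only [map_add, add_mul, hx, hy]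
    · simp only [map_add, mul_add, mulAt_add, add_starMul, LinearMap.add_apply, hx, hy]
  have e : Q.delta = Q.deltaMap (leftLeg (H ⊗[k] H) Q.comul Q.P * tensorOneB H Q.P') := rfl
  have e' : leftLeg (H ⊗[k] H) Q.comul (rightLeg Q.comul (Q.comul h)) *
      leftLeg (H ⊗[k] H) Q.comul Q.P = leftLeg (H ⊗[k] H) Q.comul Q.P *
        leftLeg (H ⊗[k] H) Q.comul (leftLeg H Q.comul (Q.comul h)) := by
    rw [← map_mul, hq.coassoc_mul, map_mul]
  rw [e, h₁, ← mul_assoc, e', mul_assoc, hq.coassoc_first', ← mul_assoc, hQ.deltaMap_congr, h₂,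
    hQ.antipode_right, map_smul, mulAt_smul, smul_starMul, deltaMap_eq]
  rfl

/-- A second antipode along Δ, besides the image of S under Δ. Two antipodes along the same map
differ by an element, here g. -/
theorem IsQuasiHopf.isAntipodal_comul (hQ : Q.IsQuasiHopf) :
    Q.IsAntipodal Q.comul Q.SS Q.gamma Q.delta where
  antipode_mul x y := by simp [flipS_mul]
  antipode_one := by simp [Algebra.TensorProduct.one_def, flipS_tmul, S_one]
  left := hQ.gamma_left
  right := hQ.delta_right

/-- Puts g in the form of `circ_mul` and `mul_circ`, which will yield g γ = Δ(α) and Δ(S(u)) g = g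
(S ⊗ S)(Δᶜᵒᵖ(u)). -/
theorem g_eq : Q.g = Q.circ Q.comul Q.SS (mulAt (Q.vS Q.comul) (Q.comul Q.alpha)) Q.delta := by
  have key : ∀ t, Q.gMap ((TensorProduct.assoc k H H H).symm t) =
      (mulAt (Q.vS Q.comul) (Q.comul Q.alpha) ⋆ (mulAt Q.comul.toLinearMap Q.delta ⋆ Q.SS)) t := by
    intro t
    refine induction₃ t (fun a b c => ?_) fun x y hx hy => ?_
    · simp [gMap_tmul, mul_assoc]
    · simp only [map_add, hx, hy]
  exact key Q.P'

/-- `t ↦ Δ(t₁) c (1 ⊗ S(t₂)) (S(t₃) α t₄ ⊗ 1)`. -/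
def coactMap (Q : QuasiHopfData k H) (c : H ⊗[k] H) :
    H ⊗[k] (H ⊗[k] (H ⊗[k] H)) →ₗ[k] H ⊗[k] H :=
  mulAt Q.comul.toLinearMap c ⋆ (Q.vS inr ⋆ (mulAt (Q.vS inl) (inl Q.alpha) ⋆ inl.toLinearMap))

theorem coactMap_tmul (c : H ⊗[k] H) (x y z w : H) : Q.coactMap c (x ⊗ₜ (y ⊗ₜ (z ⊗ₜ w))) =
    Q.comul x * (c * ((Q.S z * Q.alpha * w) ⊗ₜ Q.S y)) := by
  simp [coactMap, mul_assoc]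

/-- The S⁻¹ in q cancels against S, and the inner part of the coaction is read off from (1 ⊗ Φ)(id ⊗
Δ ⊗ id)(Φ). In the pentagon form of this element α absorbs the leading (id ⊗ id ⊗ Δ)(Φ). -/
theorem IsQuasiHopf.coactInner_eq (hQ : Q.IsQuasiHopf) (c : H ⊗[k] H) :
    Q.coactInner c Q.P =
      Q.coactMap c (leftLeg (H ⊗[k] H) Q.comul Q.P * tensorOne₃ Q.P') := by
  have h₁ : ∀ (s t : H ⊗[k] (H ⊗[k] H)) (q : H ⊗[k] H), q = Q.qMap t →
      LinearMap.mul' k (H ⊗[k] H) (TensorProduct.map Q.comul.toLinearMap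
      (LinearMap.mulLeft k c ∘ₗ LinearMap.mul' k (H ⊗[k] H) ∘ₗ
        TensorProduct.map (Q.flipS ∘ₗ LinearMap.mulLeft k q ∘ₗ Q.comul.toLinearMap)
          (Algebra.TensorProduct.includeLeft : H →ₐ[k] H ⊗[k] H).toLinearMap) s) =
      Q.coactMap c (oneTensor (H ⊗[k] (H ⊗[k] H)) t * rightLeg (leftLeg H Q.comul) s) := by
    intro s t q hq
    refine induction₃ s (fun s₁ s₂ s₃ => ?_) fun x y hx hy => ?_
    · rw [hq, rightLeg_tmul, leftLeg_tmul]
      simp only [TensorProduct.map_tmul, LinearMap.comp_apply, LinearMap.mul'_apply,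
        LinearMap.mulLeft_apply, AlgHom.toLinearMap_apply]
      refine induction₂ (Q.comul s₂) (fun x y => ?_) fun x y hx hy => ?_
      · clear hq
        refine induction₃ t (fun t₁ t₂ t₃ => ?_) fun x y hx hy => ?_
        · simp [qMap_tmul, flipS_tmul, coactMap_tmul, S_mul, S_Sinv, mul_assoc]
        · simp only [map_add, add_mul, mul_add, hx, hy]
      · simp only [map_add, TensorProduct.add_tmul, TensorProduct.tmul_add, add_mul, mul_add,
          hx, hy]
    · simp only [map_add, mul_add, hx, hy]
  refine (h₁ Q.P Q.P Q.q rfl).trans ?_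
  rw [hQ.isQuasiBialgebra.pentagon₂, coactMap,
    starMul_rightLeg_congr (starMul_rightLeg_congr (hQ.isAntipodal inl).left_mul (Q.vS inr)),
    hQ.isQuasiBialgebra.rightLeg_rightLeg_unitCounit_P, one_mul]

end QuasiHopfData

end

/-! ### The commutation rule behind the coaction. -/

section

variable {k H : Type*} [Field k] [Ring H] [Algebra k H]

theorem mul_mul_eq_of_mul_eq {M : Type*} [Semigroup M] {a b c d : M} (h : a * b = c * d) (z : M) :
    a * (b * z) = c * (d * z) := by
  rw [← mul_assoc, h, mul_assoc]

/-- The monoid skeleton of `fiveLeg`: `h₅` and `h₆` are pentagons and the other hypotheses are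
exchange relations. -/
theorem mul_eq_of_exchange {M : Type*} [Semigroup M] {a b b' c c' o o₁ o₂ p p' q q' t t' z : M}
    (h₁ : o * a = o₁ * o₂) (h₂ : o₂ * b = b' * o₂) (h₃ : o₂ * c = c' * z) (h₄ : z * t = t' * z)
    (h₅ : p * q = a * (b * c)) (h₆ : p' * q' = o₁ * (b' * c')) :
    o * (p * (q * t)) = p' * (q' * t') * z := by
  rw [← mul_assoc p, h₅, ← mul_assoc p', h₆]
  simp only [mul_assoc]
  rw [mul_mul_eq_of_mul_eq h₁, mul_mul_eq_of_mul_eq h₂, mul_mul_eq_of_mul_eq h₃, h₄]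

theorem leftLeg_tensorOne₂ (f : H →ₐ[k] H ⊗[k] H) (d : H ⊗[k] H) :
    leftLeg (H ⊗[k] H) f (tensorOne₂ d) = tensorOne₃ (leftLeg H f d) := by
  refine induction₂ d (fun x y => ?_) fun x y hx hy => ?_
  · rw [tensorOne₂_tmul, leftLeg_tmul, leftLeg_tmul]
    refine induction₂ (f x) (fun z w => by simp) fun x y hx hy => ?_
    simp only [TensorProduct.add_tmul, map_add, hx, hy]
  · simp only [map_add, hx, hy]

theorem tensorOne₂_eq_assoc (d : H ⊗[k] H) :
    tensorOne₂ d = TensorProduct.assoc k H H H (d ⊗ₜ 1) := by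
  refine induction₂ d (fun x y => by simp) fun x y hx hy => ?_
  simp only [TensorProduct.add_tmul, map_add, hx, hy]

theorem tensorOne₃_rightLeg (f : H →ₐ[k] H ⊗[k] H) (d : H ⊗[k] H) :
    tensorOne₃ (rightLeg f d) = rightLeg (leftLeg H f) (tensorOne₂ d) := by
  refine induction₂ d (fun x y => ?_) fun x y hx hy => ?_
  · rw [tensorOne₂_tmul, rightLeg_tmul, rightLeg_tmul, leftLeg_tmul, ← tensorOne₂_eq_assoc]
    rfl
  · simp only [map_add, hx, hy]

theorem rightLeg_leftLeg_tensorOne₃ (f : H →ₐ[k] H ⊗[k] H) (s : H ⊗[k] (H ⊗[k] H)) :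
    rightLeg (leftLeg (H ⊗[k] H) f) (tensorOne₃ s) =
      rightLeg tensorOne₃ (rightLeg (leftLeg H f) s) := by
  refine induction₂ s (fun x y => ?_) fun x y hx hy => ?_
  · rw [rightLeg_tmul, rightLeg_tmul, ← leftLeg_tensorOne₂]; rfl
  · simp only [map_add, hx, hy]

theorem rightLeg_tensorOne₃_rightLeg (f : H →ₐ[k] H ⊗[k] H) (s : H ⊗[k] (H ⊗[k] H)) :
    rightLeg tensorOne₃ (rightLeg (rightLeg f) s) =
      rightLeg (rightLeg (leftLeg H f)) (tensorOne₃ s) := by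
  refine induction₂ s (fun x y => ?_) fun x y hx hy => ?_
  · rw [rightLeg_tmul, rightLeg_tmul, tensorOne₃_rightLeg]; rfl
  · simp only [map_add, hx, hy]

theorem leftLeg_tensorOne₃ (f : H →ₐ[k] H ⊗[k] H) (s : H ⊗[k] (H ⊗[k] H)) :
    leftLeg (H ⊗[k] (H ⊗[k] H)) f (tensorOne₃ s) =
      rightLeg (tensorOne₃ (k := k) (H := H)) (leftLeg (H ⊗[k] H) f s) := by
  refine induction₂ s (fun x y => ?_) fun x y hx hy => ?_
  · change leftLeg (H ⊗[k] (H ⊗[k] H)) f (x ⊗ₜ tensorOne₂ y) = _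
    rw [leftLeg_tmul, leftLeg_tmul]
    refine induction₂ (f x) (fun z w => rfl) fun x y hx hy => ?_
    simp only [TensorProduct.add_tmul, map_add, hx, hy]
  · simp only [map_add, hx, hy]

namespace QuasiBialgebraData

variable {Q : QuasiBialgebraData k H}

/-- `(1 ⊗ Φ)(id ⊗ Δ ⊗ id)(Φ (Δ(w) ⊗ 1))(Φ ⊗ 1) = (id ⊗ id ⊗ Δ)(Φ)(Δ ⊗ id ⊗ id)(Φ (Δ(w) ⊗ 1))` -/
theorem IsQuasiBialgebra.pentagon_comul (hQ : Q.IsQuasiBialgebra) (w : H) :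
    oneTensor (H ⊗[k] (H ⊗[k] H)) Q.P *
      rightLeg (leftLeg H Q.comul) (Q.P * tensorOne₂ (Q.comul w)) * tensorOne₃ Q.P =
    rightLeg (rightLeg Q.comul) Q.P *
      leftLeg (H ⊗[k] H) Q.comul (Q.P * tensorOne₂ (Q.comul w)) := by
  have e : rightLeg (leftLeg H Q.comul) (tensorOne₂ (Q.comul w)) * tensorOne₃ Q.P =
      tensorOne₃ Q.P * leftLeg (H ⊗[k] H) Q.comul (tensorOne₂ (Q.comul w)) := by
    rw [← tensorOne₃_rightLeg, leftLeg_tensorOne₂, ← map_mul, hQ.coassoc_mul, map_mul]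
  rw [map_mul, map_mul, mul_assoc, mul_assoc, e, ← mul_assoc, ← mul_assoc, ← mul_assoc,
    hQ.pentagon]

-- The identity linking ι for the second antipode, which brings in γ, with the coaction. The
-- pentagon is applied under id ⊗ Δ ⊗ id ⊗ id on the left and under id ⊗ id ⊗ Δ ⊗ id on the right.
-- The factor built from `mulElt` then crosses the resulting terms one at a time, by a further
-- pentagon or by quasi-coassociativity.
set_option maxHeartbeats 1000000 in
theorem IsQuasiBialgebra.fiveLeg (hQ : Q.IsQuasiBialgebra) (w : H) :
    oneTensor (H ⊗[k] (H ⊗[k] (H ⊗[k] H)))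
        (oneTensor (H ⊗[k] (H ⊗[k] H)) Q.P' * rightLeg (rightLeg Q.comul) Q.P) *
      (rightLeg (leftLeg (H ⊗[k] H) Q.comul) (rightLeg (rightLeg Q.comul) Q.P) *
      rightLeg (leftLeg (H ⊗[k] H) Q.comul)
        (leftLeg (H ⊗[k] H) Q.comul (Q.P * tensorOne₂ (Q.comul w)))) =
    rightLeg (rightLeg (leftLeg H Q.comul)) (rightLeg (rightLeg Q.comul) Q.P *
        leftLeg (H ⊗[k] H) Q.comul (Q.P * tensorOne₂ (Q.comul w))) *
      rightLeg (tensorOne₃ (k := k) (H := H)) (leftLeg (H ⊗[k] H) Q.comul Q.P * tensorOne₃ Q.P') := by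
  have a₁ : oneTensor (H ⊗[k] (H ⊗[k] (H ⊗[k] H)))
        (oneTensor (H ⊗[k] (H ⊗[k] H)) Q.P' * rightLeg (rightLeg Q.comul) Q.P) *
      rightLeg (leftLeg (H ⊗[k] H) Q.comul)
          (oneTensor (k := k) (H := H) (H ⊗[k] (H ⊗[k] H)) Q.P) =
      oneTensor (H ⊗[k] (H ⊗[k] (H ⊗[k] H))) (rightLeg (leftLeg H Q.comul) Q.P) *
        oneTensor (H ⊗[k] (H ⊗[k] (H ⊗[k] H))) (tensorOne₃ Q.P) := by
    rw [rightLeg_oneTensor, ← map_mul, mul_assoc, hQ.pentagon₄, map_mul]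
  have a₂ : oneTensor (H ⊗[k] (H ⊗[k] (H ⊗[k] H))) (tensorOne₃ Q.P) *
      rightLeg (leftLeg (H ⊗[k] H) Q.comul) (rightLeg (leftLeg H Q.comul) Q.P) =
      rightLeg (rightLeg (leftLeg H Q.comul)) (rightLeg (leftLeg H Q.comul) Q.P) *
        oneTensor (H ⊗[k] (H ⊗[k] (H ⊗[k] H))) (tensorOne₃ Q.P) := by
    rw [rightLeg_comp, rightLeg_comp]
    exact (rightLeg_mul_oneTensor (fun x => hQ.coassoc_first x) _).symm
  have a₃ : oneTensor (H ⊗[k] (H ⊗[k] (H ⊗[k] H))) (tensorOne₃ Q.P) *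
      rightLeg (leftLeg (H ⊗[k] H) Q.comul) (tensorOne₃ Q.P) =
      rightLeg (rightLeg (leftLeg H Q.comul)) (tensorOne₃ Q.P) *
      rightLeg (tensorOne₃ (k := k) (H := H)) (leftLeg (H ⊗[k] H) Q.comul Q.P * tensorOne₃ Q.P') := by
    rw [rightLeg_leftLeg_tensorOne₃, ← rightLeg_oneTensor, ← map_mul, hQ.pentagon₂, map_mul,
      rightLeg_tensorOne₃_rightLeg]
  have a₄ : rightLeg (tensorOne₃ (k := k) (H := H)) (leftLeg (H ⊗[k] H) Q.comul Q.P * tensorOne₃ Q.P') *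
      rightLeg (leftLeg (H ⊗[k] H) Q.comul)
        (leftLeg (H ⊗[k] H) Q.comul (tensorOne₂ (Q.comul w))) =
      rightLeg (rightLeg (leftLeg H Q.comul))
        (leftLeg (H ⊗[k] H) Q.comul (tensorOne₂ (Q.comul w))) *
      rightLeg (tensorOne₃ (k := k) (H := H)) (leftLeg (H ⊗[k] H) Q.comul Q.P * tensorOne₃ Q.P') := by
    have b₁ : rightLeg (tensorOne₃ (k := k) (H := H)) (leftLeg (H ⊗[k] H) Q.comul Q.P * tensorOne₃ Q.P') =
        leftLeg (H ⊗[k] (H ⊗[k] H)) Q.comul (tensorOne₃ Q.P) * tensorOneB (H ⊗[k] H) Q.P' := by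
      rw [map_mul, ← leftLeg_tensorOne₃]
      congr 1
      refine induction₃ Q.P' (fun a b c => rfl) fun x y hx hy => ?_
      simp only [map_add, hx, hy]
    rw [b₁, mul_assoc, ← hQ.coassoc_first', ← mul_assoc, ← map_mul, leftLeg_tensorOne₂, ← map_mul,
      ← hQ.coassoc_mul, map_mul, map_mul, tensorOne₃_rightLeg, leftLeg_rightLeg, mul_assoc,
      ← leftLeg_tensorOne₂]
  have key : ∀ f : H ⊗[k] (H ⊗[k] (H ⊗[k] H)) →ₐ[k] H ⊗[k] (H ⊗[k] (H ⊗[k] (H ⊗[k] H))),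
      f (rightLeg (rightLeg Q.comul) Q.P) * f (leftLeg (H ⊗[k] H) Q.comul Q.P) =
      f (oneTensor (H ⊗[k] (H ⊗[k] H)) Q.P) *
        (f (rightLeg (leftLeg H Q.comul) Q.P) * f (tensorOne₃ Q.P)) := fun f => by
    rw [← map_mul, ← map_mul, ← map_mul, ← hQ.pentagon, mul_assoc]
  have a₅ := key (rightLeg (leftLeg (H ⊗[k] H) Q.comul))
  have a₆ := key (rightLeg (rightLeg (leftLeg H Q.comul)))
  have a₇ : rightLeg (rightLeg (leftLeg H Q.comul)) (oneTensor (k := k) (H := H) (H ⊗[k] (H ⊗[k] H)) Q.P) =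
      oneTensor (H ⊗[k] (H ⊗[k] (H ⊗[k] H))) (rightLeg (leftLeg H Q.comul) Q.P) :=
    rightLeg_oneTensor _ _
  rw [a₇] at a₆
  have a₈ : leftLeg (H ⊗[k] H) Q.comul (Q.P * tensorOne₂ (Q.comul w)) =
      leftLeg (H ⊗[k] H) Q.comul Q.P * leftLeg (H ⊗[k] H) Q.comul (tensorOne₂ (Q.comul w)) :=
    map_mul _ _ _
  have a₉ : ∀ x y z : H ⊗[k] (H ⊗[k] (H ⊗[k] H)), rightLeg (rightLeg (leftLeg H Q.comul))
      (x * (y * z)) = rightLeg (rightLeg (leftLeg H Q.comul)) x *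
        (rightLeg (rightLeg (leftLeg H Q.comul)) y * rightLeg (rightLeg (leftLeg H Q.comul)) z) :=
    fun x y z => by rw [map_mul, map_mul]
  have a₀ : ∀ x y : H ⊗[k] (H ⊗[k] (H ⊗[k] H)), rightLeg (leftLeg (H ⊗[k] H) Q.comul) (x * y) =
      rightLeg (leftLeg (H ⊗[k] H) Q.comul) x * rightLeg (leftLeg (H ⊗[k] H) Q.comul) y :=
    fun x y => map_mul _ _ _
  rw [a₈, a₉, a₀]
  exact mul_eq_of_exchange a₁ a₂ a₃ a₄ a₅ a₆

/-- Moving g to the right turns each σ' that it meets into σ, and on reaching α' it is absorbed into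
α. -/
theorem iotaAt_mul_right {B : Type*} [Ring B] [Algebra k B] {v : H →ₐ[k] B}
    {σ σ' : H →ₗ[k] B} {α α' g : B} (h : g * α' = α)
    (h' : ∀ u, σ u * g = g * σ' u) (b : B) :
    Q.iotaAt v σ' α' (b * g) = Q.iotaAt v σ α b := by
  refine LinearMap.ext fun u => ?_
  rw [iotaAt_apply, iotaAt_apply]
  have e : Q.adjAt v σ' (b * g) u = Q.adjAt v σ b u * g := by
    rw [adjAt_apply, adjAt_apply]
    refine induction₂ (Q.comul u) (fun x y => by simp [mul_assoc, h']) fun x y hx hy => ?_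
    simp only [map_add, add_mul, hx, hy]
  rw [e]
  have h'' : ∀ (u : H) (c : B), g * (σ' u * c) = σ u * (g * c) := fun u c => by
    rw [← mul_assoc, ← h', mul_assoc]
  refine induction₃ Q.P (fun x y z => ?_) fun x y hx hy => ?_
  · simp [conj₃_tmul, mul_assoc, h'', ← h]
  · simp only [conj₃_apply] at hx hy ⊢
    simp only [map_add, hx, hy]

end QuasiBialgebraData

namespace QuasiHopfData

variable {Q : QuasiHopfData k H}

/-- For c = δ most reassociators cancel, by quasi-coassociativity and the axiom for β, and the
remaining Φ enters only through X¹ β S(X²) α X³ = 1. What is left is x¹ ⊗ x² β S(x³), the shape that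
`conj₃_circ_beta` inverts. -/
theorem IsQuasiHopf.coactInner_delta (hQ : Q.IsQuasiHopf) :
    Q.coactInner Q.delta Q.P = Q.circ inr (Q.vS inr) inl.toLinearMap (inr Q.beta) := by
  have hq := hQ.isQuasiBialgebra
  have h₁ : ∀ (s₁ s₂ s₃ : H) (t : H ⊗[k] (H ⊗[k] H)) (T : H ⊗[k] (H ⊗[k] (H ⊗[k] H))),
      Q.coactMap (Q.deltaMap T)
        (leftLeg (H ⊗[k] H) Q.comul (s₁ ⊗ₜ (s₂ ⊗ₜ s₃)) * tensorOne₃ t) =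
      Q.deltaMap (leftLeg (H ⊗[k] H) Q.comul (tensorOne₂ (Q.comul s₁) * t) * T) *
        inl (Q.S s₂ * Q.alpha * s₃) := by
    intro s₁ s₂ s₃ t T
    rw [leftLeg_tmul]
    refine induction₃ t (fun t₁ t₂ t₃ => ?_) fun x y hx hy => ?_
    · refine induction₂ (Q.comul s₁) (fun x y => ?_) fun x y hx hy => ?_
      · simp only [TensorProduct.assoc_tmul, tensorOne₃_tmul, tensorOne₂_tmul,
          Algebra.TensorProduct.tmul_mul_tmul, coactMap_tmul, leftLeg_tmul, one_mul, mul_one]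
        refine induction₂ (Q.comul (x * t₁)) (fun z w => ?_) fun x y hx hy => ?_
        · refine induction₄ T (fun a b c d => ?_) fun x y hx hy => ?_
          · simp [deltaMap_tmul, S_mul, mul_assoc]
          · simp only [map_add, add_mul, mul_add, hx, hy]
        · simp only [TensorProduct.add_tmul, map_add, add_mul, hx, hy]
      · simp only [TensorProduct.add_tmul, map_add, add_mul, hx, hy]
    · simp only [map_add, add_mul, mul_add, hx, hy]
  have h₂ : ∀ s₁ : H, leftLeg (H ⊗[k] H) Q.comul (tensorOne₂ (Q.comul s₁) * Q.P') *
      (leftLeg (H ⊗[k] H) Q.comul Q.P * tensorOne₃ Q.P') =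
      tensorOne₃ Q.P' * rightLeg (leftLeg H Q.comul) (tensorOne₂ (Q.comul s₁)) := by
    intro s₁
    rw [map_mul, mul_assoc, Q.map_P'_mul_assoc, leftLeg_tensorOne₂, ← map_mul, hq.coassoc_mul',
      map_mul, tensorOne₃_rightLeg]
  have h₃ : ∀ s : H ⊗[k] (H ⊗[k] H),
      Q.coactMap Q.delta (leftLeg (H ⊗[k] H) Q.comul s * tensorOne₃ Q.P') =
      (inl.toLinearMap ⋆ (mulAt inr.toLinearMap (inr Q.beta) ⋆ Q.vS inr)) Q.P' *
        QuasiBialgebraData.conj₃ inl (Q.vS inl) (inl Q.alpha) s (inl Q.beta) := by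
    intro s
    refine induction₃ s (fun s₁ s₂ s₃ => ?_) fun x y hx hy => ?_
    · have e : Q.delta = Q.deltaMap (leftLeg (H ⊗[k] H) Q.comul Q.P * tensorOne₃ Q.P') := rfl
      rw [e, h₁, h₂, hQ.deltaMap_congr, ← tensorOne₃_rightLeg, hq.rightLeg_unitCounit_comul,
        ← map_mul]
      refine induction₃ Q.P' (fun a b c => ?_) fun x y hx hy => ?_
      · simp [Algebra.TensorProduct.one_def, deltaMap_tmul, S_one,
          QuasiBialgebraData.conj₃_tmul, mul_assoc]
      · simp only [map_add, add_mul, hx, hy]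
    · simp only [QuasiBialgebraData.conj₃_apply] at hx hy ⊢
      simp only [map_add, add_mul, mul_add, hx, hy]
  rw [hQ.coactInner_eq, h₃ Q.P, hQ.conj₃_beta, mul_one]
  rfl

/-- `s ↦ Δ(s₁) N (1 ⊗ S(s₂) α s₃)`, where `N` is the inner part of the coaction. -/
def coactSum (Q : QuasiHopfData k H) (c : H ⊗[k] H) : H ⊗[k] (H ⊗[k] H) →ₗ[k] H ⊗[k] H :=
  mulAt Q.comul.toLinearMap (Q.coactInner c Q.P) ⋆
    (mulAt (Q.vS inr) (inr Q.alpha) ⋆ inr.toLinearMap)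

theorem IsQuasiHopf.coactSum_delta (hQ : Q.IsQuasiHopf) : Q.coactSum Q.delta Q.P = 1 := by
  rw [coactSum, hQ.coactInner_delta, (hQ.isAntipodal inr).conj₃_circ_beta hQ.isQuasiBialgebra
    (hQ.conj₃_beta inr) (v' := Q.comul)]
  · simp [Algebra.TensorProduct.one_def]
  · intro u w
    rw [inl_starMul_inr]
    simp

/-- Both sides are values of one functional on the fivefold tensor power. `fiveLeg` equates its
arguments up to a Δ in legs 3 and 4, which the inner α of γ absorbs. -/
theorem IsQuasiHopf.coactSum_eq (hQ : Q.IsQuasiHopf) (c : H ⊗[k] H) (w : H) :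
    Q.coactSum c (Q.P * tensorOne₂ (Q.comul w)) =
      (Q.iotaAt Q.comul Q.SS Q.gamma c ⋆ LinearMap.id) (Q.P * tensorOne₂ (Q.comul w)) := by
  have hq := hQ.isQuasiBialgebra
  have h₁ : ∀ (r s : H ⊗[k] (H ⊗[k] H)) (t : H ⊗[k] (H ⊗[k] (H ⊗[k] H))),
      ((QuasiBialgebraData.conj₃ Q.comul Q.SS (Q.gammaMap t) r ∘ₗ Q.adjAt Q.comul Q.SS c) ⋆
        LinearMap.id) s =
      (mulAt Q.comul.toLinearMap c ⋆ Q.gammaMap)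
        (oneTensor (H ⊗[k] (H ⊗[k] (H ⊗[k] H))) t *
          (rightLeg (leftLeg (H ⊗[k] H) Q.comul) (rightLeg (rightLeg Q.comul) r) *
          rightLeg (leftLeg (H ⊗[k] H) Q.comul) (leftLeg (H ⊗[k] H) Q.comul s))) := by
    intro r s t
    have e : ∀ (d f : H ⊗[k] H), Q.gammaMap (t * TensorProduct.assoc k H H (H ⊗[k] H) (d ⊗ₜ f)) =
        Q.flipS d * Q.gammaMap t * f := by
      intro d f
      refine induction₂ d (fun x y => ?_) fun x y hx hy => ?_
      · refine induction₂ f (fun z w => ?_) fun x y hx hy => ?_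
        · refine induction₄ t (fun t₁ t₂ t₃ t₄ => ?_) fun x y hx hy => ?_
          · simp [gammaMap_tmul, flipS_tmul, S_mul, mul_assoc]
          · simp only [map_add, mul_add, add_mul, hx, hy]
        · simp only [map_add, mul_add, TensorProduct.tmul_add, hx, hy]
      · simp only [map_add, mul_add, add_mul, TensorProduct.add_tmul, hx, hy]
    refine induction₂ s (fun s₁ s₂ => ?_) fun x y hx hy => ?_
    · rw [starMul_tmul, LinearMap.comp_apply, QuasiBialgebraData.adjAt_apply, leftLeg_tmul]
      refine induction₃ r (fun r₁ r₂ r₃ => ?_) fun x y hx hy => ?_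
      · refine induction₂ (Q.comul s₁) (fun x y => ?_) fun x y hx hy => ?_
        · simp only [rightLeg_tmul, leftLeg_tmul, TensorProduct.assoc_tmul, oneTensor_apply,
            Algebra.TensorProduct.tmul_mul_tmul, ← assoc_mul, starMul_tmul, e, one_mul]
          simp [QuasiBialgebraData.conj₃_tmul, flipS_mul, mul_assoc]
        · simp only [TensorProduct.add_tmul, map_add, mul_add, add_mul, hx, hy]
      · simp only [QuasiBialgebraData.conj₃_apply] at hx hy ⊢
        simp only [map_add, mul_add, add_mul, hx, hy]
    · simp only [map_add, mul_add, hx, hy]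
  have h₂ : ∀ (s : H ⊗[k] (H ⊗[k] H)) (y : H ⊗[k] (H ⊗[k] (H ⊗[k] H))),
      (mulAt Q.comul.toLinearMap (Q.coactMap c y) ⋆
        (mulAt (Q.vS inr) (inr Q.alpha) ⋆ inr.toLinearMap)) s =
      (mulAt Q.comul.toLinearMap c ⋆ Q.gammaMap)
        (rightLeg (rightLeg ((oneTensor (H ⊗[k] H)).comp (oneTensor H))) s *
          rightLeg tensorOne₃ y) := by
    intro s y
    refine induction₃ s (fun s₁ s₂ s₃ => ?_) fun x y hx hy => ?_
    · refine induction₄ y (fun a b c d => ?_) fun x y hx hy => ?_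
      · simp [coactMap_tmul, gammaMap_tmul, S_mul, mul_assoc]
      · simp only [map_add, mul_add, mulAt_add, add_starMul, LinearMap.add_apply, hx, hy]
    · simp only [map_add, add_mul, hx, hy]
  have h₃ : rightLeg (rightLeg (leftLeg H (Q.unitCounit (H ⊗[k] H))))
      (rightLeg (rightLeg Q.comul) Q.P *
        leftLeg (H ⊗[k] H) Q.comul (Q.P * tensorOne₂ (Q.comul w))) =
      rightLeg (rightLeg ((oneTensor (H ⊗[k] H)).comp (oneTensor H)))
        (Q.P * tensorOne₂ (Q.comul w)) := by
    have e₁ : (leftLeg H (Q.unitCounit (H ⊗[k] H))).comp Q.comul =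
        (oneTensor (H ⊗[k] H)).comp (oneTensor H) :=
      AlgHom.ext fun x => hq.leftLeg_unitCounit_comul x
    have e₂ : rightLeg (rightLeg (leftLeg H (Q.unitCounit (H ⊗[k] H))))
        (rightLeg (rightLeg Q.comul) Q.P) =
        rightLeg (rightLeg ((oneTensor (H ⊗[k] H)).comp (oneTensor H))) Q.P := by
      rw [← e₁, rightLeg_comp]
      refine induction₃ Q.P (fun x y z => rfl) fun x y hx hy => ?_
      simp only [map_add, hx, hy]
    have e₃ : leftLeg (H ⊗[k] (H ⊗[k] H)) Q.comul (w ⊗ₜ 1) =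
        rightLeg (rightLeg ((oneTensor (H ⊗[k] H)).comp (oneTensor H)))
          (tensorOne₂ (Q.comul w)) := by
      rw [leftLeg_tmul]
      refine induction₂ (Q.comul w) (fun x y => ?_) fun x y hx hy => ?_
      · rw [tensorOne₂_tmul, rightLeg_tmul, rightLeg_tmul, map_one]; rfl
      · simp only [TensorProduct.add_tmul, map_add, hx, hy]
    rw [map_mul, e₂, ← leftLeg_rightLeg, map_mul, hq.rightLeg_leftLeg_unitCounit_P, one_mul,
      ← tensorOne₃_rightLeg, hq.rightLeg_unitCounit_comul, map_mul, ← e₃]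
    rfl
  rw [coactSum, hQ.coactInner_eq, h₂, QuasiBialgebraData.iotaAt, gamma, h₁, mulElt, hq.fiveLeg,
    gammaMap, starMul_rightLeg_congr (starMul_rightLeg_congr
      (starMul_leftLeg_congr (hQ.isAntipodal inl).left_mul inr.toLinearMap) _), h₃]

/-- The normalization of γ against δ is read off from `coactSum_eq` with c = δ and w = 1. The left
side there is 1; since the adjoint action multiplies δ by ε, the right side is the constant sought
times the trivial (ε ⊗ id ⊗ id)(Φ). -/
theorem IsQuasiHopf.conj₃_comul_delta (hQ : Q.IsQuasiHopf) :
    QuasiBialgebraData.conj₃ Q.comul Q.SS Q.gamma Q.P Q.delta = 1 := by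
  have hq := hQ.isQuasiBialgebra
  have e := hQ.coactSum_eq Q.delta 1
  rw [map_one, map_one, mul_one, hQ.coactSum_delta] at e
  rw [e]
  have key : ∀ s : H ⊗[k] (H ⊗[k] H), (Q.iotaAt Q.comul Q.SS Q.gamma Q.delta ⋆ LinearMap.id) s =
      QuasiBialgebraData.conj₃ Q.comul Q.SS Q.gamma Q.P Q.delta *
      LinearMap.mul' k (H ⊗[k] H)
        (Algebra.TensorProduct.map (Q.unitCounit (H ⊗[k] H)) (AlgHom.id k (H ⊗[k] H)) s) := by
    intro s
    refine induction₂ s (fun x y => ?_) fun x y hx hy => ?_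
    · rw [starMul_tmul, QuasiBialgebraData.iotaAt_apply, hQ.isAntipodal_comul.adjAt_beta]
      simp [QuasiBialgebraData.unitCounit_apply, Algebra.algebraMap_eq_smul_one]
    · simp only [map_add, mul_add, hx, hy]
  rw [key, hq.map_unitCounit_P, Algebra.TensorProduct.one_def]
  simp

/-- Right multiplication by g trades the second antipode for the first, which is the role of g in
the coaction. -/
theorem IsQuasiHopf.iotaAt_comul (hQ : Q.IsQuasiHopf) (c : H ⊗[k] H) :
    Q.iotaAt Q.comul Q.SS Q.gamma (c * Q.g) = Q.iotaMap Q.comul c := by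
  refine QuasiBialgebraData.iotaAt_mul_right ?_ (fun u => ?_) c
  · rw [g_eq]
    exact (hQ.isAntipodal Q.comul).circ_mul hQ.isAntipodal_comul hQ.isQuasiBialgebra
      hQ.conj₃_comul_delta
  · rw [g_eq]
    exact (hQ.isAntipodal Q.comul).mul_circ hQ.isAntipodal_comul hQ.isQuasiBialgebra u

/-- `y ↦ (y₁ ⊗ y₂) z (1 ⊗ S(y₃) α y₄)`. -/
def innerSum (Q : QuasiHopfData k H) (z : H ⊗[k] H) :
    H ⊗[k] (H ⊗[k] (H ⊗[k] H)) →ₗ[k] H ⊗[k] H :=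
  inl.toLinearMap ⋆ (mulAt inr.toLinearMap z ⋆
    (mulAt (Q.vS inr) (inr Q.alpha) ⋆ inr.toLinearMap))

theorem innerSum_tmul (z : H ⊗[k] H) (a b c d : H) :
    Q.innerSum z (a ⊗ₜ (b ⊗ₜ (c ⊗ₜ d))) = (a ⊗ₜ b) * (z * (1 ⊗ₜ (Q.S c * Q.alpha * d))) := by
  simp [innerSum, ← mul_assoc]

theorem innerSum_add (z z' : H ⊗[k] H) : Q.innerSum (z + z') = Q.innerSum z + Q.innerSum z' := by
  simp only [innerSum, mulAt_add, add_starMul, starMul_add]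

/-- The outer Φ of the coaction supplies the factor Φ ⊗ 1 that completes `pentagon_comul`. Then α
absorbs (id ⊗ id ⊗ Δ)(Φ), and the inner part is handled by `coactSum_eq` with c = Δ(h) g. -/
theorem IsQuasiHopf.iotaMap_comul_starMul (hQ : Q.IsQuasiHopf) (h w : H) :
    (Q.iotaMap Q.comul (Q.comul h) ⋆ LinearMap.id) (Q.P * tensorOne₂ (Q.comul w)) =
      Q.innerSum (Q.coact₀ h) (oneTensor (H ⊗[k] (H ⊗[k] H)) Q.P *
        rightLeg (leftLeg H Q.comul) (Q.P * tensorOne₂ (Q.comul w))) := by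
  have h₁ : ∀ (N : H ⊗[k] H) (t : H ⊗[k] (H ⊗[k] H)) (y : H ⊗[k] (H ⊗[k] (H ⊗[k] H))),
      Q.innerSum (Q.coactOuter N ((TensorProduct.assoc k H H H).symm t)) y =
        Q.innerSum N (y * tensorOne₃ t) := by
    intro N t y
    refine induction₃ t (fun t₁ t₂ t₃ => ?_) fun x y hx hy => ?_
    · refine induction₄ y (fun a b c d => ?_) fun x y hx hy => ?_
      · rw [tensorOne₃_tmul, TensorProduct.assoc_symm_tmul, coactOuter_tmul]
        simp only [Algebra.TensorProduct.tmul_mul_tmul, innerSum_tmul, S_mul, mul_one, mul_assoc]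
        rw [← mul_assoc (a ⊗ₜ b), Algebra.TensorProduct.tmul_mul_tmul]
      · simp only [map_add, add_mul, hx, hy]
    · simp only [map_add, mul_add, innerSum_add, LinearMap.add_apply, hx, hy]
  have h₂ : ∀ (N : H ⊗[k] H) (s : H ⊗[k] (H ⊗[k] H)),
      Q.innerSum N (leftLeg (H ⊗[k] H) Q.comul s) = (mulAt Q.comul.toLinearMap N ⋆
        (mulAt (Q.vS inr) (inr Q.alpha) ⋆ inr.toLinearMap)) s := by
    intro N s
    refine induction₃ s (fun s₁ s₂ s₃ => ?_) fun x y hx hy => ?_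
    · rw [leftLeg_tmul, starMul_tmul, mulAt_apply, AlgHom.toLinearMap_apply]
      refine induction₂ (Q.comul s₁) (fun x y => ?_) fun x y hx hy => ?_
      · simp [innerSum_tmul, mul_assoc]
      · simp only [TensorProduct.add_tmul, map_add, add_mul, hx, hy]
    · simp only [map_add, hx, hy]
  rw [← hQ.iotaAt_comul, ← hQ.coactSum_eq]
  refine Eq.trans ?_ (h₁ _ Q.P _).symm
  rw [hQ.isQuasiBialgebra.pentagon_comul, innerSum, starMul_rightLeg_congr
    (starMul_rightLeg_congr (hQ.isAntipodal inr).left_mul _),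
    hQ.isQuasiBialgebra.rightLeg_rightLeg_unitCounit_P, one_mul, ← innerSum, h₂]
  rfl

variable {B : Type*} [Ring B] [Algebra k B]

/-- Naturality of ι. Applied to the identity of H it shows that ι(v(h)) lies in the image of v. -/
theorem map_iotaMap {C : Type*} [Ring C] [Algebra k C] (v : H →ₐ[k] B) (f : B →ₐ[k] C) (b : B)
    (u : H) : f (Q.iotaMap v b u) = Q.iotaMap (f.comp v) (f b) u := by
  have e : ∀ d, f ((mulAt v.toLinearMap b ⋆ Q.vS v) d) =
      (mulAt (f.comp v).toLinearMap (f b) ⋆ Q.vS (f.comp v)) d := by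
    intro d
    refine induction₂ d (fun x y => by simp) fun x y hx hy => ?_
    simp only [map_add, hx, hy]
  rw [iotaMap, iotaMap, QuasiBialgebraData.iotaAt_apply, QuasiBialgebraData.iotaAt_apply,
    QuasiBialgebraData.adjAt_apply, QuasiBialgebraData.adjAt_apply, ← e]
  refine induction₃ Q.P (fun x y z => ?_) fun x y hx hy => ?_
  · simp [QuasiBialgebraData.conj₃_tmul]
  · simp only [QuasiBialgebraData.conj₃_apply] at hx hy ⊢
    simp only [map_add, hx, hy]

theorem IsQuasiHopf.mul_iotaMap_starMul (hQ : Q.IsQuasiHopf) (v : H →ₐ[k] B) (b : B) (u : H)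
    (d : H ⊗[k] H) : v u * (Q.iotaMap v b ⋆ v.toLinearMap) d =
      (Q.iotaMap v b ⋆ v.toLinearMap) (Q.comul u * d) := by
  refine induction₂ d (fun x y => ?_) fun x y hx hy => ?_
  · have e : Q.comul u * (x ⊗ₜ y) = Q.comul u * (x ⊗ₜ 1) * (1 ⊗ₜ y) := by
      rw [mul_assoc, Algebra.TensorProduct.tmul_mul_tmul, mul_one, one_mul]
    rw [starMul_tmul, ← mul_assoc,
      (hQ.isAntipodal v).intertwines_iotaAt hQ.isQuasiBialgebra b u x, e]
    refine induction₂ (Q.comul u * (x ⊗ₜ 1)) (fun x y => by simp [mul_assoc]) fun x y hx hy => ?_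
    simp only [map_add, add_mul, hx, hy]
  · simp only [map_add, mul_add, hx, hy]

/-- `v(h) * b = (h₍₋₁₎ · b) * v(h₍₀₎)` -/
theorem IsQuasiHopf.adjointAlgebra_mul_comm (hQ : Q.IsQuasiHopf) (v : H →ₐ[k] B) (h : H) (b : B) :
    (Q.adjointAlgebra v).mul (v h ⊗ₜ b) =
      (Q.adjointAlgebra v).mulMap ((Q.adjointAlgebra v).act.toLinearMap.flip b) v.toLinearMap
        (Q.coact₀ h) := by
  refine hQ.iota_ext v fun w => ?_
  -- ι(v(h)) is v of an element of H, so it passes through ι(b) by comultiplication. All dependence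
  -- on h is now in H ⊗ H.
  have h₁ : ∀ s : H ⊗[k] (H ⊗[k] H), (Q.iotaMap v (v h) ⋆ (Q.iotaMap v b ⋆ v.toLinearMap)) s =
      (Q.iotaMap v b ⋆ v.toLinearMap)
        ((Q.iotaMap Q.comul (Q.comul h) ⋆ LinearMap.id) s) := by
    intro s
    refine induction₂ s (fun x y => ?_) fun x y hx hy => ?_
    · have e := map_iotaMap (Q := Q) (AlgHom.id k H) v h x
      have e' := map_iotaMap (Q := Q) (AlgHom.id k H) Q.comul h x
      rw [AlgHom.comp_id] at e e'
      rw [starMul_tmul, starMul_tmul, ← e, ← e', hQ.mul_iotaMap_starMul]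
      rfl
    · simp only [map_add, hx, hy]
  -- The other side takes the same shape, with an arbitrary `z` in place of the coaction, so the
  -- claim reduces to `iotaMap_comul_starMul`.
  have h₂ : ∀ (z : H ⊗[k] H), Q.iotaMap v ((Q.adjointAlgebra v).mulMap
      ((Q.adjointAlgebra v).act.toLinearMap.flip b) v.toLinearMap z) w =
      (Q.iotaMap v b ⋆ v.toLinearMap) (Q.innerSum z (oneTensor (H ⊗[k] (H ⊗[k] H)) Q.P *
        rightLeg (leftLeg H Q.comul) (Q.P * tensorOne₂ (Q.comul w)))) := by
    intro z
    refine induction₂ z (fun x y => ?_) fun x y hx hy => ?_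
    · rw [ModuleAlgebraData.mulMap_tmul, hQ.iotaMap_mul]
      generalize Q.P * tensorOne₂ (Q.comul w) = s
      refine induction₃ s (fun s₁ s₂ s₃ => ?_) fun x y hx hy => ?_
      · have e := map_iotaMap (Q := Q) (AlgHom.id k H) v y s₂
        rw [AlgHom.comp_id] at e
        have e' : Q.iotaMap v ((Q.adjointAlgebra v).act.toLinearMap.flip b x) s₁ =
            Q.iotaMap v b (s₁ * x) := ((hQ.isAntipodal v).iotaAt_mul b s₁ x).symm
        rw [starMul_tmul, starMul_tmul, e', AlgHom.toLinearMap_apply, ← e, rightLeg_tmul,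
          leftLeg_tmul]
        generalize Q.iotaMap v b = f
        rw [QuasiBialgebraData.iotaAt_apply, QuasiBialgebraData.adjAt_apply]
        refine induction₃ Q.P (fun p q r => ?_) fun x y hx hy => ?_
        · rw [oneTensor_apply, Algebra.TensorProduct.tmul_mul_tmul, tmul_mul_assoc]
          refine induction₂ (Q.comul s₂) (fun x y => ?_) fun x y hx hy => ?_
          · simp [innerSum_tmul, QuasiBialgebraData.conj₃_tmul, S_mul, mul_assoc]
          · simp only [map_add, mul_add, add_mul, TensorProduct.tmul_add, TensorProduct.add_tmul,
              hx, hy]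
        · simp only [QuasiBialgebraData.conj₃_apply] at hx hy ⊢
          simp only [map_add, mul_add, add_mul, hx, hy]
      · simp only [map_add, mul_add, hx, hy]
    · have e : ∀ b b' : B, Q.iotaMap v (b + b') w = Q.iotaMap v b w + Q.iotaMap v b' w := by
        intro b b'
        simp only [iotaMap_apply, map_add]
      rw [map_add, e, hx, hy, innerSum_add, LinearMap.add_apply, map_add]
  rw [hQ.iotaMap_mul, h₁, hQ.iotaMap_comul_starMul, h₂]

theorem IsQuasiHopf.mulMap_diamondTwisting (hQ : Q.IsQuasiHopf) (v : H →ₐ[k] B) {A : Type*}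
    [AddCommGroup A] [Module k A] {M : ModuleAlgebraData k H A} {i : A →ₗ[k] B}
    (hi : ∀ h a, i (M.act h a) = (Q.adjointAlgebra v).act h (i a)) (z : H ⊗[k] A) :
    (Q.adjointAlgebra v).mulMap v.toLinearMap i z =
      (Q.adjointAlgebra v).mulMap i v.toLinearMap
        (ModuleAlgebraData.diamondTwisting Q M z) := by
  refine induction₂ z (fun h a => ?_) fun x y hx hy => ?_
  · rw [ModuleAlgebraData.mulMap_tmul, AlgHom.toLinearMap_apply, hQ.adjointAlgebra_mul_comm]
    simp only [ModuleAlgebraData.diamondTwisting, LinearMap.comp_apply, TensorProduct.map_tmul,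
      LinearMap.id_apply, LinearEquiv.coe_coe]
    refine induction₂ (Q.coact₀ h) (fun x y => ?_) fun x y hx hy => ?_
    · simp [hi]
    · simp only [TensorProduct.add_tmul, map_add, hx, hy]
  · simp only [map_add, hx, hy]

end QuasiHopfData

end

/-! ### The twist of a quasi-Hopf algebra. -/

section

variable {k H : Type*} [Field k] [Ring H] [Algebra k H]

section Monoid

variable {M : Type*} [Monoid M]

theorem inv_mul_cancel_of_eq_one {a b : M} (h : a * b = 1) (c : M) : a * (b * c) = c := by
  rw [← mul_assoc, h, one_mul]

/-- The monoid skeleton of `twist_pentagon`: subscripts name the legs that carry F or F⁻¹, `hp` is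
the pentagon of Φ, and `hx`, `hd` are quasi-coassociativity applied to F and F⁻¹. -/
theorem mul_eq_of_pentagon {F₁₂ G₁₂ F₂₃ G₂₃ F₃₄ G₃₄ a c c' d e e' f l l' m n n' p q x y z : M}
    (h₂₃ : G₂₃ * F₂₃ = 1) (h₃₄ : G₃₄ * F₃₄ = 1) (h₁₂ : G₁₂ * F₁₂ = 1)
    (hc : G₃₄ * F₁₂ = F₁₂ * G₃₄) (hl : l * l' = 1) (he : e * e' = 1) (hn : n * n' = 1)
    (hx : x * c = c' * x) (hd : d * z = z * m) (hp : x * (y * z) = p * q) :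
    F₃₄ * a * x * l * G₂₃ * (F₂₃ * (l' * c * y * d * e) * G₂₃) * (F₂₃ * e' * z * f * G₁₂) =
      F₃₄ * (a * c' * p * n * G₁₂) * G₃₄ * (F₁₂ * (F₃₄ * n' * q * m * f) * G₁₂) := by
  have hp' : ∀ w, x * (y * (z * w)) = p * (q * w) := fun w => by
    rw [← mul_assoc y, ← mul_assoc, hp, mul_assoc]
  simp only [mul_assoc]
  rw [inv_mul_cancel_of_eq_one h₂₃, inv_mul_cancel_of_eq_one hl, inv_mul_cancel_of_eq_one h₂₃,
    inv_mul_cancel_of_eq_one he, mul_mul_eq_of_mul_eq hx, mul_mul_eq_of_mul_eq hd, hp',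
    mul_mul_eq_of_mul_eq hc, inv_mul_cancel_of_eq_one h₁₂, inv_mul_cancel_of_eq_one h₃₄,
    inv_mul_cancel_of_eq_one hn]

end Monoid

section Legs

variable {B C : Type*} [Ring B] [Algebra k B] [Ring C] [Algebra k C]

theorem map_F_mul (F : (H ⊗[k] H)ˣ) (f : H ⊗[k] H →ₐ[k] B) : f ↑F * f ↑F⁻¹ = 1 := by
  rw [← map_mul, Units.mul_inv, map_one]

theorem map_F'_mul (F : (H ⊗[k] H)ˣ) (f : H ⊗[k] H →ₐ[k] B) : f ↑F⁻¹ * f ↑F = 1 := by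
  rw [← map_mul, Units.inv_mul, map_one]

theorem map_F'_eq_one {F : (H ⊗[k] H)ˣ} {f : H ⊗[k] H →ₐ[k] B} (h : f ↑F = 1) :
    f ↑F⁻¹ = 1 := by
  simpa [h] using map_F_mul F f

/-- `a ⊗ b ↦ a ⊗ b ⊗ 1`, with `1` in `B`. -/
def tensorOne (B : Type*) [Ring B] [Algebra k B] : H ⊗[k] H →ₐ[k] H ⊗[k] (H ⊗[k] B) :=
  (Algebra.TensorProduct.assoc k k k H H B).toAlgHom.comp Algebra.TensorProduct.includeLeft

theorem tensorOne_apply (d : H ⊗[k] H) :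
    tensorOne B d = TensorProduct.assoc k H H B (d ⊗ₜ 1) := rfl

theorem tensorOne_self (d : H ⊗[k] H) : tensorOne H d = tensorOne₂ d :=
  (tensorOne₂_eq_assoc d).symm

theorem rightLeg_rightLeg_tensorOne (f : B →ₐ[k] C) (d : H ⊗[k] H) :
    rightLeg (rightLeg f) (tensorOne B d) = tensorOne C d := by
  refine induction₂ d (fun x y => ?_) fun x y hx hy => ?_
  · simp [tensorOne_apply]
  · simp only [map_add, hx, hy]

theorem tensorOne₃_tensorOne₂ (d : H ⊗[k] H) :
    tensorOne₃ (tensorOne₂ d) = tensorOne (H ⊗[k] H) d := by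
  refine induction₂ d (fun x y => ?_) fun x y hx hy => ?_
  · simp [tensorOne_apply, Algebra.TensorProduct.one_def]
  · simp only [map_add, hx, hy]

theorem tensorOne_mul_oneTensor (d : H ⊗[k] H) (b : B) :
    tensorOne B d * oneTensor (H ⊗[k] B) (oneTensor B b) =
      oneTensor (H ⊗[k] B) (oneTensor B b) * tensorOne B d := by
  refine induction₂ d (fun x y => ?_) fun x y hx hy => ?_
  · simp [tensorOne_apply]
  · simp only [map_add, add_mul, mul_add, hx, hy]

theorem rightLeg_conj {D D' : B →ₐ[k] C} {a b : C} (h : ∀ x, D' x = a * D x * b) (t : H ⊗[k] B) :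
    rightLeg D' t = oneTensor C a * rightLeg D t * oneTensor C b := by
  refine induction₂ t (fun x y => by simp [h]) fun x y hx hy => ?_
  simp only [map_add, add_mul, mul_add, hx, hy]

end Legs

namespace QuasiBialgebraData

variable {Q : QuasiBialgebraData k H} {F : (H ⊗[k] H)ˣ} {B : Type*} [Ring B] [Algebra k B]

theorem rightLeg_twist (t : H ⊗[k] H) : rightLeg (Q.twist F).comul t =
    oneTensor (H ⊗[k] H) ↑F * rightLeg Q.comul t * oneTensor (H ⊗[k] H) ↑F⁻¹ :=
  rightLeg_conj (Q.twist_comul F) t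

theorem leftLeg_twist (t : H ⊗[k] B) : leftLeg B (Q.twist F).comul t =
    tensorOne B ↑F * leftLeg B Q.comul t * tensorOne B ↑F⁻¹ := by
  refine induction₂ t (fun x y => ?_) fun x y hx hy => ?_
  · rw [leftLeg_tmul, leftLeg_tmul, twist_comul, tensorOne_apply, tensorOne_apply, ← assoc_mul,
      ← assoc_mul, one_mul, mul_one]
  · simp only [map_add, add_mul, mul_add, hx, hy]

theorem twist_counit : (Q.twist F).counit = Q.counit := rfl

theorem twist_P : (Q.twist F).P = oneTensor (H ⊗[k] H) ↑F * rightLeg Q.comul ↑F * Q.P *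
    leftLeg H Q.comul ↑F⁻¹ * tensorOne₂ ↑F⁻¹ := rfl

theorem twist_P' : (Q.twist F).P' = tensorOne₂ ↑F * (leftLeg H Q.comul ↑F * (Q.P' *
    (rightLeg Q.comul ↑F⁻¹ * oneTensor (H ⊗[k] H) ↑F⁻¹))) := by
  have h : (Q.twist F).P * (tensorOne₂ ↑F * (leftLeg H Q.comul ↑F * (Q.P' *
    (rightLeg Q.comul ↑F⁻¹ * oneTensor (H ⊗[k] H) ↑F⁻¹)))) = 1 := by
    rw [twist_P]
    simp only [mul_assoc]
    rw [inv_mul_cancel_of_eq_one (map_F'_mul F _), inv_mul_cancel_of_eq_one (map_F'_mul F _),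
      inv_mul_cancel_of_eq_one (Units.mul_inv Q.Phi), inv_mul_cancel_of_eq_one (map_F_mul F _),
      map_F_mul]
  exact Units.inv_eq_of_mul_eq_one_right h

theorem twist_coassoc_mul (hQ : Q.IsQuasiBialgebra) (h : H) :
    rightLeg (Q.twist F).comul ((Q.twist F).comul h) * (Q.twist F).P =
      (Q.twist F).P * leftLeg H (Q.twist F).comul ((Q.twist F).comul h) := by
  rw [rightLeg_twist, leftLeg_twist, twist_P, twist_comul, tensorOne_self, tensorOne_self,
    map_mul, map_mul, map_mul, map_mul]
  simp only [mul_assoc]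
  rw [inv_mul_cancel_of_eq_one (map_F'_mul F _), inv_mul_cancel_of_eq_one (map_F'_mul F _),
    inv_mul_cancel_of_eq_one (map_F'_mul F _), inv_mul_cancel_of_eq_one (map_F'_mul F _),
    mul_mul_eq_of_mul_eq (hQ.coassoc_mul h)]

/-- The images of the reassociator of the twist in the fourfold tensor power. -/
theorem rightLeg_rightLeg_twist_P :
    rightLeg (rightLeg (Q.twist F).comul) (Q.twist F).P =
      oneTensor (H ⊗[k] (H ⊗[k] H)) (oneTensor (H ⊗[k] H) ↑F) *
        (oneTensor (H ⊗[k] (H ⊗[k] H)) (rightLeg Q.comul ↑F) *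
          rightLeg ((rightLeg Q.comul).comp Q.comul) ↑F * rightLeg (rightLeg Q.comul) Q.P *
          rightLeg (rightLeg Q.comul) (leftLeg H Q.comul ↑F⁻¹) *
          tensorOne (H ⊗[k] H) ↑F⁻¹) *
        oneTensor (H ⊗[k] (H ⊗[k] H)) (oneTensor (H ⊗[k] H) ↑F⁻¹) := by
  rw [rightLeg_conj (D := rightLeg Q.comul) (fun x => rightLeg_twist x), twist_P]
  simp only [map_mul]
  rw [rightLeg_oneTensor, rightLeg_comp, ← tensorOne_self, rightLeg_rightLeg_tensorOne]

theorem leftLeg_twist_P :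
    leftLeg (H ⊗[k] H) (Q.twist F).comul (Q.twist F).P =
      tensorOne (H ⊗[k] H) ↑F * (oneTensor (H ⊗[k] (H ⊗[k] H)) (oneTensor (H ⊗[k] H) ↑F) *
        rightLeg (rightLeg Q.comul) (leftLeg H Q.comul ↑F) * leftLeg (H ⊗[k] H) Q.comul Q.P *
        leftLeg (H ⊗[k] H) Q.comul (leftLeg H Q.comul ↑F⁻¹) *
        tensorOne₃ (leftLeg H Q.comul ↑F⁻¹)) * tensorOne (H ⊗[k] H) ↑F⁻¹ := by
  rw [leftLeg_twist, twist_P]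
  simp only [map_mul]
  rw [leftLeg_oneTensor, leftLeg_rightLeg, leftLeg_tensorOne₂]

theorem rightLeg_leftLeg_twist_P :
    rightLeg (leftLeg H (Q.twist F).comul) (Q.twist F).P =
      oneTensor (H ⊗[k] (H ⊗[k] H)) (tensorOne₂ ↑F) *
        (oneTensor (H ⊗[k] (H ⊗[k] H)) (leftLeg H Q.comul ↑F) *
          rightLeg ((leftLeg H Q.comul).comp Q.comul) ↑F * rightLeg (leftLeg H Q.comul) Q.P *
          rightLeg (leftLeg H Q.comul) (leftLeg H Q.comul ↑F⁻¹) *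
          tensorOne₃ (rightLeg Q.comul ↑F⁻¹)) *
        oneTensor (H ⊗[k] (H ⊗[k] H)) (tensorOne₂ ↑F⁻¹) := by
  have h : ∀ x : H ⊗[k] H, leftLeg H (Q.twist F).comul x =
      tensorOne₂ ↑F * leftLeg H Q.comul x * tensorOne₂ ↑F⁻¹ := fun x => by
    rw [leftLeg_twist, tensorOne_self, tensorOne_self]
  rw [rightLeg_conj h, twist_P]
  simp only [map_mul]
  rw [rightLeg_oneTensor, rightLeg_comp, ← tensorOne₃_rightLeg]

/-- With Δ_F written as a conjugate of Δ, inner copies of F and F⁻¹ cancel after commuting disjoint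
legs and using quasi-coassociativity; the pentagon of Φ remains between equal outer factors. -/
theorem twist_pentagon (hQ : Q.IsQuasiBialgebra) :
    oneTensor (H ⊗[k] (H ⊗[k] H)) (Q.twist F).P *
      rightLeg (leftLeg H (Q.twist F).comul) (Q.twist F).P * tensorOne₃ (Q.twist F).P =
    rightLeg (rightLeg (Q.twist F).comul) (Q.twist F).P *
      leftLeg (H ⊗[k] H) (Q.twist F).comul (Q.twist F).P := by
  have e₁ : oneTensor (k := k) (H := H) (H ⊗[k] (H ⊗[k] H)) (Q.twist F).P =
      oneTensor (H ⊗[k] (H ⊗[k] H)) (oneTensor (H ⊗[k] H) ↑F) *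
        oneTensor (H ⊗[k] (H ⊗[k] H)) (rightLeg Q.comul ↑F) *
        oneTensor (H ⊗[k] (H ⊗[k] H)) Q.P *
        oneTensor (H ⊗[k] (H ⊗[k] H)) (leftLeg H Q.comul ↑F⁻¹) *
        oneTensor (H ⊗[k] (H ⊗[k] H)) (tensorOne₂ ↑F⁻¹) := by
    rw [twist_P, map_mul, map_mul, map_mul, map_mul]
  have e₂ : tensorOne₃ (Q.twist F).P = oneTensor (H ⊗[k] (H ⊗[k] H)) (tensorOne₂ ↑F) *
      tensorOne₃ (rightLeg Q.comul ↑F) * tensorOne₃ Q.P *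
      tensorOne₃ (leftLeg H Q.comul ↑F⁻¹) * tensorOne (H ⊗[k] H) ↑F⁻¹ := by
    rw [twist_P, map_mul, map_mul, map_mul, map_mul, tensorOne₃_tensorOne₂]
    rfl
  rw [rightLeg_rightLeg_twist_P, leftLeg_twist_P, rightLeg_leftLeg_twist_P, e₁, e₂]
  refine mul_eq_of_pentagon ?_ ?_ ?_ ?_ ?_ ?_ ?_ ?_ ?_ ?_
  · exact map_F'_mul F ((oneTensor (H ⊗[k] (H ⊗[k] H))).comp tensorOne₂)
  · exact map_F'_mul F ((oneTensor (H ⊗[k] (H ⊗[k] H))).comp (oneTensor (H ⊗[k] H)))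
  · exact map_F'_mul F _
  · exact (tensorOne_mul_oneTensor _ _).symm
  · exact map_F'_mul F ((oneTensor (H ⊗[k] (H ⊗[k] H))).comp (leftLeg H Q.comul))
  · exact map_F'_mul F (tensorOne₃.comp (rightLeg Q.comul))
  · exact map_F'_mul F ((rightLeg (rightLeg Q.comul)).comp (leftLeg H Q.comul))
  · exact (rightLeg_mul_oneTensor (fun x => hQ.coassoc_mul x) _).symm
  · exact hQ.coassoc_first _
  · rw [← mul_assoc, hQ.pentagon]

section Counit

/-- Of the five factors of Φ_F, ε on the first leg leaves only 1 ⊗ F and 1 ⊗ F⁻¹, which cancel. -/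
theorem map_counit_id_twist_P (hQ : Q.IsQuasiBialgebra) (hF : Q.IsGaugeTransformation F) :
    Algebra.TensorProduct.map Q.counit (AlgHom.id k (H ⊗[k] H)) (Q.twist F).P = 1 := by
  have e₁ : ∀ t, Algebra.TensorProduct.map Q.counit (AlgHom.id k (H ⊗[k] H))
      (rightLeg Q.comul t) = Algebra.TensorProduct.map (AlgHom.id k k) Q.comul
        (Algebra.TensorProduct.map Q.counit (AlgHom.id k H) t) := by
    intro t
    refine induction₂ t (fun x y => rfl) fun x y hx hy => ?_
    simp only [map_add, hx, hy]
  have e₂ : ∀ t, Algebra.TensorProduct.map Q.counit (AlgHom.id k (H ⊗[k] H))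
      (tensorOne₂ t) = Algebra.TensorProduct.map (AlgHom.id k k)
        (Algebra.TensorProduct.includeLeft : H →ₐ[k] H ⊗[k] H)
        (Algebra.TensorProduct.map Q.counit (AlgHom.id k H) t) := by
    intro t
    refine induction₂ t (fun x y => rfl) fun x y hx hy => ?_
    simp only [map_add, hx, hy]
  have e₃ : ∀ t, Algebra.TensorProduct.map Q.counit (AlgHom.id k (H ⊗[k] H))
      (leftLeg H Q.comul t) = 1 ⊗ₜ t := by
    have key : ∀ (d : H ⊗[k] H) (y : H), Algebra.TensorProduct.map Q.counit
        (AlgHom.id k (H ⊗[k] H)) (TensorProduct.assoc k H H H (d ⊗ₜ y)) =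
        TensorProduct.assoc k k H H
          (Algebra.TensorProduct.map Q.counit (AlgHom.id k H) d ⊗ₜ y) := by
      intro d y
      refine induction₂ d (fun x y => rfl) fun x y hx hy => ?_
      simp only [map_add, TensorProduct.add_tmul, hx, hy]
    intro t
    refine induction₂ t (fun x y => ?_) fun x y hx hy => ?_
    · rw [leftLeg_tmul, key, hQ.counit_id]; rfl
    · simp only [map_add, TensorProduct.tmul_add, hx, hy]
  rw [twist_P]
  simp only [map_mul]
  rw [e₁, e₂, e₃, hF.counit_id, hQ.counit_Phi₁, map_F'_eq_one hF.counit_id, map_one, map_one,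
    oneTensor_apply, Algebra.TensorProduct.map_tmul, map_one, AlgHom.id_apply, mul_one, mul_one,
    mul_one, Algebra.TensorProduct.tmul_mul_tmul, Units.mul_inv, one_mul]
  rfl

theorem map_id_counit_id_twist_P (hQ : Q.IsQuasiBialgebra) (hF : Q.IsGaugeTransformation F) :
    Algebra.TensorProduct.map (AlgHom.id k H)
      (Algebra.TensorProduct.map Q.counit (AlgHom.id k H)) (Q.twist F).P = 1 := by
  have e₁ : ∀ t, Algebra.TensorProduct.map (AlgHom.id k H)
      (Algebra.TensorProduct.map Q.counit (AlgHom.id k H)) (rightLeg Q.comul t) =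
      Algebra.TensorProduct.map (AlgHom.id k H)
        (Algebra.TensorProduct.includeRight : H →ₐ[k] k ⊗[k] H) t := by
    intro t
    refine induction₂ t (fun x y => ?_) fun x y hx hy => ?_
    · rw [rightLeg_tmul, Algebra.TensorProduct.map_tmul, hQ.counit_id]; rfl
    · simp only [map_add, hx, hy]
  have e₂ : ∀ t, Algebra.TensorProduct.map (AlgHom.id k H)
      (Algebra.TensorProduct.map Q.counit (AlgHom.id k H)) (tensorOne₂ t) =
      Algebra.TensorProduct.map (AlgHom.id k H)
        (Algebra.TensorProduct.includeLeft : k →ₐ[k] k ⊗[k] H)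
        (Algebra.TensorProduct.map (AlgHom.id k H) Q.counit t) := by
    intro t
    refine induction₂ t (fun x y => ?_) fun x y hx hy => ?_
    · simp
    · simp only [map_add, hx, hy]
  have e₃ : ∀ t, Algebra.TensorProduct.map (AlgHom.id k H)
      (Algebra.TensorProduct.map Q.counit (AlgHom.id k H)) (leftLeg H Q.comul t) =
      Algebra.TensorProduct.map (AlgHom.id k H)
        (Algebra.TensorProduct.includeRight : H →ₐ[k] k ⊗[k] H) t := by
    have key : ∀ (d : H ⊗[k] H) (y : H), Algebra.TensorProduct.map (AlgHom.id k H)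
        (Algebra.TensorProduct.map Q.counit (AlgHom.id k H))
        (TensorProduct.assoc k H H H (d ⊗ₜ y)) = TensorProduct.assoc k H k H
          (Algebra.TensorProduct.map (AlgHom.id k H) Q.counit d ⊗ₜ y) := by
      intro d y
      refine induction₂ d (fun x y => rfl) fun x y hx hy => ?_
      simp only [map_add, TensorProduct.add_tmul, hx, hy]
    intro t
    refine induction₂ t (fun x y => ?_) fun x y hx hy => ?_
    · rw [leftLeg_tmul, key, hQ.id_counit]; rfl
    · simp only [map_add, hx, hy]
  rw [twist_P]
  simp only [map_mul]
  rw [e₁, e₂, e₃, hQ.counit_Phi₂, map_F'_eq_one hF.id_counit, map_one, mul_one, mul_one,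
    oneTensor_apply, Algebra.TensorProduct.map_tmul, hF.counit_id, mul_assoc, map_F_mul, mul_one]
  rfl

theorem map_id_id_counit_twist_P (hQ : Q.IsQuasiBialgebra) (hF : Q.IsGaugeTransformation F) :
    Algebra.TensorProduct.map (AlgHom.id k H)
      (Algebra.TensorProduct.map (AlgHom.id k H) Q.counit) (Q.twist F).P = 1 := by
  have e₁ : ∀ t, Algebra.TensorProduct.map (AlgHom.id k H)
      (Algebra.TensorProduct.map (AlgHom.id k H) Q.counit) (rightLeg Q.comul t) =
      Algebra.TensorProduct.map (AlgHom.id k H)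
        (Algebra.TensorProduct.includeLeft : H →ₐ[k] H ⊗[k] k) t := by
    intro t
    refine induction₂ t (fun x y => ?_) fun x y hx hy => ?_
    · rw [rightLeg_tmul, Algebra.TensorProduct.map_tmul, hQ.id_counit]; rfl
    · simp only [map_add, hx, hy]
  have e₂ : ∀ t, Algebra.TensorProduct.map (AlgHom.id k H)
      (Algebra.TensorProduct.map (AlgHom.id k H) Q.counit) (tensorOne₂ t) =
      Algebra.TensorProduct.map (AlgHom.id k H)
        (Algebra.TensorProduct.includeLeft : H →ₐ[k] H ⊗[k] k) t := by
    intro t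
    refine induction₂ t (fun x y => ?_) fun x y hx hy => ?_
    · simp
    · simp only [map_add, hx, hy]
  have e₃ : ∀ t, Algebra.TensorProduct.map (AlgHom.id k H)
      (Algebra.TensorProduct.map (AlgHom.id k H) Q.counit) (leftLeg H Q.comul t) =
      (Algebra.TensorProduct.assoc k k k H H k).toAlgHom (Algebra.TensorProduct.map Q.comul
        (AlgHom.id k k) (Algebra.TensorProduct.map (AlgHom.id k H) Q.counit t)) := by
    intro t
    refine induction₂ t (fun x y => ?_) fun x y hx hy => ?_
    · rw [leftLeg_tmul, Algebra.TensorProduct.map_tmul, Algebra.TensorProduct.map_tmul]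
      refine induction₂ (Q.comul x) (fun x y => rfl) fun x y hx hy => ?_
      simp only [map_add, TensorProduct.add_tmul, hx, hy]
    · simp only [map_add, hx, hy]
  rw [twist_P]
  simp only [map_mul]
  rw [e₁, e₂, e₃, hQ.counit_Phi₃, map_F'_eq_one hF.id_counit, map_one, map_one, mul_one, mul_one,
    oneTensor_apply, Algebra.TensorProduct.map_tmul, hF.id_counit, mul_assoc, map_F_mul, mul_one]
  rfl

end Counit

theorem IsQuasiBialgebra.twist (hQ : Q.IsQuasiBialgebra) (hF : Q.IsGaugeTransformation F) :
    (Q.twist F).IsQuasiBialgebra where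
  quasi_coassoc h := by
    rw [← twist_coassoc_mul hQ, Units.mul_inv_cancel_right]
  id_counit h := by
    rw [twist_comul]
    rw [twist_counit, map_mul, map_mul, hF.id_counit, map_F'_eq_one hF.id_counit, one_mul, mul_one, hQ.id_counit]
  counit_id h := by
    rw [twist_comul]
    rw [twist_counit, map_mul, map_mul, hF.counit_id, map_F'_eq_one hF.counit_id, one_mul, mul_one, hQ.counit_id]
  pentagon := twist_pentagon hQ
  counit_Phi₁ := by rw [twist_counit]; exact map_counit_id_twist_P hQ hF
  counit_Phi₂ := by rw [twist_counit]; exact map_id_counit_id_twist_P hQ hF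
  counit_Phi₃ := by rw [twist_counit]; exact map_id_id_counit_twist_P hQ hF

theorem IsGaugeTransformation.rightLeg_unitCounit (hF : Q.IsGaugeTransformation F) :
    rightLeg (Q.unitCounit B) (F : H ⊗[k] H) = 1 := by
  have key : ∀ t : H ⊗[k] H, rightLeg (Q.unitCounit B) t =
      rightLeg (Algebra.ofId k B) (Algebra.TensorProduct.map (AlgHom.id k H) Q.counit t) := by
    intro t
    refine induction₂ t (fun a b => rfl) fun x y hx hy => ?_
    simp only [map_add, hx, hy]
  rw [key, hF.id_counit, map_one]

theorem IsGaugeTransformation.map_unitCounit (hF : Q.IsGaugeTransformation F) :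
    Algebra.TensorProduct.map (Q.unitCounit B) (AlgHom.id k H) (F : H ⊗[k] H) = 1 := by
  have key : ∀ t : H ⊗[k] H, Algebra.TensorProduct.map (Q.unitCounit B) (AlgHom.id k H) t =
      Algebra.TensorProduct.map (Algebra.ofId k B) (AlgHom.id k H)
        (Algebra.TensorProduct.map Q.counit (AlgHom.id k H) t) := by
    intro t
    refine induction₂ t (fun a b => rfl) fun x y hx hy => ?_
    simp only [map_add, hx, hy]
  rw [key, hF.counit_id, map_one]

theorem IsGaugeTransformation.leftLeg_unitCounit (hF : Q.IsGaugeTransformation F) :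
    leftLeg H (Q.unitCounit (H ⊗[k] H)) (F : H ⊗[k] H) = 1 := by
  change Algebra.TensorProduct.assoc k k k H H H (Algebra.TensorProduct.map
    (Q.unitCounit (H ⊗[k] H)) (AlgHom.id k H) (F : H ⊗[k] H)) = 1
  rw [hF.map_unitCounit, map_one]

theorem IsAntipodal.mul_right_mulAt {v : H →ₐ[k] B} {σ : H →ₗ[k] B} {α β : B}
    (hA : Q.IsAntipodal v σ α β) (b : B) (u : H) (d : H ⊗[k] H) :
    (mulAt v.toLinearMap β ⋆ mulAt σ b) (d * Q.comul u) =
      (mulAt v.toLinearMap β ⋆ mulAt σ b) (d * Q.unitCounit (H ⊗[k] H) u) := by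
  rw [starMul_mulAt, hA.mul_right, starMul_mulAt]

end QuasiBialgebraData

namespace QuasiHopfData

variable {Q : QuasiHopfData k H} {F : (H ⊗[k] H)ˣ}

/-- c ↦ S(e₁) c e₂ is a right action of H ⊗ H, so the F⁻¹ in α_F cancels the F at the left of
Δ_F(h). -/
theorem SMul_SMul (c : H) (d e : H ⊗[k] H) : Q.SMul (Q.SMul c e) d = Q.SMul c (e * d) := by
  refine induction₂ d (fun x y => ?_) fun x y hx hy => ?_
  · refine induction₂ e (fun a b => by simp [SMul_tmul, S_mul, mul_assoc]) fun a b ha hb => ?_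
    simp only [SMul_tmul] at ha hb ⊢
    simp only [map_add, mul_add, add_mul, ha, hb]
  · simp only [map_add, mul_add, hx, hy]

theorem MulS_MulS (c : H) (d e : H ⊗[k] H) : Q.MulS (Q.MulS c e) d = Q.MulS c (d * e) := by
  refine induction₂ d (fun x y => ?_) fun x y hx hy => ?_
  · refine induction₂ e (fun a b => by simp [MulS_tmul, S_mul, mul_assoc]) fun a b ha hb => ?_
    simp only [MulS_tmul] at ha hb ⊢
    simp only [map_add, mul_add, add_mul, ha, hb]
  · simp only [map_add, add_mul, hx, hy]

theorem IsQuasiHopf.SMul_comul_mul (hQ : Q.IsQuasiHopf) (h : H) (d : H ⊗[k] H) :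
    Q.SMul Q.alpha (Q.comul h * d) = Q.counit h • Q.SMul Q.alpha d := by
  rw [← SMul_SMul, hQ.antipode_left]
  refine induction₂ d (fun x y => by simp [SMul_tmul]) fun x y hx hy => ?_
  simp only [map_add, smul_add, hx, hy]

theorem IsQuasiHopf.MulS_mul_comul (hQ : Q.IsQuasiHopf) (h : H) (d : H ⊗[k] H) :
    Q.MulS Q.beta (d * Q.comul h) = Q.counit h • Q.MulS Q.beta d := by
  rw [← MulS_MulS, hQ.antipode_right]
  refine induction₂ d (fun x y => by simp [MulS_tmul]) fun x y hx hy => ?_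
  simp only [map_add, smul_add, hx, hy]

theorem IsQuasiHopf.twist (hQ : Q.IsQuasiHopf) (hF : Q.IsGaugeTransformation F) :
    (Q.twist F).IsQuasiHopf where
  isQuasiBialgebra := hQ.isQuasiBialgebra.twist hF
  antipode_left h := by
    change Q.SMul (Q.SMul Q.alpha ↑F⁻¹) ((Q.toQuasiBialgebraData.twist F).comul h) =
      Q.counit h • Q.SMul Q.alpha ↑F⁻¹
    rw [SMul_SMul, QuasiBialgebraData.twist_comul, mul_assoc, Units.inv_mul_cancel_left,
      hQ.SMul_comul_mul]
  antipode_right h := by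
    change Q.MulS (Q.MulS Q.beta ↑F) ((Q.toQuasiBialgebraData.twist F).comul h) =
      Q.counit h • Q.MulS Q.beta ↑F
    rw [MulS_MulS, QuasiBialgebraData.twist_comul, Units.inv_mul_cancel_right, hQ.MulS_mul_comul]
  antipode_Phi := by
    have key : ∀ (d e : H ⊗[k] H) (t : H ⊗[k] (H ⊗[k] H)),
        LinearMap.mul' k H (TensorProduct.map (LinearMap.mulRight k (Q.MulS Q.beta e))
          (Q.SMul (Q.SMul Q.alpha d)) t) =
        (mulAt (AlgHom.id k H).toLinearMap Q.beta ⋆ (mulAt (Q.vS (AlgHom.id k H)) Q.alpha ⋆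
          (AlgHom.id k H).toLinearMap)) (oneTensor (H ⊗[k] H) d * (t * tensorOne₂ e)) := by
      intro d e t
      refine induction₃ t (fun t₁ t₂ t₃ => ?_) fun x y hx hy => ?_
      · refine induction₂ e (fun x y => ?_) fun x y hx hy => ?_
        · rw [TensorProduct.map_tmul, SMul_SMul]
          refine induction₂ d (fun z w => ?_) fun x y hx hy => ?_
          · simp [MulS_tmul, SMul_tmul, S_mul, mul_assoc]
          · simp only [map_add, TensorProduct.tmul_add, add_mul, hx, hy]
        · simp only [TensorProduct.map_tmul, LinearMap.mulRight_apply, LinearMap.mul'_apply]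
            at hx hy ⊢
          simp only [map_add, mul_add, add_mul, hx, hy]
      · simp only [map_add, add_mul, mul_add, hx, hy]
    have hA : Q.IsAntipodal (AlgHom.id k H) (Q.vS (AlgHom.id k H)) Q.alpha Q.beta :=
      hQ.isAntipodal (AlgHom.id k H)
    refine (key ↑F⁻¹ ↑F (Q.toQuasiBialgebraData.twist F).P).trans ?_
    rw [QuasiBialgebraData.twist_P]
    simp only [mul_assoc]
    -- The F⁻¹ of α_F and the F of β_F cancel the outer factors of Φ_F; then α absorbs (id ⊗ Δ)(F)
    -- and β absorbs (Δ ⊗ id)(F⁻¹).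
    rw [map_F'_mul F, mul_one, inv_mul_cancel_of_eq_one (map_F'_mul F _),
      starMul_rightLeg_congr hA.left_mul, hF.rightLeg_unitCounit, one_mul,
      starMul_mul_leftLeg_congr (hA.mul_right_mulAt _), map_F'_eq_one hF.leftLeg_unitCounit,
      mul_one]
    exact hQ.conj₃_beta (AlgHom.id k H)
  antipode_Phi_inv := by
    have key : ∀ (d e : H ⊗[k] H) (t : H ⊗[k] (H ⊗[k] H)),
        LinearMap.mul' k H (TensorProduct.map (LinearMap.mulRight k (Q.SMul Q.alpha d) ∘ₗ Q.S)
          (Q.MulS (Q.MulS Q.beta e)) t) =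
        (mulAt (Q.vS (AlgHom.id k H)) Q.alpha ⋆ (mulAt (AlgHom.id k H).toLinearMap Q.beta ⋆
          Q.vS (AlgHom.id k H))) (tensorOne₂ d * (t * oneTensor (H ⊗[k] H) e)) := by
      intro d e t
      refine induction₃ t (fun t₁ t₂ t₃ => ?_) fun x y hx hy => ?_
      · refine induction₂ d (fun x y => ?_) fun x y hx hy => ?_
        · rw [TensorProduct.map_tmul, MulS_MulS]
          refine induction₂ e (fun z w => ?_) fun x y hx hy => ?_
          · simp [MulS_tmul, SMul_tmul, S_mul, mul_assoc]
          · simp only [map_add, TensorProduct.tmul_add, mul_add, hx, hy]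
        · simp only [TensorProduct.map_tmul, LinearMap.mulRight_apply, LinearMap.mul'_apply,
            LinearMap.comp_apply] at hx hy ⊢
          simp only [map_add, mul_add, add_mul, hx, hy]
      · simp only [map_add, add_mul, mul_add, hx, hy]
    have hA : Q.IsAntipodal (AlgHom.id k H) (Q.vS (AlgHom.id k H)) Q.alpha Q.beta :=
      hQ.isAntipodal (AlgHom.id k H)
    refine (key ↑F⁻¹ ↑F (Q.toQuasiBialgebraData.twist F).P').trans ?_
    rw [QuasiBialgebraData.twist_P']
    simp only [mul_assoc]
    rw [map_F'_mul F, mul_one, inv_mul_cancel_of_eq_one (map_F'_mul F _),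
      starMul_leftLeg_congr (hA.left_mul_mulAt _), hF.leftLeg_unitCounit, one_mul,
      starMul_mul_rightLeg_congr hA.mul_right, map_F'_eq_one hF.rightLeg_unitCounit,
      mul_one]
    exact hQ.starMul_P' (AlgHom.id k H)

end QuasiHopfData

end

/-! ### Twisting module algebras, and the isomorphism. -/

section

variable {k H : Type*} [Field k] [Ring H] [Algebra k H]

theorem mul_eq_of_mulElt {M : Type*} [Monoid M] {F₁₂ G₁₂ F₂₃ G₂₃ F₃₄ G₃₄ a a' c c' l n p x : M}
    (h₂₃ : G₂₃ * F₂₃ = 1) (h₃₄ : G₃₄ * F₃₄ = 1) (ha : a' * a = 1) (h₁₂ : G₁₂ * F₁₂ = 1)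
    (hx : x * c = c' * x) :
    G₂₃ * (F₂₃ * (l * (x * (a' * G₃₄))) * (F₃₄ * (a * c * p * n * G₁₂) * G₃₄) * (F₃₄ * F₁₂)) =
      l * c' * (x * p * n) := by
  simp only [mul_assoc]
  rw [inv_mul_cancel_of_eq_one h₂₃, inv_mul_cancel_of_eq_one h₃₄, inv_mul_cancel_of_eq_one ha,
    inv_mul_cancel_of_eq_one h₃₄, h₁₂, mul_one, mul_mul_eq_of_mul_eq hx]

namespace QuasiBialgebraData

variable {Q : QuasiBialgebraData k H} {F : (H ⊗[k] H)ˣ}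

/-- `(id ⊗ Δ)(F⁻¹)(1 ⊗ F⁻¹) Φ_F = Φ (Δ ⊗ id)(F⁻¹)(F⁻¹ ⊗ 1)` -/
theorem inv_mul_twist_P : rightLeg Q.comul ↑F⁻¹ * (oneTensor (H ⊗[k] H) ↑F⁻¹ * (Q.twist F).P) =
    Q.P * (leftLeg H Q.comul ↑F⁻¹ * tensorOne₂ ↑F⁻¹) := by
  rw [twist_P]
  simp only [mul_assoc]
  rw [inv_mul_cancel_of_eq_one (map_F'_mul F _), inv_mul_cancel_of_eq_one (map_F'_mul F _)]

end QuasiBialgebraData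

namespace ModuleAlgebraData

variable {A B : Type*} [AddCommGroup A] [Module k A] [AddCommGroup B] [Module k B]
  {M : ModuleAlgebraData k H A} {N : ModuleAlgebraData k H B} {Q : QuasiBialgebraData k H}
  {F : (H ⊗[k] H)ˣ}

theorem twist_mul_apply (z : A ⊗[k] A) :
    (M.twist F).mul z = M.mul (tensAct M.act M.act ↑F⁻¹ z) := rfl

theorem IsHom.twist {f : A →ₗ[k] B} (hf : IsHom M N f) (F : (H ⊗[k] H)ˣ) :
    IsHom (M.twist F) (N.twist F) f where
  act := hf.act
  mul a a' := by
    rw [twist_mul_apply, hf.mul', tensAct_map hf.act hf.act]; rfl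
  one := hf.one

theorem IsModuleAlgebra.tensAct_one_left (hM : M.IsModuleAlgebra Q) {U : Type*} [AddCommGroup U]
    [Module k U] (ρ : H →ₐ[k] Module.End k U) (t : H ⊗[k] H) (u : U) :
    tensAct M.act ρ t (M.one ⊗ₜ u) = tensAct M.act ρ
      (Algebra.TensorProduct.map (Q.unitCounit H) (AlgHom.id k H) t) (M.one ⊗ₜ u) := by
  refine induction₂ t (fun x y => ?_) fun x y hx hy => ?_
  · rw [Algebra.TensorProduct.map_tmul, tensAct_tmul, tensAct_tmul, hM.act_one,
      QuasiBialgebraData.unitCounit_apply, AlgHom.commutes]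
    rfl
  · simp only [map_add, LinearMap.add_apply, hx, hy]

theorem IsModuleAlgebra.tensAct_one_right (hM : M.IsModuleAlgebra Q) {U : Type*} [AddCommGroup U]
    [Module k U] (ρ : H →ₐ[k] Module.End k U) (t : H ⊗[k] H) (u : U) :
    tensAct ρ M.act t (u ⊗ₜ M.one) = tensAct ρ M.act
      (rightLeg (Q.unitCounit H) t) (u ⊗ₜ M.one) := by
  refine induction₂ t (fun x y => ?_) fun x y hx hy => ?_
  · rw [rightLeg_tmul, tensAct_tmul, tensAct_tmul, hM.act_one,
      QuasiBialgebraData.unitCounit_apply, AlgHom.commutes]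
    rfl
  · simp only [map_add, LinearMap.add_apply, hx, hy]

/-- The new bracketings are the old ones preceded by (Δ ⊗ id)(F⁻¹)(F⁻¹ ⊗ 1) and by (id ⊗ Δ)(F⁻¹)(1 ⊗
F⁻¹); Φ_F is exactly what matches them (`inv_mul_twist_P`). -/
theorem IsModuleAlgebra.twist (hM : M.IsModuleAlgebra Q) (hF : Q.IsGaugeTransformation F) :
    (M.twist F).IsModuleAlgebra (Q.twist F) where
  quasi_assoc a b c := by
    have h₁ : ∀ d e : H ⊗[k] H, M.mul (tensAct M.act M.act d
        (M.mul (tensAct M.act M.act e (a ⊗ₜ b)) ⊗ₜ c)) =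
        M.mulLeft₃ (M.act₃ (leftLeg H Q.comul d * tensorOne₂ e) (a ⊗ₜ (b ⊗ₜ c))) := by
      intro d e
      refine induction₂ e (fun x y => ?_) fun x y hx hy => ?_
      · rw [tensAct_tmul, M.mul_tensAct_left hM.act_mul, map_mul, Module.End.mul_apply,
          tensorOne₂_tmul, tensAct_tmul, tensAct_tmul, map_one, Module.End.one_apply]
      · simp only [map_add, LinearMap.add_apply, TensorProduct.add_tmul, mul_add, hx, hy]
    have h₂ : ∀ (d e : H ⊗[k] H) (z : A ⊗[k] (A ⊗[k] A)), M.mul (tensAct M.act M.act d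
        (TensorProduct.map LinearMap.id (M.mul ∘ₗ tensAct M.act M.act e) z)) =
        M.mulRight₃ (M.act₃ (rightLeg Q.comul d * oneTensor (H ⊗[k] H) e) z) := by
      intro d e z
      refine induction₃ z (fun a b c => ?_) fun x y hx hy => ?_
      · rw [TensorProduct.map_tmul, LinearMap.comp_apply]
        refine induction₂ e (fun x y => ?_) fun x y hx hy => ?_
        · rw [tensAct_tmul, LinearMap.id_apply, M.mul_tensAct_right hM.act_mul, map_mul,
            Module.End.mul_apply, oneTensor_apply, tensAct_tmul, tensAct_tmul, map_one,
            Module.End.one_apply]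
        · simp only [map_add, LinearMap.add_apply, TensorProduct.tmul_add, mul_add, hx, hy]
      · simp only [map_add, hx, hy]
    have h₃ : ∀ z, M.mulLeft₃ z = M.mulRight₃ (M.act₃ Q.P z) := by
      intro z
      refine induction₃ z (fun a b c => ?_) fun x y hx hy => ?_
      · rw [mulLeft₃_tmul]; exact hM.quasi_assoc a b c
      · simp only [map_add, hx, hy]
    refine (h₁ ↑F⁻¹ ↑F⁻¹).trans (Eq.trans ?_ (h₂ ↑F⁻¹ ↑F⁻¹ _).symm)
    rw [h₃]
    change _ = M.mulRight₃ (M.act₃ _ (M.act₃ (Q.twist F).P _))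
    rw [← Module.End.mul_apply, ← Module.End.mul_apply, ← map_mul, ← map_mul, mul_assoc,
      QuasiBialgebraData.inv_mul_twist_P]
  one_mul a := by
    rw [twist_mul_apply]
    change M.mul (tensAct M.act M.act _ (M.one ⊗ₜ a)) = a
    rw [hM.tensAct_one_left, map_F'_eq_one hF.map_unitCounit, map_one, Module.End.one_apply,
      hM.one_mul]
  mul_one a := by
    rw [twist_mul_apply]
    change M.mul (tensAct M.act M.act _ (a ⊗ₜ M.one)) = a
    rw [hM.tensAct_one_right, map_F'_eq_one hF.rightLeg_unitCounit, map_one, Module.End.one_apply,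
      hM.mul_one]
  act_mul h a b := by
    have e : ∀ z, M.act h (M.mul z) = M.mul (tensAct M.act M.act (Q.comul h) z) := by
      intro z
      refine induction₂ z (fun x y => hM.act_mul h x y) fun x y hx hy => ?_
      simp only [map_add, hx, hy]
    rw [twist_mul_apply, QuasiBialgebraData.twist_comul]
    change M.act h (M.mul _) = M.mul (tensAct M.act M.act _ (tensAct M.act M.act _ _))
    rw [e, ← Module.End.mul_apply, ← Module.End.mul_apply, ← map_mul, ← map_mul, mul_assoc,
      Units.inv_mul_cancel_left]
  act_one h := hM.act_one h

end ModuleAlgebraData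

namespace QuasiHopfData

variable {Q : QuasiHopfData k H} {F : (H ⊗[k] H)ˣ} {B : Type*} [Ring B] [Algebra k B]

/-- `b ↦ d₁ b S(d₂)`. -/
def sandwichAt (Q : QuasiHopfData k H) (v : H →ₐ[k] B) (d : H ⊗[k] H) : B →ₗ[k] B where
  toFun b := (mulAt v.toLinearMap b ⋆ Q.vS v) d
  map_add' b b' := by rw [mulAt_add, add_starMul, LinearMap.add_apply]
  map_smul' c b := by rw [mulAt_smul, smul_starMul, LinearMap.smul_apply, RingHom.id_apply]

theorem sandwichAt_apply (v : H →ₐ[k] B) (d : H ⊗[k] H) (b : B) :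
    Q.sandwichAt v d b = (mulAt v.toLinearMap b ⋆ Q.vS v) d := rfl

theorem sandwichAt_tmul (v : H →ₐ[k] B) (x y : H) (b : B) :
    Q.sandwichAt v (x ⊗ₜ y) b = v x * b * v (Q.S y) := rfl

theorem sandwichAt_add (v : H →ₐ[k] B) (d e : H ⊗[k] H) (b : B) :
    Q.sandwichAt v (d + e) b = Q.sandwichAt v d b + Q.sandwichAt v e b := 
    map_add (mulAt v.toLinearMap b ⋆ Q.vS v) d e

theorem sandwichAt_mul (v : H →ₐ[k] B) (d e : H ⊗[k] H) (b : B) :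
    Q.sandwichAt v (d * e) b = Q.sandwichAt v d (Q.sandwichAt v e b) :=
  Q.sandwich_vS_mul v d e b

theorem sandwichAt_one (v : H →ₐ[k] B) (b : B) : Q.sandwichAt v 1 b = b := by
  rw [Algebra.TensorProduct.one_def, sandwichAt_tmul, S_one, map_one, one_mul, mul_one]

theorem sandwichAt_injective (v : H →ₐ[k] B) (F : (H ⊗[k] H)ˣ) :
    Function.Injective (Q.sandwichAt v ↑F) := by
  intro b b' h
  have e := congrArg (Q.sandwichAt v ↑F⁻¹) h
  rwa [← sandwichAt_mul, ← sandwichAt_mul, Units.inv_mul, sandwichAt_one, sandwichAt_one] at e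

theorem map_sandwich (v : H →ₐ[k] B) (d : H ⊗[k] H) (h : H) :
    v (Q.sandwich d h) = Q.sandwichAt v d (v h) := by
  simp only [sandwichAt_apply]
  refine induction₂ d (fun x y => by simp [sandwich_tmul]) fun x y hx hy => ?_
  simp only [map_add, LinearMap.add_apply, hx, hy]

/-- On the left, F⁻¹ in the middle legs comes from α_F, and the two copies of F from the arguments
F¹ b S(F²) and F¹ b' S(F²). On the right, what precedes `mulElt` has a Δ in the middle legs, ready
to be absorbed by α. -/
theorem inv_mul_twist_mulElt (hQ : Q.IsQuasiBialgebra) :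
    oneTensor (H ⊗[k] (H ⊗[k] H)) (tensorOne₂ ↑F⁻¹) * ((Q.twist F).mulElt *
      (tensorOne (H ⊗[k] H) ↑F * oneTensor (H ⊗[k] (H ⊗[k] H)) (oneTensor (H ⊗[k] H) ↑F))) =
    rightLeg (leftLeg H Q.comul) (oneTensor (H ⊗[k] H) ↑F * rightLeg Q.comul ↑F) *
      (Q.mulElt * leftLeg (H ⊗[k] H) Q.comul (rightLeg Q.comul ↑F⁻¹)) := by
  have e₁ : (Q.twist F).mulElt = oneTensor (k := k) (H := H) (H ⊗[k] (H ⊗[k] H))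
      (Q.toQuasiBialgebraData.twist F).P' *
      rightLeg (rightLeg (Q.toQuasiBialgebraData.twist F).comul)
        (Q.toQuasiBialgebraData.twist F).P := rfl
  have e₂ : Q.mulElt = oneTensor (H ⊗[k] (H ⊗[k] H)) Q.P' *
      rightLeg (rightLeg Q.comul) Q.P := rfl
  have e₃ : oneTensor (H ⊗[k] (H ⊗[k] H)) Q.P' *
      rightLeg ((rightLeg Q.comul).comp Q.comul) (F : H ⊗[k] H) =
      rightLeg ((leftLeg H Q.comul).comp Q.comul) (F : H ⊗[k] H) *
        oneTensor (H ⊗[k] (H ⊗[k] H)) Q.P' :=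
    (rightLeg_mul_oneTensor (fun x => hQ.coassoc_mul' x) _).symm
  have e₄ : rightLeg (leftLeg H Q.comul) (oneTensor (H ⊗[k] H) ↑F * rightLeg Q.comul ↑F) =
      oneTensor (H ⊗[k] (H ⊗[k] H)) (leftLeg H Q.comul ↑F) *
        rightLeg ((leftLeg H Q.comul).comp Q.comul) (F : H ⊗[k] H) := by
    rw [map_mul, rightLeg_oneTensor, rightLeg_comp]
  have e₅ : oneTensor (k := k) (H := H) (H ⊗[k] (H ⊗[k] H))
      (Q.toQuasiBialgebraData.twist F).P' =
      oneTensor (H ⊗[k] (H ⊗[k] H)) (tensorOne₂ (F : H ⊗[k] H)) *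
        (oneTensor (H ⊗[k] (H ⊗[k] H)) (leftLeg H Q.comul ↑F) *
        (oneTensor (H ⊗[k] (H ⊗[k] H)) Q.P' *
        (oneTensor (H ⊗[k] (H ⊗[k] H)) (rightLeg Q.comul ((F⁻¹ : (H ⊗[k] H)ˣ) : H ⊗[k] H)) *
        oneTensor (H ⊗[k] (H ⊗[k] H)) (oneTensor (H ⊗[k] H) ↑F⁻¹)))) := by
    rw [QuasiBialgebraData.twist_P', map_mul, map_mul, map_mul, map_mul]
  rw [e₁, e₂, e₄, e₅, QuasiBialgebraData.rightLeg_rightLeg_twist_P, leftLeg_rightLeg]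
  have i₁ : oneTensor (k := k) (H := H) (H ⊗[k] (H ⊗[k] H)) (tensorOne₂ ↑F⁻¹) *
      oneTensor (H ⊗[k] (H ⊗[k] H)) (tensorOne₂ ↑F) = 1 :=
    map_F'_mul F ((oneTensor (H ⊗[k] (H ⊗[k] H))).comp tensorOne₂)
  have i₂ : oneTensor (k := k) (H := H) (H ⊗[k] (H ⊗[k] H)) (oneTensor (H ⊗[k] H) ↑F⁻¹) *
      oneTensor (H ⊗[k] (H ⊗[k] H)) (oneTensor (H ⊗[k] H) ↑F) = 1 :=
    map_F'_mul F ((oneTensor (H ⊗[k] (H ⊗[k] H))).comp (oneTensor (H ⊗[k] H)))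
  have i₃ : oneTensor (k := k) (H := H) (H ⊗[k] (H ⊗[k] H)) (rightLeg Q.comul ↑F⁻¹) *
      oneTensor (H ⊗[k] (H ⊗[k] H)) (rightLeg Q.comul ↑F) = 1 :=
    map_F'_mul F ((oneTensor (H ⊗[k] (H ⊗[k] H))).comp (rightLeg Q.comul))
  have i₄ : tensorOne (H ⊗[k] H) ↑F * oneTensor (H ⊗[k] (H ⊗[k] H))
      (oneTensor (k := k) (H := H) (H ⊗[k] H) ↑F) = oneTensor (H ⊗[k] (H ⊗[k] H))
        (oneTensor (H ⊗[k] H) ↑F) * tensorOne (H ⊗[k] H) ↑F :=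
    tensorOne_mul_oneTensor _ _
  have i₅ : tensorOne (H ⊗[k] H) ↑F⁻¹ * tensorOne (H ⊗[k] H) (F : H ⊗[k] H) = 1 :=
    map_F'_mul F _
  rw [i₄]
  exact mul_eq_of_mulElt i₁ i₂ i₃ i₅ e₃

/-- `b ↦ F¹ b S(F²)` is a homomorphism from the twist of the algebra afforded by `v` to the algebra
afforded by `v` and the twisted quasi-Hopf algebra. -/
theorem IsQuasiHopf.isHom_sandwichAt (hQ : Q.IsQuasiHopf) (hF : Q.IsGaugeTransformation F)
    (v : H →ₐ[k] B) : ModuleAlgebraData.IsHom ((Q.adjointAlgebra v).twist F)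
      ((Q.twist F).adjointAlgebra v) (Q.sandwichAt v ↑F) where
  act h b := by
    have e : ((Q.twist F).adjointAlgebra v).act h (Q.sandwichAt v ↑F b) =
        Q.sandwichAt v ((Q.toQuasiBialgebraData.twist F).comul h) (Q.sandwichAt v ↑F b) := rfl
    rw [e, QuasiBialgebraData.twist_comul, ← sandwichAt_mul, Units.inv_mul_cancel_right,
      sandwichAt_mul]
    rfl
  one := by
    rw [sandwichAt_apply]
    exact Q.starMul_vS v Q.beta ↑F
  mul b b' := by
    have hq := hQ.isQuasiBialgebra
    have h₁ : ∀ (d : H ⊗[k] H) (t : H ⊗[k] (H ⊗[k] (H ⊗[k] H))),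
        Q.sandwichAt v d (Q.conj₄ v Q.alpha t b b') = Q.conj₄ v Q.alpha
          (rightLeg (leftLeg H (Q.unitCounit (H ⊗[k] H))) (rightLeg Q.comul d) * t) b b' := by
      intro d t
      refine induction₂ d (fun x y => ?_) fun x y hx hy => ?_
      · rw [rightLeg_tmul, rightLeg_tmul, hq.leftLeg_unitCounit_comul]
        refine induction₄ t (fun t₁ t₂ t₃ t₄ => ?_) fun x y hx hy => ?_
        · simp [sandwichAt_tmul, conj₄_apply, S_mul, mul_assoc]
        · simp only [conj₄_apply] at hx hy ⊢
          simp only [map_add, mul_add, hx, hy]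
      · simp only [sandwichAt_apply, conj₄_apply] at hx hy ⊢
        simp only [map_add, add_mul, hx, hy]
    have h₃ : ∀ (c d e : H ⊗[k] H) (t : H ⊗[k] (H ⊗[k] (H ⊗[k] H))),
        Q.conj₄ v (Q.SMul Q.alpha c) t (Q.sandwichAt v d b) (Q.sandwichAt v e b') =
        Q.conj₄ v Q.alpha (oneTensor (H ⊗[k] (H ⊗[k] H)) (tensorOne₂ c) * (t *
          (tensorOne (H ⊗[k] H) d * oneTensor (H ⊗[k] (H ⊗[k] H)) (oneTensor (H ⊗[k] H) e))))
          b b' := by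
      intro c d e t
      refine induction₄ t (fun t₁ t₂ t₃ t₄ => ?_) fun x y hx hy => ?_
      · refine induction₂ d (fun d₁ d₂ => ?_) fun x y hx hy => ?_
        · refine induction₂ e (fun e₁ e₂ => ?_) fun x y hx hy => ?_
          · rw [conj₄_apply]
            simp only [starMul_tmul, mulAt_apply]
            refine induction₂ c (fun c₁ c₂ => ?_) fun x y hx hy => ?_
            · simp [sandwichAt_tmul, conj₄_apply, SMul_tmul, tensorOne_apply, S_mul, mul_assoc]
            · simp only [conj₄_apply] at hx hy ⊢
              simp only [map_add, add_mul, mul_add, hx, hy]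
          · simp only [conj₄_apply] at hx hy ⊢
            simp only [sandwichAt_add, mulAt_add, add_starMul, starMul_add, LinearMap.add_apply,
              map_add, mul_add, hx, hy]
        · simp only [conj₄_apply] at hx hy ⊢
          simp only [sandwichAt_add, mulAt_add, add_starMul, LinearMap.add_apply, map_add,
            add_mul, mul_add, hx, hy]
      · simp only [conj₄_apply] at hx hy ⊢
        simp only [map_add, add_mul, mul_add, hx, hy]
    have h₄ := h₃ ↑F⁻¹ ↑F ↑F (Q.twist F).mulElt
    rw [ModuleAlgebraData.twist_mul_apply]
    refine Eq.trans ?_ h₄.symm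
    rw [inv_mul_twist_mulElt hq]
    have h₅ := lift_conj₄_tensAct (Q := Q) v b b' Q.mulElt ↑F⁻¹
    change TensorProduct.lift (Q.conj₄ v Q.alpha Q.mulElt) _ = _ at h₅
    change Q.sandwichAt v _ (TensorProduct.lift (Q.conj₄ v Q.alpha Q.mulElt) _) = _
    -- α turns the middle Δ into ε. This trivializes the factor from 1 ⊗ F and leaves F acting on
    -- the whole product, as in `h₁`.
    rw [h₅, h₁, conj₄_apply, conj₄_apply, starMul_rightLeg_congr
      (starMul_leftLeg_congr ((hQ.isAntipodal v).left_mul_mulAt b') _) _ (_ * _)]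
    rw [map_mul (rightLeg _) (oneTensor (H ⊗[k] H) (F : H ⊗[k] H)), rightLeg_oneTensor,
      hF.leftLeg_unitCounit, map_one, one_mul]

end QuasiHopfData

namespace ModuleAlgebraData

variable {A B C : Type*} [AddCommGroup A] [Module k A] [AddCommGroup B] [Module k B]
  [AddCommGroup C] [Module k C]
  {M : ModuleAlgebraData k H A} {N : ModuleAlgebraData k H B} {P : ModuleAlgebraData k H C}

/-- Makes `twistDiamond` a homomorphism without any computation inside the two diamond products. -/
theorem IsHom.of_comp {f : A →ₗ[k] B} {g : B →ₗ[k] C} (hg : IsHom N P g)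
    (hi : Function.Injective g) (hgf : IsHom M P (g ∘ₗ f)) : IsHom M N f where
  act h a := hi (by rw [hg.act]; exact hgf.act h a)
  mul a a' := hi (by rw [hg.mul]; exact hgf.mul a a')
  one := hi (by rw [hg.one]; exact hgf.one)

end ModuleAlgebraData

open ModuleAlgebraData

variable {A : Type*} [AddCommGroup A] [Module k A]
  {Q : QuasiHopfData k H} {F : (H ⊗[k] H)ˣ} {M : ModuleAlgebraData k H A}

theorem isHom_smashMap (hQ : Q.IsQuasiHopf) (hM : M.IsModuleAlgebra Q.toQuasiBialgebraData) :
    IsHom (M.diamond Q) (Q.adjointAlgebra (M.smashAct Q.toQuasiBialgebraData)) (smashMap M Q) :=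
  (hQ.adjointAlgebra_isModuleAlgebra _).isHom_twistedTensor (isHom_smashHom hQ hM)
    (QuasiHopfData.isHom_adjointAlgebra _)
    (hQ.mulMap_diamondTwisting _ (isHom_smashHom hQ hM).act)

/-- The map `a ⊗ h ↦ F¹ · a ⊗ F² ▷ h` followed by `h ↦ F¹ h S(F²)` on the second factor. -/
def twistDiamond (Q : QuasiHopfData k H) (M : ModuleAlgebraData k H A) (F : (H ⊗[k] H)ˣ) :
    A ⊗[k] H ≃ₗ[k] A ⊗[k] H :=
  LinearEquiv.ofLinearMap
    (TensorProduct.map LinearMap.id (Q.sandwich ↑F) ∘ₗ tensAct M.act Q.H₀.act ↑F)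
    (tensAct M.act Q.H₀.act ↑F⁻¹ ∘ₗ TensorProduct.map LinearMap.id (Q.sandwich ↑F⁻¹))
    (by
      refine LinearMap.ext fun z => ?_
      have e : ∀ w, tensAct M.act Q.H₀.act ↑F (tensAct M.act Q.H₀.act ↑F⁻¹ w) = w := fun w => by
        rw [← Module.End.mul_apply, map_F_mul, Module.End.one_apply]
      simp only [LinearMap.comp_apply, LinearMap.id_apply, e]
      refine induction₂ z (fun a h => ?_) fun x y hx hy => ?_
      · simp only [TensorProduct.map_tmul, LinearMap.id_apply,
          ← Module.End.mul_apply, map_F_mul, Module.End.one_apply]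
      · simp only [map_add, hx, hy])
    (by
      refine LinearMap.ext fun z => ?_
      have e : ∀ w : A ⊗[k] H, TensorProduct.map LinearMap.id (Q.sandwich ↑F⁻¹)
          (TensorProduct.map LinearMap.id (Q.sandwich ↑F) w) = w := fun w => by
        refine induction₂ w (fun a h => ?_) fun x y hx hy => ?_
        · simp only [TensorProduct.map_tmul, LinearMap.id_apply,
            ← Module.End.mul_apply, map_F'_mul, Module.End.one_apply]
        · simp only [map_add, hx, hy]
      simp only [LinearMap.comp_apply, LinearMap.id_apply, e]
      rw [← Module.End.mul_apply, map_F'_mul, Module.End.one_apply])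

theorem twistDiamond_apply (z : A ⊗[k] H) : twistDiamond Q M F z =
    TensorProduct.map LinearMap.id (Q.sandwich ↑F) (tensAct M.act Q.H₀.act ↑F z) := rfl

/-- The homomorphism from `A_{F⁻¹} ◇ (H_F)₀` induced by `smashHom`. -/
def twistSmashMap (M : ModuleAlgebraData k H A) (Q : QuasiHopfData k H) (F : (H ⊗[k] H)ˣ) :
    A ⊗[k] H →ₗ[k] Module.End k (A ⊗[k] H) :=
  ((Q.twist F).adjointAlgebra (M.smashAct Q.toQuasiBialgebraData)).mulMap
    (Q.sandwichAt (M.smashAct Q.toQuasiBialgebraData) ↑F ∘ₗ smashHom M Q)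
    (M.smashAct Q.toQuasiBialgebraData).toLinearMap

theorem isHom_twistSmashMap (hQ : Q.IsQuasiHopf) (hF : Q.IsGaugeTransformation F)
    (hM : M.IsModuleAlgebra Q.toQuasiBialgebraData) :
    IsHom ((M.twist F).diamond (Q.twist F))
      ((Q.twist F).adjointAlgebra (M.smashAct Q.toQuasiBialgebraData)) (twistSmashMap M Q F) := by
  have hi := (hQ.isHom_sandwichAt hF (M.smashAct Q.toQuasiBialgebraData)).comp
    ((isHom_smashHom hQ hM).twist F)
  have hQF := hQ.twist hF
  exact (hQF.adjointAlgebra_isModuleAlgebra _).isHom_twistedTensor hi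
    (QuasiHopfData.isHom_adjointAlgebra _) (hQF.mulMap_diamondTwisting _ hi.act)

/-- In (B^v)_{F⁻¹} the product of the images of F¹·a and F² ▷ h is the untwisted product of the
images of a and h, and `sandwichAt` carries v(h) to v(F¹ h S(F²)). These two facts dictate the two
factors of `twistDiamond`. -/
theorem twistSmashMap_twistDiamond (hQ : Q.IsQuasiHopf) (hF : Q.IsGaugeTransformation F)
    (hM : M.IsModuleAlgebra Q.toQuasiBialgebraData) (z : A ⊗[k] H) :
    twistSmashMap M Q F (twistDiamond Q M F z) =
      Q.sandwichAt (M.smashAct Q.toQuasiBialgebraData) ↑F (smashMap M Q z) := by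
  have h₁ : ∀ w : A ⊗[k] H, twistSmashMap M Q F
      (TensorProduct.map LinearMap.id (Q.sandwich ↑F) w) =
      Q.sandwichAt (M.smashAct Q.toQuasiBialgebraData) ↑F
        (((Q.adjointAlgebra (M.smashAct Q.toQuasiBialgebraData)).twist F).mul
          (TensorProduct.map (smashHom M Q) (M.smashAct Q.toQuasiBialgebraData).toLinearMap w)) := by
    intro w
    refine induction₂ w (fun a h => ?_) fun x y hx hy => ?_
    · rw [TensorProduct.map_tmul, twistSmashMap, mulMap_tmul, TensorProduct.map_tmul,
        (hQ.isHom_sandwichAt hF (M.smashAct Q.toQuasiBialgebraData)).mul]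
      simp only [AlgHom.toLinearMap_apply, QuasiHopfData.map_sandwich]
      rfl
    · simp only [map_add, hx, hy]
  rw [twistDiamond_apply, h₁, twist_mul_apply, tensAct_map (isHom_smashHom hQ hM).act
    (QuasiHopfData.isHom_adjointAlgebra (M.smashAct Q.toQuasiBialgebraData)).act,
    ← Module.End.mul_apply, map_F'_mul, Module.End.one_apply]
  rfl

theorem twistSmashMap_injective (hQ : Q.IsQuasiHopf) (hF : Q.IsGaugeTransformation F)
    (hM : M.IsModuleAlgebra Q.toQuasiBialgebraData) :
    Function.Injective (twistSmashMap M Q F) := by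
  intro z z' h
  rw [← (twistDiamond Q M F).apply_symm_apply z, ← (twistDiamond Q M F).apply_symm_apply z',
    twistSmashMap_twistDiamond hQ hF hM, twistSmashMap_twistDiamond hQ hF hM] at h
  exact (twistDiamond Q M F).symm.injective
    (smashMap_injective hQ hM (QuasiHopfData.sandwichAt_injective _ F h))

theorem isHom_twistDiamond (hQ : Q.IsQuasiHopf) (hF : Q.IsGaugeTransformation F)
    (hM : M.IsModuleAlgebra Q.toQuasiBialgebraData) :
    IsHom ((M.diamond Q).twist F) ((M.twist F).diamond (Q.twist F))
      (twistDiamond Q M F).toLinearMap := by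
  refine (isHom_twistSmashMap hQ hF hM).of_comp (twistSmashMap_injective hQ hF hM) ?_
  have e : twistSmashMap M Q F ∘ₗ (twistDiamond Q M F).toLinearMap =
      Q.sandwichAt (M.smashAct Q.toQuasiBialgebraData) ↑F ∘ₗ smashMap M Q :=
    LinearMap.ext fun z => twistSmashMap_twistDiamond hQ hF hM z
  rw [e]
  exact (hQ.isHom_sandwichAt hF _).comp ((isHom_smashMap hQ hM).twist F)

end

end QuasiHopf

end

theorem proposition3p5 {k H A : Type*} [Field k] [Ring H] [Algebra k H]
    [AddCommGroup A] [Module k A]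
    (Q : QuasiHopf.QuasiHopfData k H) (hQ : Q.IsQuasiHopf)
    (F : (H ⊗[k] H)ˣ) (hF : Q.IsGaugeTransformation F)
    (M : QuasiHopf.ModuleAlgebraData k H A) (hM : M.IsModuleAlgebra Q.toQuasiBialgebraData) :
    (Q.twist F).IsQuasiHopf ∧
    (M.diamond Q).IsModuleAlgebra Q.toQuasiBialgebraData ∧
    (M.twist F).IsModuleAlgebra (Q.twist F).toQuasiBialgebraData ∧
    ((M.diamond Q).twist F).IsModuleAlgebra (Q.twist F).toQuasiBialgebraData ∧
    ((M.twist F).diamond (Q.twist F)).IsModuleAlgebra (Q.twist F).toQuasiBialgebraData ∧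
    ((M.diamond Q).twist F).Isomorphic ((M.twist F).diamond (Q.twist F)) := by
  have hQF := hQ.twist hF
  have hMQ := (QuasiHopf.isHom_smashMap hQ hM).isModuleAlgebra
    (QuasiHopf.smashMap_injective hQ hM) (hQ.adjointAlgebra_isModuleAlgebra _)
  have he := QuasiHopf.isHom_twistDiamond hQ hF hM
  exact ⟨hQF, hMQ, hM.twist hF, hMQ.twist hF,
    (QuasiHopf.isHom_twistSmashMap hQ hF hM).isModuleAlgebra
      (QuasiHopf.twistSmashMap_injective hQ hF hM) (hQF.adjointAlgebra_isModuleAlgebra _),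
    QuasiHopf.twistDiamond Q M F, he.mul, he.one, he.act⟩
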